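/- Let $\mathcal H$ be a separable Hilbert space over $\mathbb K\in\{\mathbb R,\mathbb C\}$ and let $(\mathcal A,\mathcal B)$ be a boundary control system with $m$ inputs. That is, $\mathcal A:D(\mathcal A)\subset\mathcal H\to\mathcal H$ and $\mathcal B:D(\mathcal B)\subset\mathcal H\to\mathbb K^m$ are linear with $D(\mathcal A)\subset D(\mathcal B)$; the disturbance-free operator $\mathcal A_0=\mathcal A|_{D(\mathcal A)\cap\ker\mathcal B}$ generates a $C_0$-semigroup; and there is a bounded lifting operator $B:\mathbb K^m\to\mathcal H$ with range in $D(\mathcal A)$, $\mathcal AB$ bounded and $\mathcal BB=I$. Assume: (A1) $\mathcal A_0$ is a Riesz-spectral operator: it is closed, it has eigenvectors $\phi_n$ with eigenvalues $\lambda_n$, $n\ge 1$ (repetitions allowed), the $\phi_n$ form a Riesz basis of $\mathcal H$, and the closure of $\{\lambda_n\}$ contains no segment $[a,b]$ with $a\neq b$. Let $(\psi_n)$ be the biorthogonal sequence, $\langle\phi_k,\psi_l\rangle=\delta_{kl}$. (A2) There are $N_0\ge 1$ and $\alpha>0$ with $\operatorname{Re}\lambda_n\le-\alpha$ for all $n\ge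 N_0+1$. (A3) With $A_{N_0}=\operatorname{diag}(\lambda_1,\dots,\lambda_{N_0})$ and $B_{N_0}=(-\lambda_n\langle Be_k,\psi_n\rangle+\langle\mathcal ABe_k,\psi_n\rangle)_{1\le n\le N_0,\,1\le k\le m}$, the pair $(A_{N_0},B_{N_0})$ satisfies the Kalman rank condition. Let $D>0$. Then there are matrices $K\in\mathbb K^{m\times N_0}$ such that $A_{\rm cl}=A_{N_0}+e^{-DA_{N_0}}B_{N_0}K$ is Hurwitz. For each such $K$ there is $\kappa_0>0$ such that, for every $t_0>0$ and every $\varphi\in C^2([-D,\infty);\mathbb R)$ with $0\le\varphi\le1$, $\varphi=0$ on $[-D,0]$ and $\varphi=1$ on $[t_0,\infty)$, there are constants $\overline C_1,\overline C_2,\overline C_3,\overline C_4\ge0$ with the following property. For all $X_0\in D(\mathcal A_0)$ and $d\in C^1([0,\infty);\mathcal H)$, the closed-loop system $$X'(t)=\mathcal AX(t)+d(t),\qquad \mathcal BX(t)=u(t-D),\qquad X(0)=X_0,\qquad u|_{[-D,0]}=0,$$ $$u(t)=\varphi(t)KZ(t),\qquad Z(t)=Y(t)+\int_{t-D}^{t}e^{(t-s-D)A_{N_0}}B_{N_0}u(s)\,ds,\qquad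 Y(t)=\big(\langle X(t),\psi_n\rangle\big)_{1\le n\le N_0}\qquad(t\ge0)$$ has a unique solution $(X,u)$ with $X\in C^0([0,\infty);D(\mathcal A))\cap C^1([0,\infty);\mathcal H)$ and $u$ locally integrable on $[-D,\infty)$, and for all $t\ge0$ $$\|X(t)\|\le\overline C_1e^{-\kappa_0t}\|X_0\|+\overline C_2\sup_{\tau\in[0,t]}\|d(\tau)\|,\qquad \|u(t)\|\le\overline C_3e^{-\kappa_0t}\|X_0\|+\overline C_4\sup_{\tau\in[0,t]}\|d(\tau)\|.$$ -/

import Mathlib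

open Set Filter Topology

noncomputable section

namespace DelayBoundaryControl

section Operators

variable {𝕜 : Type*} [RCLike 𝕜] {H : Type*} [NormedAddCommGroup H] [InnerProductSpace 𝕜 H]

/-- A `C₀`-semigroup of bounded operators on `H`, indexed by the nonnegative reals
(the values of `S` at negative times play no role). -/
structure IsC0Semigroup (S : ℝ → H →L[𝕜] H) : Prop where
  zero : S 0 = 1
  add : ∀ s t : ℝ, 0 ≤ s → 0 ≤ t → S (s + t) = S s * S t
  strongly_continuous : ∀ x : H, Tendsto (fun t : ℝ => S t x) (𝓝[>] 0) (𝓝 x)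

/-- `A` is the infinitesimal generator of `S`: `x ∈ D(A)` and `A x = y` if and only if
`(S h x - x) / h → y` as `h → 0⁺`. -/
def IsGenerator (A : H →ₗ.[𝕜] H) (S : ℝ → H →L[𝕜] H) : Prop :=
  ∀ x y : H, (x, y) ∈ A.graph ↔
    Tendsto (fun h : ℝ => ((h⁻¹ : ℝ) : 𝕜) • (S h x - x)) (𝓝[>] 0) (𝓝 y)

variable {m : ℕ}

/-- The disturbance-free operator `A₀`: the restriction of `A` to `D(A) ∩ ker 𝓑`. -/
def disturbanceFree (A : H →ₗ.[𝕜] H) (𝓑 : H →ₗ.[𝕜] EuclideanSpace 𝕜 (Fin m)) : H →ₗ.[𝕜] H :=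
  A.domRestrict ((LinearMap.ker 𝓑.toFun).map 𝓑.domain.subtype)

/-- A lifting operator of `(A, 𝓑)`: a bounded operator `B : 𝕜ᵐ → H` with range in `D(A)`, such
that `A B` (the field `AB`) is bounded and `𝓑 B` is the identity. -/
structure LiftingOperator (A : H →ₗ.[𝕜] H) (𝓑 : H →ₗ.[𝕜] EuclideanSpace 𝕜 (Fin m)) where
  B : EuclideanSpace 𝕜 (Fin m) →L[𝕜] H
  AB : EuclideanSpace 𝕜 (Fin m) →L[𝕜] H
  AB_spec : ∀ v, (B v, AB v) ∈ A.graph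
  lift_spec : ∀ v, (B v, v) ∈ 𝓑.graph

/-- `(A, 𝓑)` is a boundary control system. -/
structure IsBoundaryControlSystem (A : H →ₗ.[𝕜] H)
    (𝓑 : H →ₗ.[𝕜] EuclideanSpace 𝕜 (Fin m)) : Prop where
  domain_le : A.domain ≤ 𝓑.domain
  generates : ∃ S : ℝ → H →L[𝕜] H, IsC0Semigroup S ∧ IsGenerator (disturbanceFree A 𝓑) S
  lifting : Nonempty (LiftingOperator A 𝓑)

/-- `φ` is a Riesz basis of `H`: its span is dense, and the two-sided inequality holds on finite
linear combinations. -/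
def IsRieszBasis (𝕜 : Type*) [RCLike 𝕜] {H : Type*} [NormedAddCommGroup H]
    [InnerProductSpace 𝕜 H] (φ : ℕ → H) : Prop :=
  Dense (Submodule.span 𝕜 (range φ) : Set H) ∧
    ∃ mR MR : ℝ, 0 < mR ∧ 0 < MR ∧ ∀ (N : ℕ) (a : ℕ → 𝕜),
      mR * ∑ n ∈ Finset.range N, ‖a n‖ ^ 2 ≤ ‖∑ n ∈ Finset.range N, a n • φ n‖ ^ 2 ∧
      ‖∑ n ∈ Finset.range N, a n • φ n‖ ^ 2 ≤ MR * ∑ n ∈ Finset.range N, ‖a n‖ ^ 2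

/-- `A₀` is a Riesz-spectral operator with eigenvalues `lam n` and eigenvectors `φ n`: it is
closed, the `φ n` form a Riesz basis, and no segment joining two distinct points of the closure of
the set of eigenvalues is contained in that closure. Repeated values of `lam` are allowed. -/
structure IsRieszSpectral (A₀ : H →ₗ.[𝕜] H) (lam : ℕ → 𝕜) (φ : ℕ → H) : Prop where
  isClosed : A₀.IsClosed
  eigen : ∀ n, (φ n, lam n • φ n) ∈ A₀.graph
  rieszBasis : IsRieszBasis 𝕜 φ
  totallyDisconnected : ∀ a ∈ closure (range lam), ∀ b ∈ closure (range lam), a ≠ b →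
    ¬ segment ℝ a b ⊆ closure (range lam)

/-- `ψ` is the sequence biorthogonal to `φ`. -/
def IsBiorthogonal (𝕜 : Type*) [RCLike 𝕜] {H : Type*} [NormedAddCommGroup H]
    [InnerProductSpace 𝕜 H] (φ ψ : ℕ → H) : Prop :=
  ∀ k l, inner 𝕜 (ψ l) (φ k) = if k = l then 1 else 0

/-- The vector `(⟨x, ψ_n⟩)` of the first `N₀` coefficients of `x` in the Riesz basis. (The inner
product of Mathlib is linear in its second argument.) -/
def coeffs (𝕜 : Type*) [RCLike 𝕜] {H : Type*} [NormedAddCommGroup H]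
    [InnerProductSpace 𝕜 H] (ψ : ℕ → H) (N₀ : ℕ) (x : H) : EuclideanSpace 𝕜 (Fin N₀) :=
  WithLp.toLp 2 fun n => inner 𝕜 (ψ n) x

/-- The matrix `A_{N₀} = diag(λ_1, …, λ_{N₀})`. -/
def truncA (lam : ℕ → 𝕜) (N₀ : ℕ) : Matrix (Fin N₀) (Fin N₀) 𝕜 :=
  Matrix.diagonal fun n => lam n

/-- The matrix `B_{N₀}` with entries `b_{n,k} = -λ_n ⟨B e_k, ψ_n⟩ + ⟨A B e_k, ψ_n⟩`. -/
def truncB {A : H →ₗ.[𝕜] H} {𝓑 : H →ₗ.[𝕜] EuclideanSpace 𝕜 (Fin m)} (L : LiftingOperator A 𝓑)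
    (lam : ℕ → 𝕜) (ψ : ℕ → H) (N₀ : ℕ) : Matrix (Fin N₀) (Fin m) 𝕜 :=
  Matrix.of fun n k =>
    -lam n * inner 𝕜 (ψ n) (L.B (EuclideanSpace.single k 1)) +
      inner 𝕜 (ψ n) (L.AB (EuclideanSpace.single k 1))

end Operators

section Matrices

variable {𝕜 : Type*} [RCLike 𝕜]

/-- The Kalman condition: the block matrix `(B, AB, …, A^{N-1}B)` has full rank `N`. -/
def KalmanCondition {N m : ℕ} (A : Matrix (Fin N) (Fin N) 𝕜) (B : Matrix (Fin N) (Fin m) 𝕜) :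
    Prop :=
  (Matrix.of fun (i : Fin N) (p : Fin N × Fin m) => (A ^ (p.1 : ℕ) * B) i p.2).rank = N

/-- A square matrix over `𝕜` (which is `ℝ` or `ℂ`) is Hurwitz if all its complex eigenvalues have
negative real part. -/
def IsHurwitz {N : ℕ} (M : Matrix (Fin N) (Fin N) 𝕜) : Prop :=
  ∀ μ ∈ spectrum ℂ (M.map fun z => (⟨RCLike.re z, RCLike.im z⟩ : ℂ)), μ.re < 0

/-- The matrix `A_cl = A + e^{-DA} B K`. -/
def closedLoopMatrix {N m : ℕ} (A : Matrix (Fin N) (Fin N) 𝕜) (B : Matrix (Fin N) (Fin m) 𝕜)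
    (D : ℝ) (K : Matrix (Fin m) (Fin N) 𝕜) : Matrix (Fin N) (Fin N) 𝕜 :=
  A + NormedSpace.exp (((-D : ℝ) : 𝕜) • A) * B * K

/-- The Artstein transform `Z(t) = Y(t) + ∫_{t-D}^t e^{(t-s-D)A} B u(s) ds`. -/
def artstein {N m : ℕ} (A : Matrix (Fin N) (Fin N) 𝕜) (B : Matrix (Fin N) (Fin m) 𝕜) (D : ℝ)
    (Y : ℝ → EuclideanSpace 𝕜 (Fin N)) (u : ℝ → EuclideanSpace 𝕜 (Fin m)) (t : ℝ) :
    EuclideanSpace 𝕜 (Fin N) :=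
  Y t + ∫ s in (t - D)..t,
    Matrix.toLpLin 2 2 (NormedSpace.exp (((t - s - D : ℝ) : 𝕜) • A) * B) (u s)

end Matrices

/-- A transition signal: `χ` is of class `C²` on `[-D, ∞)`, with values in `[0, 1]`, equal to `0`
on `[-D, 0]` and to `1` on `[t₀, ∞)`. -/
structure IsTransition (D t₀ : ℝ) (χ : ℝ → ℝ) : Prop where
  contDiffOn : ContDiffOn ℝ 2 χ (Ici (-D))
  mem_Icc : ∀ t ∈ Ici (-D), χ t ∈ Icc (0 : ℝ) 1
  eq_zero : ∀ t ∈ Icc (-D) 0, χ t = 0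
  eq_one : ∀ t ∈ Ici t₀, χ t = 1

/-- `(X, u)` is a classical solution of the closed-loop system with initial condition `X₀` and
disturbance `d`: `X` is continuous on `[0, ∞)` with values in `D(A)` (with the graph norm) and of
class `C¹` with values in `H`, and for all `t ≥ 0`
`X'(t) = A X(t) + d(t)`, `𝓑 X(t) = u(t - D)`, `u(t) = χ(t) K Z(t)`,
where `u` is locally integrable on `[-D, ∞)` and vanishes on `[-D, 0]`, and where `Z` is the
Artstein transform built from `Y(t) = (⟨X(t), ψ_n⟩)_{n ≤ N₀}` and `u`. Only the values of `X` on
`[0, ∞)` and those of `u` on `[-D, ∞)` matter. -/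
structure IsClosedLoopSolution {𝕜 : Type*} [RCLike 𝕜] {H : Type*} [NormedAddCommGroup H]
    [InnerProductSpace 𝕜 H] [NormedSpace ℝ H] {m : ℕ} {A : H →ₗ.[𝕜] H}
    {𝓑 : H →ₗ.[𝕜] EuclideanSpace 𝕜 (Fin m)} (L : LiftingOperator A 𝓑)
    (lam : ℕ → 𝕜) (ψ : ℕ → H) (N₀ : ℕ) (D : ℝ) (K : Matrix (Fin m) (Fin N₀) 𝕜) (χ : ℝ → ℝ)
    (X₀ : H) (d : ℝ → H) (X : ℝ → H) (u : ℝ → EuclideanSpace 𝕜 (Fin m)) : Prop where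
  state_eq : ∃ AX : ℝ → H, ContinuousOn AX (Ici 0) ∧ ∀ t ∈ Ici (0 : ℝ),
    (X t, AX t) ∈ A.graph ∧ HasDerivWithinAt X (AX t + d t) (Ici 0) t
  boundary_eq : ∀ t ∈ Ici (0 : ℝ), (X t, u (t - D)) ∈ 𝓑.graph
  control_integrable : MeasureTheory.LocallyIntegrableOn u (Ici (-D))
  control_eq_zero : ∀ t ∈ Icc (-D) 0, u t = 0
  control_eq : ∀ t ∈ Ici (0 : ℝ), u t = ((χ t : ℝ) : 𝕜) • Matrix.toLpLin 2 2 K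
    (artstein (truncA lam N₀) (truncB L lam ψ N₀) D (fun s => coeffs 𝕜 ψ N₀ (X s)) u t)
  initial : X 0 = X₀

end DelayBoundaryControl

end

/-! Pairing the state with ψ_n turns the boundary control system into scalar modes. The first N₀ of
them form the finite system Y' = A Y + B u(t - D) + P d, with A, B the truncated matrices and P the
coefficient map; all other modes decay like e^{-αt} by (A2). Artstein's transform removes the delay
from the finite part: Z' = A Z + e^{-DA} B u + P d (`hasDerivWithinAt_add_delayIntegral`). With u =
χ K Z this is a linear equation for Z alone, whose matrix is A_cl from t₀ on. Hence Z, u and u' are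
bounded by a multiple of e^{-κt}‖X₀‖ + sup‖d‖ (`exists_predictor`).

Existence reads this chain backwards (`exists_isClosedLoopSolution`). The equation for Z is solved
first, u is read off from it, and X = W + B u(t - D) is built from W' = A₀ W + f, where f = AB v - B
v' + d and v = u(· - D). As χ is C², f is C¹ and W is a classical solution
(`exists_boundary_solution`). The transform of this X solves the same equation as Z, so the feedback
law holds.

For uniqueness, every solution has a predictor obeying the same linear equation
(`IsClosedLoopSolution.predictor`), so u is determined. The difference of two states then stays in
D(A₀), all its modes vanish, and the ψ_n are total (`IsClosedLoopSolution.unique`).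

The bound on X splits it into the lift B v, a stable part and the first N₀ modes. The stable part is
estimated by Duhamel's formula, which needs κ < α; the first modes are controlled by Z minus the
delay integral; the delay costs a factor e^{κD}.

The gain K comes from Bass' construction (`exists_isHurwitz_closedLoopMatrix`): e^{-DA} is diagonal
and invertible, so (A, e^{-DA}B) is again controllable; a shifted Lyapunov equation then has a
positive definite solution W, and K = -(e^{-DA}B)ᴴ W⁻¹ stabilizes. -/

noncomputable section

namespace DelayBoundaryControl

/-! ### Linear differential equations with bounded continuous coefficients -/

section LinearODE

open MeasureTheory intervalIntegral

lemma abs_integral_exp_mul_abs_le {β : ℝ} (hβ : 0 < β) (t : ℝ) :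
    |∫ s in (0 : ℝ)..t, Real.exp (β * |s|)| ≤ Real.exp (β * |t|) / β := by
  have key : ∀ r : ℝ, 0 ≤ r → |∫ s in (0 : ℝ)..r, Real.exp (β * |s|)| ≤ Real.exp (β * |r|) / β := by
    intro r hr
    have h1 : ∫ s in (0 : ℝ)..r, Real.exp (β * |s|) = ∫ s in (0 : ℝ)..r, Real.exp (β * s) := by
      refine integral_congr fun s hs => ?_
      rw [uIcc_of_le hr] at hs
      simp [abs_of_nonneg hs.1]
    rw [h1, integral_comp_mul_left (fun x => Real.exp x) hβ.ne', integral_exp, abs_of_nonneg hr]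
    have h2 : 1 ≤ Real.exp (β * r) := Real.one_le_exp (by positivity)
    simp only [mul_zero, Real.exp_zero, smul_eq_mul]
    rw [abs_of_nonneg (mul_nonneg (by positivity) (by linarith)), div_eq_inv_mul]
    gcongr
    simp
  rcases le_total 0 t with ht | ht
  · exact key t ht
  · have h := key (-t) (by linarith)
    have h1 : ∫ s in (0 : ℝ)..(-t), Real.exp (β * |s|) = -∫ s in (0 : ℝ)..t, Real.exp (β * |s|) := by
      have := integral_comp_neg (a := 0) (b := t) (fun s => Real.exp (β * |s|))
      simp only [abs_neg, neg_zero] at this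
      rw [this, integral_symm]
    rwa [h1, abs_neg, abs_neg] at h

variable {F : Type*} [NormedAddCommGroup F] [NormedSpace ℝ F]

/-- Global solvability of `y' = N(t) y` on `ℝ` for bounded continuous coefficients. -/
theorem exists_hasDerivAt_linear [CompleteSpace F] (N : ℝ → F →L[ℝ] F) (hN : Continuous N) (C : ℝ)
    (hC : ∀ t, ‖N t‖ ≤ C) (y₀ : F) :
    ∃ y : ℝ → F, y 0 = y₀ ∧ ∀ t, HasDerivAt y (N t (y t)) t := by
  have hC0 : 0 ≤ C := (norm_nonneg _).trans (hC 0)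
  -- The Picard map below has Lipschitz constant C / β, which this choice keeps under 1/2.
  set β : ℝ := 2 * C + 1 with hβdef
  have hβ : 0 < β := by positivity
  have hintc : ∀ y : BoundedContinuousFunction ℝ F,
      Continuous fun s => Real.exp (β * |s|) • N s (y s) := fun y => by fun_prop
  have hbd : ∀ (y : BoundedContinuousFunction ℝ F) (t : ℝ),
      ‖∫ s in (0 : ℝ)..t, Real.exp (β * |s|) • N s (y s)‖ ≤ C * ‖y‖ * (Real.exp (β * |t|) / β) := by
    intro y t
    have h1 : ‖∫ s in (0 : ℝ)..t, Real.exp (β * |s|) • N s (y s)‖ ≤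
        |∫ s in (0 : ℝ)..t, C * ‖y‖ * Real.exp (β * |s|)| := by
      refine norm_integral_le_abs_of_norm_le (Eventually.of_forall fun s => ?_)
        (Continuous.intervalIntegrable (by fun_prop) _ _)
      rw [norm_smul, Real.norm_eq_abs, Real.abs_exp, mul_comm]
      gcongr
      exact ((N s).le_opNorm _).trans
        (mul_le_mul (hC s) (y.norm_coe_le_norm s) (norm_nonneg _) hC0)
    refine h1.trans ?_
    rw [intervalIntegral.integral_const_mul, abs_mul, abs_of_nonneg (by positivity : 0 ≤ C * ‖y‖)]
    gcongr
    exact abs_integral_exp_mul_abs_le hβ t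
  have hexp : ∀ t : ℝ, Real.exp (-(β * |t|)) * Real.exp (β * |t|) = 1 := fun t => by
    rw [← Real.exp_add]; simp
  have hcont : ∀ y : BoundedContinuousFunction ℝ F, Continuous fun t =>
      Real.exp (-(β * |t|)) • (y₀ + ∫ s in (0 : ℝ)..t, Real.exp (β * |s|) • N s (y s)) := by
    intro y
    have : Continuous fun t => ∫ s in (0 : ℝ)..t, Real.exp (β * |s|) • N s (y s) :=
      continuous_primitive (fun a b => (hintc y).intervalIntegrable a b) 0
    fun_prop
  have hbound : ∀ (y : BoundedContinuousFunction ℝ F) (t : ℝ),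
      ‖Real.exp (-(β * |t|)) • (y₀ + ∫ s in (0 : ℝ)..t, Real.exp (β * |s|) • N s (y s))‖ ≤
        ‖y₀‖ + C * ‖y‖ / β := by
    intro y t
    rw [norm_smul, Real.norm_eq_abs, Real.abs_exp]
    have h1 : Real.exp (-(β * |t|)) ≤ 1 := Real.exp_le_one_iff.2 (by simp; positivity)
    calc _ ≤ Real.exp (-(β * |t|)) * (‖y₀‖ + C * ‖y‖ * (Real.exp (β * |t|) / β)) := by
          gcongr
          exact (norm_add_le _ _).trans (by gcongr; exact hbd y t)
      _ = Real.exp (-(β * |t|)) * ‖y₀‖ +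
            (Real.exp (-(β * |t|)) * Real.exp (β * |t|)) * (C * ‖y‖ / β) := by ring
      _ ≤ _ := by
          rw [hexp, one_mul]
          gcongr
          exact mul_le_of_le_one_left (norm_nonneg _) h1
  -- The unknown is e^{-β|t|} times the solution: in this weight the Picard iteration contracts on
  -- all of ℝ at once, among bounded functions.
  let T : BoundedContinuousFunction ℝ F → BoundedContinuousFunction ℝ F := fun y =>
    BoundedContinuousFunction.ofNormedAddCommGroup _ (hcont y) _ (hbound y)
  have hT : ContractingWith (1 / 2) T := by
    refine ⟨by norm_num, LipschitzWith.of_dist_le_mul fun y z => ?_⟩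
    rw [BoundedContinuousFunction.dist_le (by positivity)]
    intro t
    have h1 : T y t - T z t = Real.exp (-(β * |t|)) •
        ∫ s in (0 : ℝ)..t, Real.exp (β * |s|) • N s ((y - z) s) := by
      change Real.exp (-(β * |t|)) • (y₀ + ∫ s in (0 : ℝ)..t, Real.exp (β * |s|) • N s (y s)) -
        Real.exp (-(β * |t|)) • (y₀ + ∫ s in (0 : ℝ)..t, Real.exp (β * |s|) • N s (z s)) = _
      rw [← smul_sub, add_sub_add_left_eq_sub,
        ← integral_sub ((hintc y).intervalIntegrable _ _) ((hintc z).intervalIntegrable _ _)]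
      simp only [BoundedContinuousFunction.coe_sub, Pi.sub_apply, map_sub, smul_sub]
    rw [dist_eq_norm, h1, norm_smul, Real.norm_eq_abs, Real.abs_exp, dist_eq_norm]
    calc _ ≤ Real.exp (-(β * |t|)) * (C * ‖y - z‖ * (Real.exp (β * |t|) / β)) := by
          gcongr
          exact hbd (y - z) t
      _ = (Real.exp (-(β * |t|)) * Real.exp (β * |t|)) * (C / β * ‖y - z‖) := by ring
      _ ≤ _ := by
          rw [hexp, one_mul]
          gcongr
          rw [div_le_iff₀ hβ]
          simp [hβdef]
          linarith
  have hfix := hT.fixedPoint_isFixedPt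
  set y := ContractingWith.fixedPoint T hT
  have hy : ∀ t, Real.exp (β * |t|) • y t =
      y₀ + ∫ s in (0 : ℝ)..t, Real.exp (β * |s|) • N s (y s) := by
    intro t
    have h1 : y t = Real.exp (-(β * |t|)) •
        (y₀ + ∫ s in (0 : ℝ)..t, Real.exp (β * |s|) • N s (y s)) :=
      congrArg (fun w : BoundedContinuousFunction ℝ F => w t) hfix.eq.symm
    rw [h1, smul_smul, mul_comm, hexp, one_smul]
  refine ⟨fun t => Real.exp (β * |t|) • y t, by simpa using hy 0, fun t => ?_⟩
  have h2 : (fun t => Real.exp (β * |t|) • y t) =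
      fun t => y₀ + ∫ s in (0 : ℝ)..t, Real.exp (β * |s|) • N s (y s) := funext hy
  rw [map_smul, h2]
  exact ((hintc y).integral_hasStrictDerivAt 0 t).hasDerivAt.const_add y₀

/-- A fundamental solution of `y' = M(t) y` together with its inverse. -/
theorem exists_fundamental_solution [CompleteSpace F] (M : ℝ → F →L[ℝ] F) (hM : Continuous M) (C : ℝ)
    (hC : ∀ t, ‖M t‖ ≤ C) :
    ∃ Φ Ψ : ℝ → F →L[ℝ] F, Φ 0 = 1 ∧ Ψ 0 = 1 ∧ (∀ t, HasDerivAt Φ (M t * Φ t) t) ∧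
      (∀ t, HasDerivAt Ψ (-(Ψ t * M t)) t) ∧ ∀ t, Φ t * Ψ t = 1 := by
  have hC0 : 0 ≤ C := (norm_nonneg _).trans (hC 0)
  obtain ⟨Φ, hΦ0, hΦ⟩ := exists_hasDerivAt_linear
    (fun t => ContinuousLinearMap.mul ℝ (F →L[ℝ] F) (M t)) (by fun_prop) C
    (fun t => (ContinuousLinearMap.opNorm_mul_apply_le ..).trans (hC t)) 1
  obtain ⟨Ψ, hΨ0, hΨ⟩ := exists_hasDerivAt_linear
    (fun t => -(ContinuousLinearMap.mul ℝ (F →L[ℝ] F)).flip (M t)) (by fun_prop) C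
    (fun t => by
      rw [norm_neg]
      refine ContinuousLinearMap.opNorm_le_bound _ hC0 fun x => ?_
      simp only [ContinuousLinearMap.flip_apply, ContinuousLinearMap.mul_apply']
      rw [mul_comm C]
      exact (norm_mul_le _ _).trans (by gcongr; exact hC t)) 1
  simp only [ContinuousLinearMap.mul_apply', neg_apply,
    ContinuousLinearMap.flip_apply] at hΦ hΨ
  refine ⟨Φ, Ψ, hΦ0, hΨ0, hΦ, hΨ, fun t => ?_⟩
  -- The product solves Y' = M Y - Y M with Y(0) = 1, and so does the constant 1.
  have h1 : (fun t => Φ t * Ψ t) = fun _ => 1 := by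
    refine ODE_solution_unique_univ (v := fun t Y => M t * Y - Y * M t) (s := fun _ => univ)
      (K := Real.toNNReal (2 * C)) (t₀ := 0) (fun t => ?_) (fun t => ⟨?_, mem_univ _⟩)
      (fun t => ⟨?_, mem_univ _⟩) ?_
    · refine LipschitzWith.lipschitzOnWith (LipschitzWith.of_dist_le_mul fun Y Y' => ?_)
      rw [dist_eq_norm, dist_eq_norm, Real.coe_toNNReal _ (by positivity)]
      have h : M t * Y - Y * M t - (M t * Y' - Y' * M t) = M t * (Y - Y') - (Y - Y') * M t := by
        noncomm_ring
      rw [h]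
      have h1 := norm_mul_le (M t) (Y - Y')
      have h2 := norm_mul_le (Y - Y') (M t)
      have h3 := mul_le_mul_of_nonneg_right (hC t) (norm_nonneg (Y - Y'))
      have h4 := norm_sub_le (M t * (Y - Y')) ((Y - Y') * M t)
      nlinarith
    · refine ((hΦ t).mul (hΨ t)).congr_deriv ?_
      noncomm_ring
    · simpa using hasDerivAt_const t (1 : F →L[ℝ] F)
    · simp [hΦ0, hΨ0]
  exact congrFun h1 t

/-- Global solutions of `z' = M(t) z + g(t)`. -/
theorem exists_hasDerivAt_affine [CompleteSpace F] (M : ℝ → F →L[ℝ] F) (hM : Continuous M) (C : ℝ)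
    (hC : ∀ t, ‖M t‖ ≤ C) (g : ℝ → F) (hg : Continuous g) (z₀ : F) :
    ∃ z : ℝ → F, z 0 = z₀ ∧ ∀ t, HasDerivAt z (M t (z t) + g t) t := by
  obtain ⟨Φ, Ψ, hΦ0, -, hΦ, hΨ, hΦΨ⟩ := exists_fundamental_solution M hM C hC
  have hΨc : Continuous Ψ := continuous_iff_continuousAt.2 fun t => (hΨ t).continuousAt
  have hgc : Continuous fun s => Ψ s (g s) := by fun_prop
  -- Variation of constants, with Ψ in the role of Φ⁻¹.
  refine ⟨fun t => Φ t (z₀ + ∫ s in (0 : ℝ)..t, Ψ s (g s)), by simp [hΦ0], fun t => ?_⟩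
  have h1 := ((hgc.integral_hasStrictDerivAt 0 t).hasDerivAt.const_add z₀)
  have h2 := (hΦ t).clm_apply h1
  convert h2 using 1
  have h3 : Φ t (Ψ t (g t)) = g t := by
    exact congrArg (fun L : F →L[ℝ] F => L (g t)) (hΦΨ t)
  rw [h3]
  rfl

/-- Bootstrapping: the equation itself exhibits z' as C¹. Second order is needed because the lifted
forcing contains the derivative of the input and must be C¹. -/
lemma contDiff_two_of_hasDerivAt_affine {M : ℝ → F →L[ℝ] F} (hM : ContDiff ℝ 1 M) {g z : ℝ → F}
    (hg : ContDiff ℝ 1 g) (hz : ∀ t, HasDerivAt z (M t (z t) + g t) t) : ContDiff ℝ 2 z := by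
  have hd : deriv z = fun t => M t (z t) + g t := funext fun t => (hz t).deriv
  have hdiff : Differentiable ℝ z := fun t => (hz t).differentiableAt
  have hz1 : ContDiff ℝ 1 z := by
    rw [contDiff_one_iff_deriv, hd]
    refine ⟨hdiff, ?_⟩
    have h1 := hM.continuous
    have h2 := hg.continuous
    have h3 := hdiff.continuous
    fun_prop
  have h2 : (2 : WithTop ℕ∞) = 1 + 1 := by norm_num
  rw [h2, contDiff_succ_iff_deriv, hd]
  exact ⟨hdiff, by simp, (hM.clm_apply hz1).add hg⟩

/-- Uniqueness for `z' = M(t) z + g(t)` on `[0, ∞)`. -/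
lemma eqOn_of_hasDerivWithinAt_affine {M : ℝ → F →L[ℝ] F} {C : ℝ}
    (hC : ∀ t ∈ Ici (0 : ℝ), ‖M t‖ ≤ C) {g z w : ℝ → F}
    (hz : ∀ t ∈ Ici (0 : ℝ), HasDerivWithinAt z (M t (z t) + g t) (Ici 0) t)
    (hw : ∀ t ∈ Ici (0 : ℝ), HasDerivWithinAt w (M t (w t) + g t) (Ici 0) t)
    (h0 : z 0 = w 0) : EqOn z w (Ici 0) := by
  intro T hT
  have hC0 : 0 ≤ C := (norm_nonneg _).trans (hC 0 (mem_Ici.2 le_rfl))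
  refine ODE_solution_unique_of_mem_Icc_right (v := fun t y => M t y + g t) (s := fun _ => univ)
    (K := C.toNNReal) (a := 0) (b := T) (fun t ht => ?_)
    (fun t ht => ((hz t ht.1).continuousWithinAt).mono Icc_subset_Ici_self)
    (fun t ht => (hz t ht.1).mono (Ici_subset_Ici.2 ht.1)) (fun _ _ => mem_univ _)
    (fun t ht => ((hw t ht.1).continuousWithinAt).mono Icc_subset_Ici_self)
    (fun t ht => (hw t ht.1).mono (Ici_subset_Ici.2 ht.1)) (fun _ _ => mem_univ _) h0
    ⟨hT, le_rfl⟩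
  refine LipschitzWith.lipschitzOnWith (LipschitzWith.of_dist_le_mul fun y y' => ?_)
  rw [dist_eq_norm, dist_eq_norm, Real.coe_toNNReal _ hC0, add_sub_add_right_eq_sub, ← map_sub]
  exact (M t).le_of_opNorm_le (hC t ht.1) _

end LinearODE

/-! ### Matrices as real-linear operators, and the passage to ℂ -/

section MatrixMaps

variable {𝕜 : Type*} [RCLike 𝕜] {n k l : ℕ}

/-- The real-linear operator between Euclidean spaces given by a matrix. -/
def matCLM (M : Matrix (Fin n) (Fin k) 𝕜) : EuclideanSpace 𝕜 (Fin k) →L[ℝ] EuclideanSpace 𝕜 (Fin n) :=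
  (LinearMap.toContinuousLinearMap (Matrix.toLpLin 2 2 M)).restrictScalars ℝ

lemma matCLM_apply (M : Matrix (Fin n) (Fin k) 𝕜) (v : EuclideanSpace 𝕜 (Fin k)) :
    matCLM M v = Matrix.toLpLin 2 2 M v := rfl

lemma matCLM_mul (M : Matrix (Fin n) (Fin k) 𝕜) (N : Matrix (Fin k) (Fin l) 𝕜) :
    matCLM (M * N) = matCLM M ∘L matCLM N := by
  ext v i
  simp [matCLM_apply]

lemma matCLM_add (M N : Matrix (Fin n) (Fin k) 𝕜) : matCLM (M + N) = matCLM M + matCLM N := by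
  ext v i
  simp [matCLM_apply]

/-- `matCLM` on square matrices as a ring homomorphism. -/
def matCLMHom (𝕜 : Type*) [RCLike 𝕜] (n : ℕ) : Matrix (Fin n) (Fin n) 𝕜 →+*
    (EuclideanSpace 𝕜 (Fin n) →L[ℝ] EuclideanSpace 𝕜 (Fin n)) where
  toFun := matCLM
  map_one' := by ext v i; simp [matCLM_apply]
  map_zero' := by ext v i; simp [matCLM_apply]
  map_mul' := matCLM_mul
  map_add' := matCLM_add

lemma matCLM_smul (r : ℝ) (M : Matrix (Fin n) (Fin k) 𝕜) :
    matCLM ((r : 𝕜) • M) = r • matCLM M := by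
  ext v i
  simp only [matCLM_apply, map_smul, LinearMap.smul_apply, PiLp.smul_apply,
    smul_apply, RCLike.real_smul_eq_coe_mul, smul_eq_mul]

/-- Entrywise bounds suffice, with a constant depending only on the dimensions. Thus a decay
estimate proved in a matrix norm over ℂ passes to operators on Euclidean space over 𝕜. -/
lemma exists_norm_matCLM_le (𝕜 : Type*) [RCLike 𝕜] (n k : ℕ) :
    ∃ C : ℝ, 0 ≤ C ∧ ∀ (M : Matrix (Fin n) (Fin k) 𝕜) (B : ℝ), 0 ≤ B → (∀ i j, ‖M i j‖ ≤ B) →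
      ‖matCLM M‖ ≤ C * B := by
  let f : Matrix (Fin n) (Fin k) 𝕜 →ₗ[ℝ]
      (EuclideanSpace 𝕜 (Fin k) →L[ℝ] EuclideanSpace 𝕜 (Fin n)) :=
    { toFun := matCLM
      map_add' := matCLM_add
      map_smul' := fun r M => by
        rw [RingHom.id_apply, ← matCLM_smul]
        congr 1
        ext i j
        simp [RCLike.real_smul_eq_coe_mul] }
  refine ⟨∑ i : Fin n, ∑ j : Fin k, ‖matCLM (Matrix.single i j (1 : 𝕜))‖, by positivity, fun M B hB hM => ?_⟩
  have h1 : ∀ i j, matCLM (Matrix.single i j (M i j)) =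
      matCLM (Matrix.single i i (M i j)) ∘L matCLM (Matrix.single i j (1 : 𝕜)) := by
    intro i j
    rw [← matCLM_mul]
    simp
  have h2 : ∀ i j, ‖matCLM (Matrix.single i j (M i j))‖ ≤
      B * ‖matCLM (Matrix.single i j (1 : 𝕜))‖ := by
    intro i j
    refine ContinuousLinearMap.opNorm_le_bound _ (by positivity) fun v => ?_
    have : matCLM (Matrix.single i j (M i j)) v =
        M i j • matCLM (Matrix.single i j (1 : 𝕜)) v := by
      have : Matrix.single i j (M i j) = M i j • Matrix.single i j (1 : 𝕜) := by
        simp [Matrix.smul_single]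
      simp only [matCLM_apply]
      rw [this, map_smul]
      rfl
    rw [this, norm_smul, mul_assoc]
    gcongr
    · exact hM i j
    · exact ContinuousLinearMap.le_opNorm _ _
  have h3 : matCLM M = ∑ i, ∑ j, matCLM (Matrix.single i j (M i j)) := by
    conv_lhs => rw [Matrix.matrix_eq_sum_single M]
    change f _ = _
    simp only [map_sum]
    rfl
  rw [h3]
  calc ‖∑ i, ∑ j, matCLM (Matrix.single i j (M i j))‖
      ≤ ∑ i, ∑ j, ‖matCLM (Matrix.single i j (M i j))‖ :=
        (norm_sum_le _ _).trans (Finset.sum_le_sum fun i _ => norm_sum_le _ _)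
    _ ≤ ∑ i, ∑ j, B * ‖matCLM (Matrix.single i j (1 : 𝕜))‖ :=
        Finset.sum_le_sum fun i _ => Finset.sum_le_sum fun j _ => h2 i j
    _ = _ := by simp only [← Finset.mul_sum, mul_comm _ B]

/-- Continuity for the entrywise topology is what lets the exponential series pass through the
homomorphism. -/
lemma continuous_matCLMHom : Continuous (matCLMHom 𝕜 n) := by
  obtain ⟨C, hC0, hC⟩ := exists_norm_matCLM_le 𝕜 n n
  rw [continuous_iff_continuousAt]
  intro M
  rw [ContinuousAt, tendsto_iff_norm_sub_tendsto_zero]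
  have h : Tendsto (fun N : Matrix (Fin n) (Fin n) 𝕜 => C * ∑ i, ∑ j, ‖(N - M) i j‖) (𝓝 M)
      (𝓝 0) := by
    have : Continuous fun N : Matrix (Fin n) (Fin n) 𝕜 => C * ∑ i, ∑ j, ‖(N - M) i j‖ := by
      have : ∀ i j, Continuous fun N : Matrix (Fin n) (Fin n) 𝕜 => N i j :=
        fun i j => continuous_id.matrix_elem i j
      simp only [Matrix.sub_apply]
      fun_prop
    simpa using this.tendsto M
  refine squeeze_zero (fun _ => norm_nonneg _) (fun N => ?_) h
  rw [← map_sub]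
  refine hC _ _ (by positivity) fun i j => ?_
  refine le_trans ?_ (Finset.single_le_sum (f := fun i => ∑ j, ‖(N - M) i j‖)
    (fun i _ => by positivity) (Finset.mem_univ i))
  exact Finset.single_le_sum (f := fun j => ‖(N - M) i j‖) (fun _ _ => norm_nonneg _)
    (Finset.mem_univ j)

lemma matCLM_exp (r : ℝ) (M : Matrix (Fin n) (Fin n) 𝕜) :
    matCLM (NormedSpace.exp ((r : 𝕜) • M)) = NormedSpace.exp (r • matCLM M) := by
  rw [← matCLM_smul]
  open scoped Matrix.Norms.Operator in
  exact NormedSpace.map_exp (matCLMHom 𝕜 n) continuous_matCLMHom _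

/-- The embedding of `𝕜` (which is `ℝ` or `ℂ`) into `ℂ`. -/
def toC (𝕜 : Type*) [RCLike 𝕜] : 𝕜 →+* ℂ where
  toFun z := ⟨RCLike.re z, RCLike.im z⟩
  map_one' := by apply Complex.ext <;> simp
  map_zero' := by apply Complex.ext <;> simp
  map_mul' z w := by apply Complex.ext <;> simp
  map_add' z w := by apply Complex.ext <;> simp

lemma toC_apply (z : 𝕜) : toC 𝕜 z = ⟨RCLike.re z, RCLike.im z⟩ := rfl

lemma toC_re (z : 𝕜) : (toC 𝕜 z).re = RCLike.re z := rfl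

lemma toC_star (z : 𝕜) : toC 𝕜 (star z) = star (toC 𝕜 z) := by
  apply Complex.ext <;> simp [toC_apply]

lemma toC_ofReal (r : ℝ) : toC 𝕜 (r : 𝕜) = r := by
  apply Complex.ext <;> simp [toC_apply]

lemma norm_toC (z : 𝕜) : ‖toC 𝕜 z‖ = ‖z‖ := by
  rw [Complex.norm_eq_sqrt_sq_add_sq, ← Real.sqrt_sq (norm_nonneg z), RCLike.norm_sq_eq_def,
    sq, sq]
  rfl

lemma continuous_toC : Continuous (toC 𝕜) := by
  refine LipschitzWith.continuous (K := 1) (LipschitzWith.of_dist_le_mul fun x y => ?_)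
  rw [dist_eq_norm, dist_eq_norm, ← map_sub, norm_toC]
  simp

end MatrixMaps

/-! ### Exponential decay for Hurwitz matrices -/

section Hurwitz

open scoped Matrix.Norms.Operator

variable {n : ℕ}

lemma exp_mulVec_of_eigenvector {M : Matrix (Fin n) (Fin n) ℂ} {v : Fin n → ℂ} {μ : ℂ}
    (h : M.mulVec v = μ • v) : (NormedSpace.exp M).mulVec v = Complex.exp μ • v := by
  have hpow : ∀ p : ℕ, (M ^ p).mulVec v = μ ^ p • v := by
    intro p
    induction p with
    | zero => simp
    | succ p ih => rw [pow_succ, ← Matrix.mulVec_mulVec, h, Matrix.mulVec_smul, ih, smul_smul,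
        pow_succ']
  have h1 := NormedSpace.exp_series_hasSum_exp' (𝕂 := ℂ) M
  have h2 : HasSum (fun p : ℕ => ((p.factorial : ℂ)⁻¹ • M ^ p).mulVec v)
      ((NormedSpace.exp M).mulVec v) := by
    let f : Matrix (Fin n) (Fin n) ℂ →+ (Fin n → ℂ) :=
      { toFun := fun N => N.mulVec v
        map_zero' := Matrix.zero_mulVec v
        map_add' := fun N N' => Matrix.add_mulVec N N' v }
    have hf : Continuous f := by
      change Continuous fun N : Matrix (Fin n) (Fin n) ℂ => N.mulVec v
      exact continuous_id.matrix_mulVec continuous_const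
    exact h1.map f hf
  have h3 := (NormedSpace.exp_series_hasSum_exp' (𝕂 := ℂ) μ).smul_const v
  rw [← Complex.exp_eq_exp_ℂ] at h3
  refine h2.unique (h3.congr_fun ?_)
  intro p
  simp [Matrix.smul_mulVec, hpow, smul_smul]

/-- Since M commutes with its exponential, it leaves each eigenspace of e^M invariant. Over ℂ it has
an eigenvector there, on which e^M acts as e^μ. -/
lemma exists_mem_spectrum_of_mem_spectrum_exp {M : Matrix (Fin n) (Fin n) ℂ} {ν : ℂ}
    (hν : ν ∈ spectrum ℂ (NormedSpace.exp M)) : ∃ μ ∈ spectrum ℂ M, Complex.exp μ = ν := by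
  set f := Matrix.toLin' M
  set g := Matrix.toLin' (NormedSpace.exp M)
  rw [← Matrix.spectrum_toLin', ← Module.End.hasEigenvalue_iff_mem_spectrum] at hν
  have hcomm : Commute g f := by
    have h : Commute (NormedSpace.exp M) M := (Commute.refl M).exp_left
    change g * f = f * g
    change Matrix.toLin' _ ∘ₗ Matrix.toLin' _ = Matrix.toLin' _ ∘ₗ Matrix.toLin' _
    rw [← Matrix.toLin'_mul, ← Matrix.toLin'_mul, h.eq]
  have hmaps : MapsTo f (Module.End.eigenspace g ν) (Module.End.eigenspace g ν) :=
    Module.End.mapsTo_genEigenspace_of_comm hcomm ν 1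
  have hnt : Nontrivial (Module.End.eigenspace g ν) :=
    Submodule.nontrivial_iff_ne_bot.2 hν
  obtain ⟨μ, hμ⟩ := Module.End.exists_eigenvalue (LinearMap.restrict f hmaps)
  obtain ⟨⟨v, hv⟩, hvμ⟩ := hμ.exists_hasEigenvector
  have hv0 : v ≠ 0 := fun h => hvμ.2 (Subtype.ext h)
  have hfv : f v = μ • v := congrArg Subtype.val hvμ.apply_eq_smul
  have hgv : g v = ν • v := Module.End.mem_eigenspace_iff.1 hv
  refine ⟨μ, ?_, ?_⟩
  · rw [← Matrix.spectrum_toLin', ← Module.End.hasEigenvalue_iff_mem_spectrum]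
    exact Module.End.hasEigenvalue_of_hasEigenvector
      ⟨Module.End.mem_eigenspace_iff.2 hfv, hv0⟩
  · have h1 := exp_mulVec_of_eigenvector (M := M) (v := v) (μ := μ) (by simpa [f] using hfv)
    have h2 : (NormedSpace.exp M).mulVec v = ν • v := by simpa [g] using hgv
    exact smul_left_injective ℂ hv0 (h1.symm.trans h2)

/-- By spectral mapping the spectral radius of e^M is below 1, and Gelfand's formula makes some
power a strict contraction. -/
lemma exists_norm_exp_pow_lt_one [NeZero n] {M : Matrix (Fin n) (Fin n) ℂ}
    (hM : ∀ μ ∈ spectrum ℂ M, μ.re < 0) : ∃ p : ℕ, 0 < p ∧ ‖NormedSpace.exp M ^ p‖ < 1 := by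
  have h1 : spectralRadius ℂ (NormedSpace.exp M) < ((1 : NNReal) : ENNReal) := by
    refine spectrum.spectralRadius_lt_of_forall_lt _ fun ν hν => ?_
    obtain ⟨μ, hμ, rfl⟩ := exists_mem_spectrum_of_mem_spectrum_exp hν
    rw [← NNReal.coe_lt_coe, coe_nnnorm, Complex.norm_exp]
    simpa using hM μ hμ
  have h2 := (spectrum.pow_nnnorm_pow_one_div_tendsto_nhds_spectralRadius
    (NormedSpace.exp M)).eventually (gt_mem_nhds h1)
  obtain ⟨p, hp, hp0⟩ := (h2.and (eventually_gt_atTop 0)).exists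
  refine ⟨p, hp0, ?_⟩
  by_contra hcon
  rw [not_lt] at hcon
  have h3 : (1 : ENNReal) ≤ (‖NormedSpace.exp M ^ p‖₊ : ENNReal) := by exact_mod_cast hcon
  have h4 := ENNReal.one_le_rpow h3 (z := 1 / (p : ℝ)) (by positivity)
  exact absurd hp (not_lt.2 (by exact_mod_cast h4))

/-- Exponential decay of `e^{tM}` for a complex matrix `M` with spectrum in the open left half
plane. -/
theorem exists_norm_exp_smul_le [NeZero n] {M : Matrix (Fin n) (Fin n) ℂ}
    (hM : ∀ μ ∈ spectrum ℂ M, μ.re < 0) :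
    ∃ κ C : ℝ, 0 < κ ∧ 0 ≤ C ∧ ∀ t : ℝ, 0 ≤ t →
      ‖NormedSpace.exp ((t : ℂ) • M)‖ ≤ C * Real.exp (-κ * t) := by
  obtain ⟨p, hp0, hp⟩ := exists_norm_exp_pow_lt_one hM
  have hpR : (0 : ℝ) < p := by exact_mod_cast hp0
  -- The maximum with 1/2 keeps q positive, so that log q gives a genuine rate -log q / p.
  set q : ℝ := max ‖NormedSpace.exp M ^ p‖ (1 / 2) with hq
  have hq0 : 0 < q := lt_max_of_lt_right (by norm_num)
  have hq1 : q < 1 := max_lt hp (by norm_num)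
  have hcont : Continuous fun t : ℝ => NormedSpace.exp ((t : ℂ) • M) := by
    have : Continuous (NormedSpace.exp : Matrix (Fin n) (Fin n) ℂ → _) := NormedSpace.exp_continuous
    fun_prop
  obtain ⟨C, hC⟩ := (isCompact_Icc (a := (0 : ℝ)) (b := p)).exists_bound_of_continuousOn
    hcont.continuousOn
  have hC0 : 0 ≤ C := (norm_nonneg _).trans (hC 0 ⟨le_rfl, hpR.le⟩)
  refine ⟨-Real.log q / p, C * q⁻¹, div_pos (neg_pos.2 (Real.log_neg hq0 hq1)) hpR,
    by positivity, fun t ht => ?_⟩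
  -- Time t consists of j contracting blocks of length p and a remainder in [0, p], where the
  -- exponential is bounded by compactness.
  set j := ⌊t / p⌋₊
  have hj1 : (j : ℝ) * p ≤ t := (le_div_iff₀ hpR).1 (Nat.floor_le (by positivity))
  have hj2 : t < (j + 1) * p := (div_lt_iff₀ hpR).1 (Nat.lt_floor_add_one _)
  have hsplit : NormedSpace.exp ((t : ℂ) • M) =
      (NormedSpace.exp M ^ p) ^ j * NormedSpace.exp (((t - j * p : ℝ) : ℂ) • M) := by
    rw [← pow_mul, ← Matrix.exp_nsmul, ← Matrix.exp_add_of_commute]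
    · congr 1
      rw [← Nat.cast_smul_eq_nsmul ℂ, ← add_smul]
      congr 1
      push_cast
      ring
    · exact ((Commute.refl M).smul_left _).smul_right _
  have hqj : q ^ j ≤ q⁻¹ * Real.exp (-(-Real.log q / p) * t) := by
    have h1 : q ^ j = Real.exp (j * Real.log q) := by
      rw [mul_comm, Real.exp_mul, Real.exp_log hq0, Real.rpow_natCast]
    have h2 : q⁻¹ = Real.exp (-Real.log q) := by rw [Real.exp_neg, Real.exp_log hq0]
    rw [h1, h2, ← Real.exp_add, Real.exp_le_exp]
    have hl := Real.log_neg hq0 hq1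
    have h3 : -(-Real.log q / p) * t = Real.log q * (t / p) := by ring
    have h4 : t / p ≤ j + 1 := (Nat.lt_floor_add_one (t / p)).le
    rw [h3]
    nlinarith
  rw [hsplit]
  calc _ ≤ ‖(NormedSpace.exp M ^ p) ^ j‖ * C := by
        refine (norm_mul_le _ _).trans (mul_le_mul_of_nonneg_left ?_ (norm_nonneg _))
        exact hC _ ⟨by linarith, by linarith⟩
    _ ≤ q ^ j * C := by
        gcongr
        exact (norm_pow_le _ _).trans (pow_le_pow_left₀ (norm_nonneg _) (le_max_left _ _) _)
    _ ≤ (q⁻¹ * Real.exp (-(-Real.log q / p) * t)) * C := by gcongr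
    _ = _ := by ring

/-- A Hurwitz matrix generates an exponentially stable group. -/
theorem IsHurwitz.exists_norm_exp_le {𝕜 : Type*} [RCLike 𝕜] [NeZero n]
    {M : Matrix (Fin n) (Fin n) 𝕜} (hM : IsHurwitz M) :
    ∃ κ C : ℝ, 0 < κ ∧ 0 ≤ C ∧ ∀ t : ℝ, 0 ≤ t →
      ‖NormedSpace.exp (t • matCLM M)‖ ≤ C * Real.exp (-κ * t) := by
  obtain ⟨κ, C, hκ, hC, h⟩ := exists_norm_exp_smul_le (M := M.map (toC 𝕜)) hM
  obtain ⟨C', hC', h'⟩ := exists_norm_matCLM_le 𝕜 n n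
  refine ⟨κ, C' * C, hκ, by positivity, fun t ht => ?_⟩
  rw [← matCLM_exp, mul_assoc]
  refine h' _ _ (by positivity) fun i j => le_trans ?_ (h t ht)
  have h1 : NormedSpace.exp ((t : ℂ) • M.map (toC 𝕜)) =
      (NormedSpace.exp ((t : 𝕜) • M)).map (toC 𝕜) := by
    have h2 : (NormedSpace.exp ((t : 𝕜) • M)).map (toC 𝕜) =
        NormedSpace.exp (((t : 𝕜) • M).map (toC 𝕜)) :=
      NormedSpace.map_exp (toC 𝕜).mapMatrix
        (by exact Continuous.matrix_map continuous_id continuous_toC) ((t : 𝕜) • M)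
    rw [h2]
    congr 1
    ext i j
    simp only [Matrix.smul_apply, Matrix.map_apply, smul_eq_mul, map_mul, toC_ofReal]
  -- Each entry is dominated by its row sum, hence by the ℓ^∞ operator norm.
  rw [h1, ← norm_toC, ← coe_nnnorm, ← coe_nnnorm, NNReal.coe_le_coe, Matrix.linfty_opNNNorm_def]
  refine le_trans ?_ (Finset.le_sup (f := fun i => ∑ j, ‖(NormedSpace.exp ((t : 𝕜) • M)).map (toC 𝕜) i j‖₊)
    (Finset.mem_univ i))
  exact Finset.single_le_sum (f := fun j => ‖(NormedSpace.exp ((t : 𝕜) • M)).map (toC 𝕜) i j‖₊)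
    (fun _ _ => zero_le) (Finset.mem_univ j)

end Hurwitz

/-! ### Pole placement to the left half plane by Bass' method -/

section Stabilization

variable {N m : ℕ}

/-- The form `∑ z_i z̄_j / (μ_i + μ̄_j)` is the integral over `[0, ∞)` of `|∑ z_i e^{-sμ_i}|²`. -/
lemma cauchy_form_nonneg_and_eq_zero (μ z : Fin N → ℂ) (hμ : ∀ i, 0 < (μ i).re) :
    0 ≤ (∑ i, ∑ j, z i * star (z j) / (μ i + star (μ j))).re ∧
      ((∑ i, ∑ j, z i * star (z j) / (μ i + star (μ j))).re = 0 →
        ∀ s : ℝ, 0 < s → ∑ i, z i * Complex.exp (-(s : ℂ) * μ i) = 0) := by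
  have hne : ∀ i j, μ i + star (μ j) ≠ 0 := fun i j h => by
    have h1 := congrArg Complex.re h
    simp only [Complex.add_re, Complex.zero_re, Complex.star_def, Complex.conj_re] at h1
    linarith [hμ i, hμ j]
  let c : Fin N → Fin N → ℂ := fun i j => z i * star (z j) / (μ i + star (μ j))
  -- G is the tail of the integral: G' = -|h|² and G → 0 at infinity. Monotonicity of Re G thus
  -- replaces any improper integral.
  let G : ℝ → ℂ := fun s => ∑ i, ∑ j, c i j * Complex.exp (-(s : ℂ) * (μ i + star (μ j)))
  let h : ℝ → ℂ := fun s => ∑ i, z i * Complex.exp (-(s : ℂ) * μ i)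
  have hG : ∀ s, HasDerivAt G (-(h s * star (h s))) s := by
    intro s
    have h1 : ∀ i j, HasDerivAt
        (fun s : ℝ => c i j * Complex.exp (-(s : ℂ) * (μ i + star (μ j))))
        (c i j * (Complex.exp (-(s : ℂ) * (μ i + star (μ j))) * (-1 * (μ i + star (μ j))))) s := by
      intro i j
      exact ((((Complex.ofRealCLM.hasDerivAt (x := s)).neg.mul_const
        (μ i + star (μ j))).cexp).const_mul (c i j))
    have h2 : HasDerivAt G (∑ i, ∑ j,
        c i j * (Complex.exp (-(s : ℂ) * (μ i + star (μ j))) * (-1 * (μ i + star (μ j))))) s := by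
      have := HasDerivAt.fun_sum (u := Finset.univ) fun i _ =>
        HasDerivAt.fun_sum (u := Finset.univ) fun j _ => h1 i j
      exact this
    convert h2 using 1
    simp only [h, star_sum, Finset.sum_mul_sum, ← Finset.sum_neg_distrib]
    refine Finset.sum_congr rfl fun i _ => Finset.sum_congr rfl fun j _ => ?_
    have h3 : star (z j * Complex.exp (-(s : ℂ) * μ j)) =
        star (z j) * Complex.exp (-(s : ℂ) * star (μ j)) := by
      simp [← Complex.exp_conj, mul_comm]
    rw [h3, mul_add, Complex.exp_add]
    have h4 := hne i j
    simp only [c]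
    field_simp
  let g : ℝ → ℝ := fun s => (G s).re
  have hg : ∀ s, HasDerivAt g (-‖h s‖ ^ 2) s := by
    intro s
    have := Complex.reCLM.hasFDerivAt.comp_hasDerivAt s (hG s)
    refine this.congr_deriv ?_
    change (-(h s * star (h s))).re = _
    rw [Complex.star_def, Complex.mul_conj, Complex.normSq_eq_norm_sq, Complex.neg_re, Complex.ofReal_re]
  have hanti : Antitone g := antitone_of_deriv_nonpos (fun s => (hg s).differentiableAt)
    fun s => by rw [(hg s).deriv]; simp
  have hlim : Tendsto g atTop (𝓝 0) := by
    have h1 : Tendsto G atTop (𝓝 0) := by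
      have : (0 : ℂ) = ∑ i : Fin N, ∑ j : Fin N, c i j * 0 := by simp
      rw [this]
      refine tendsto_finsetSum _ fun i _ => tendsto_finsetSum _ fun j _ =>
        Tendsto.const_mul _ ?_
      rw [tendsto_zero_iff_norm_tendsto_zero]
      simp only [Complex.norm_exp]
      refine Real.tendsto_exp_atBot.comp ?_
      have h2 : 0 < (μ i).re + (μ j).re := by linarith [hμ i, hμ j]
      have h3 : (fun s : ℝ => (-(s : ℂ) * (μ i + star (μ j))).re) =
          fun s : ℝ => -(s * ((μ i).re + (μ j).re)) := by
        funext s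
        simp
      rw [h3]
      exact tendsto_neg_atTop_atBot.comp (tendsto_id.atTop_mul_const h2)
    exact (Complex.continuous_re.tendsto 0).comp h1
  have hg0 : g 0 = (∑ i, ∑ j, z i * star (z j) / (μ i + star (μ j))).re := by
    simp [g, G, c]
  have hnn : ∀ s, 0 ≤ g s := fun s => hanti.le_of_tendsto hlim s
  refine ⟨hg0 ▸ hnn 0, fun hz s hs => ?_⟩
  -- An antitone nonnegative function with g(0) = 0 vanishes on (0, ∞), and so does its derivative
  -- -|h|².
  have hev : g =ᶠ[𝓝 s] fun _ => 0 := by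
    filter_upwards [lt_mem_nhds hs] with r hr
    exact le_antisymm ((hanti hr.le).trans (hg0.trans hz).le) (hnn r)
  have h1 := (hg s).unique ((hasDerivAt_const s (0 : ℝ)).congr_of_eventuallyEq hev)
  have h2 : ‖h s‖ = 0 := by
    have : ‖h s‖ ^ 2 = 0 := by linarith
    exact pow_eq_zero_iff two_ne_zero |>.1 this
  exact norm_eq_zero.1 h2

/-- Each differentiation in s brings down a factor -μ_i; positive times form an open set, so the
identity can be differentiated there. -/
lemma sum_mul_pow_eq_zero_of_exp_sum_eq_zero {μ z : Fin N → ℂ}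
    (h : ∀ s : ℝ, 0 < s → ∑ i, z i * Complex.exp (-(s : ℂ) * μ i) = 0) (p : ℕ) :
    ∀ s : ℝ, 0 < s → ∑ i, z i * μ i ^ p * Complex.exp (-(s : ℂ) * μ i) = 0 := by
  induction p with
  | zero => simpa using h
  | succ p ih =>
    intro s hs
    have h1 : ∀ i, HasDerivAt
        (fun s : ℝ => z i * μ i ^ p * Complex.exp (-(s : ℂ) * μ i))
        (z i * μ i ^ p * (Complex.exp (-(s : ℂ) * μ i) * (-1 * μ i))) s := by
      intro i
      exact (((Complex.ofRealCLM.hasDerivAt (x := s)).neg.mul_const (μ i)).cexp).const_mul _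
    have h2 := HasDerivAt.fun_sum (u := Finset.univ) fun i _ => h1 i
    have hev : (fun s : ℝ => ∑ i, z i * μ i ^ p * Complex.exp (-(s : ℂ) * μ i))
        =ᶠ[𝓝 s] fun _ => 0 := by
      filter_upwards [lt_mem_nhds hs] with r hr
      exact ih r hr
    have h3 := h2.unique ((hasDerivAt_const s (0 : ℂ)).congr_of_eventuallyEq hev)
    rw [← neg_eq_zero, ← h3, ← Finset.sum_neg_distrib]
    refine Finset.sum_congr rfl fun i _ => ?_
    ring

/-- A right inverse is a polynomial identity between entries, so it survives the embedding of 𝕜 into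
ℂ without any comparison of ranks. -/
lemma KalmanCondition.exists_mul_eq_one {𝕜 : Type*} [RCLike 𝕜] {A : Matrix (Fin N) (Fin N) 𝕜}
    {B : Matrix (Fin N) (Fin m) 𝕜} (h : KalmanCondition A B) :
    ∃ R : Matrix (Fin N × Fin m) (Fin N) 𝕜,
      (Matrix.of fun (i : Fin N) (p : Fin N × Fin m) => (A ^ (p.1 : ℕ) * B) i p.2) * R = 1 := by
  rw [← Matrix.mulVec_surjective_iff_exists_right_inverse]
  rw [KalmanCondition, Matrix.rank] at h
  have h1 := Submodule.eq_top_of_finrank_eq (K := 𝕜) (h.trans (by simp))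
  exact LinearMap.range_eq_top.1 h1

/-- Kalman's condition for a diagonal pair, after extension of scalars to `ℂ`. -/
lemma KalmanCondition.eq_zero_of_sum {𝕜 : Type*} [RCLike 𝕜] {lam : Fin N → 𝕜}
    {B : Matrix (Fin N) (Fin m) 𝕜} (h : KalmanCondition (Matrix.diagonal lam) B) {x : Fin N → ℂ}
    (hx : ∀ (p : ℕ) (k : Fin m), ∑ i, x i * toC 𝕜 (lam i) ^ p * toC 𝕜 (B i k) = 0) : x = 0 := by
  obtain ⟨R, hR⟩ := h.exists_mul_eq_one
  have h1 := congrArg (fun M => M.map (toC 𝕜)) hR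
  simp only [Matrix.map_mul, Matrix.map_one _ (map_zero _) (map_one _)] at h1
  have h2 : Matrix.vecMul x ((Matrix.of fun (i : Fin N) (p : Fin N × Fin m) =>
      (Matrix.diagonal lam ^ (p.1 : ℕ) * B) i p.2).map (toC 𝕜)) = 0 := by
    funext p
    rw [Pi.zero_apply, ← hx p.1 p.2]
    simp only [Matrix.vecMul, dotProduct, Matrix.map_apply, Matrix.of_apply, Matrix.diagonal_pow,
      Matrix.diagonal_mul, map_mul, Pi.pow_apply, map_pow, mul_assoc]
  rw [← Matrix.vecMul_one x, ← h1, ← Matrix.vecMul_vecMul, h2, Matrix.zero_vecMul]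

/-- Binomial expansion of μ_i = (μ_i + β) - β. It undoes the shift that makes the Lyapunov equation
solvable. -/
lemma sum_mul_pow_shift_eq_zero {x μ : Fin N → ℂ} (β : ℂ)
    (h : ∀ p : ℕ, ∑ i, x i * (μ i + β) ^ p = 0) (p : ℕ) : ∑ i, x i * μ i ^ p = 0 := by
  have h1 : ∀ i, x i * μ i ^ p = ∑ r ∈ Finset.range (p + 1),
      (x i * (μ i + β) ^ r) * ((-β) ^ (p - r) * (p.choose r : ℂ)) := by
    intro i
    have : μ i = (μ i + β) + -β := by ring
    conv_lhs => rw [this, add_pow, Finset.mul_sum]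
    refine Finset.sum_congr rfl fun r _ => ?_
    ring
  simp_rw [h1]
  rw [Finset.sum_comm]
  refine Finset.sum_eq_zero fun r _ => ?_
  rw [← Finset.sum_mul, h r, zero_mul]

/-- Solution of the Lyapunov equation `M W + W Mᴴ = B Bᴴ` for `M = diag μ`. -/
def diagLyapunov {𝕜 : Type*} [RCLike 𝕜] (μ : Fin N → 𝕜) (B : Matrix (Fin N) (Fin m) 𝕜) :
    Matrix (Fin N) (Fin N) 𝕜 :=
  Matrix.of fun i j => (B * B.conjTranspose) i j / (μ i + star (μ j))

lemma diagLyapunov_map {𝕜 : Type*} [RCLike 𝕜] (μ : Fin N → 𝕜) (B : Matrix (Fin N) (Fin m) 𝕜) :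
    (diagLyapunov μ B).map (toC 𝕜) = diagLyapunov (fun i => toC 𝕜 (μ i)) (B.map (toC 𝕜)) := by
  ext i j
  simp [diagLyapunov, Matrix.mul_apply, ← toC_star]

/-- Writing B Bᴴ as a sum over columns splits the form into one Cauchy form per input, with z_i =
v_i B_{ik}. -/
lemma diagLyapunov_form (μ : Fin N → ℂ) (B : Matrix (Fin N) (Fin m) ℂ) (v : Fin N → ℂ) :
    dotProduct v ((diagLyapunov μ B).mulVec (star v)) =
      ∑ k, ∑ i, ∑ j, (v i * B i k) * star (v j * B j k) / (μ i + star (μ j)) := by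
  rw [Finset.sum_comm]
  simp only [dotProduct, Matrix.mulVec, Finset.mul_sum]
  refine Finset.sum_congr rfl fun i _ => ?_
  rw [Finset.sum_comm]
  refine Finset.sum_congr rfl fun j _ => ?_
  simp only [diagLyapunov, Matrix.of_apply, Matrix.mul_apply, Matrix.conjTranspose_apply,
    Pi.star_apply, star_mul', Finset.sum_div, Finset.sum_mul, Finset.mul_sum]
  refine Finset.sum_congr rfl fun k _ => ?_
  ring

/-- If the form vanished, every column would give an exponential sum that is identically zero for s
> 0. Its derivatives at s = 1 are the moments of v_i e^{-μ_i}, so observability kills this vector,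
and the exponential factors are nonzero. -/
lemma diagLyapunov_form_pos {μ : Fin N → ℂ} (hμ : ∀ i, 0 < (μ i).re)
    {B : Matrix (Fin N) (Fin m) ℂ}
    (hobs : ∀ x : Fin N → ℂ, (∀ (p : ℕ) (k : Fin m), ∑ i, x i * μ i ^ p * B i k = 0) → x = 0)
    {v : Fin N → ℂ} (hv : v ≠ 0) :
    0 < (dotProduct v ((diagLyapunov μ B).mulVec (star v))).re := by
  rw [diagLyapunov_form, Complex.re_sum]
  have h := fun k => cauchy_form_nonneg_and_eq_zero μ (fun i => v i * B i k) hμ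
  refine lt_of_le_of_ne (Finset.sum_nonneg fun k _ => (h k).1) fun h0 => hv ?_
  have h1 := (Finset.sum_eq_zero_iff_of_nonneg fun k _ => (h k).1).1 h0.symm
  have h2 : (fun i => v i * Complex.exp (-((1 : ℝ) : ℂ) * μ i)) = 0 := by
    refine hobs _ fun p k => ?_
    rw [← sum_mul_pow_eq_zero_of_exp_sum_eq_zero ((h k).2 (h1 k (Finset.mem_univ k))) p 1 one_pos]
    refine Finset.sum_congr rfl fun i _ => ?_
    ring
  funext i
  have h3 := congrFun h2 i
  simpa using h3

/-- The denominators are λ_i + λ̄_j + 2β, so the shift appears as -2βW. This term provides the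
strict negativity in the stabilization argument. -/
lemma diagLyapunov_eq (lam : Fin N → ℂ) (β : ℝ) (hμ : ∀ i, 0 < (lam i + β).re)
    (B : Matrix (Fin N) (Fin m) ℂ) :
    Matrix.diagonal lam * diagLyapunov (fun i => lam i + β) B +
      diagLyapunov (fun i => lam i + β) B * (Matrix.diagonal lam).conjTranspose =
    B * B.conjTranspose - (2 * β : ℂ) • diagLyapunov (fun i => lam i + β) B := by
  ext i j
  have h4 : lam i + β + (star (lam j) + β) ≠ 0 := fun h => by
    have h1 := congrArg Complex.re h
    have h2 := hμ i
    have h3 := hμ j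
    simp only [Complex.add_re, Complex.zero_re, Complex.star_def, Complex.conj_re,
      Complex.ofReal_re] at h1 h2 h3
    linarith
  simp only [Matrix.diagonal_conjTranspose, Matrix.add_apply, Matrix.sub_apply, Matrix.smul_apply,
    Matrix.diagonal_mul, Matrix.mul_diagonal, diagLyapunov, Matrix.of_apply, Pi.star_apply,
    star_add, smul_eq_mul]
  have h5 : star (β : ℂ) = β := Complex.conj_ofReal β
  rw [h5]
  field_simp
  ring

lemma diagLyapunov_conjTranspose (μ : Fin N → ℂ) (B : Matrix (Fin N) (Fin m) ℂ) :
    (diagLyapunov μ B).conjTranspose = diagLyapunov μ B := by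
  ext i j
  have h : star ((B * B.conjTranspose) j i) = (B * B.conjTranspose) i j := by
    rw [← Matrix.conjTranspose_apply, Matrix.conjTranspose_mul, Matrix.conjTranspose_conjTranspose]
  simp only [Matrix.conjTranspose_apply, diagLyapunov, Matrix.of_apply, star_div₀, star_add,
    star_star, h]
  rw [add_comm]

/-- Bass' stabilization of a diagonal controllable pair with input delay. -/
theorem exists_isHurwitz_closedLoopMatrix {𝕜 : Type*} [RCLike 𝕜] (lam : Fin N → 𝕜)
    (B : Matrix (Fin N) (Fin m) 𝕜) (hK : KalmanCondition (Matrix.diagonal lam) B) (D : ℝ) :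
    ∃ K : Matrix (Fin m) (Fin N) 𝕜, IsHurwitz (closedLoopMatrix (Matrix.diagonal lam) B D K) := by
  set B' : Matrix (Fin N) (Fin m) 𝕜 :=
    NormedSpace.exp (((-D : ℝ) : 𝕜) • Matrix.diagonal lam) * B with hB'
  -- The delay only rescales the rows of B by these nonzero factors, which preserves
  -- controllability.
  let e : Fin N → 𝕜 := fun i => NormedSpace.exp (((-D : ℝ) : 𝕜) * lam i)
  have he : ∀ i, e i ≠ 0 := fun i => (NormedSpace.isUnit_exp _).ne_zero
  have hB'e : ∀ i k, B' i k = e i * B i k := by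
    intro i k
    rw [hB', ← Matrix.diagonal_smul, Matrix.exp_diagonal, Matrix.diagonal_mul]
    rw [Pi.coe_exp, Pi.smul_apply, smul_eq_mul]
  -- Large enough for every λ_i + β to have positive real part.
  set β : ℝ := 1 + ∑ i, ‖lam i‖ with hβ
  have hβ0 : 0 < β := by positivity
  have hμ𝕜 : ∀ i, 0 < RCLike.re (lam i) + β := by
    intro i
    have h1 := (abs_le.1 (RCLike.abs_re_le_norm (lam i))).1
    have h2 : ‖lam i‖ ≤ ∑ i, ‖lam i‖ := Finset.single_le_sum (f := fun i => ‖lam i‖)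
      (fun i _ => norm_nonneg _) (Finset.mem_univ i)
    linarith
  set W := diagLyapunov (fun i => lam i + (β : 𝕜)) B' with hW
  set lc : Fin N → ℂ := fun i => toC 𝕜 (lam i)
  set Bc := B'.map (toC 𝕜) with hBc
  set Wc := diagLyapunov (fun i => lc i + (β : ℂ)) Bc with hWc
  have hWmap : W.map (toC 𝕜) = Wc := by
    rw [hW, diagLyapunov_map, hWc]
    simp only [map_add, toC_ofReal, lc, hBc]
  have hμ : ∀ i, 0 < (lc i + (β : ℂ)).re := fun i => by
    simpa [lc, toC_re] using hμ𝕜 i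
  have hpos : ∀ v : Fin N → ℂ, v ≠ 0 → 0 < (dotProduct v (Wc.mulVec (star v))).re := by
    intro v hv
    refine diagLyapunov_form_pos hμ (fun x hx => ?_) hv
    have h1 : (fun i => x i * toC 𝕜 (e i)) = 0 := by
      refine hK.eq_zero_of_sum fun p k => ?_
      have h2 := sum_mul_pow_shift_eq_zero (x := fun i => x i * Bc i k) (μ := lc) β
        (fun q => by
          rw [← hx q k]
          refine Finset.sum_congr rfl fun i _ => ?_
          ring) p
      rw [← h2]
      refine Finset.sum_congr rfl fun i _ => ?_
      simp only [hBc, Matrix.map_apply, hB'e, map_mul, lc]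
      ring
    funext i
    have h3 := congrFun h1 i
    simpa [he i] using h3
  have hdet : IsUnit W.det := by
    rw [isUnit_iff_ne_zero]
    intro h0
    have h1 : Wc.det = 0 := by
      rw [← hWmap, ← RingHom.mapMatrix_apply, ← RingHom.map_det, h0, map_zero]
    obtain ⟨v, hv, hv0⟩ := Matrix.exists_mulVec_eq_zero_iff.2 h1
    have h2 := hpos (star v) (by simpa using hv)
    rw [star_star, hv0] at h2
    simp at h2
  refine ⟨-(B'.conjTranspose * W⁻¹), fun μ hμs => ?_⟩
  change μ ∈ spectrum ℂ ((closedLoopMatrix _ B D _).map (toC 𝕜)) at hμs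
  set Ac := (closedLoopMatrix (Matrix.diagonal lam) B D (-(B'.conjTranspose * W⁻¹))).map (toC 𝕜)
    with hAc
  have hAcW : Ac * Wc = Matrix.diagonal lc * Wc - Bc * Bc.conjTranspose := by
    have h1 : closedLoopMatrix (Matrix.diagonal lam) B D (-(B'.conjTranspose * W⁻¹)) * W =
        Matrix.diagonal lam * W - B' * B'.conjTranspose := by
      rw [closedLoopMatrix, ← hB', Matrix.mul_neg, ← sub_eq_add_neg, Matrix.sub_mul,
        ← Matrix.mul_assoc, Matrix.mul_assoc _ W⁻¹ W, Matrix.nonsing_inv_mul _ hdet,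
        Matrix.mul_one]
    have h2 := congrArg (fun M => M.map (toC 𝕜)) h1
    simp only [Matrix.map_mul, Matrix.map_sub _ (map_sub (toC 𝕜)), hWmap,
      Matrix.diagonal_map (map_zero (toC 𝕜))] at h2
    rw [Matrix.conjTranspose_map _ (fun z => toC_star z)] at h2
    exact h2
  have hWH : Wc.conjTranspose = Wc := diagLyapunov_conjTranspose _ _
  have hlyap : Ac * Wc + Wc * Ac.conjTranspose =
      -(Bc * Bc.conjTranspose) - (2 * β : ℂ) • Wc := by
    have h1 : Wc * Ac.conjTranspose = (Ac * Wc).conjTranspose := by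
      rw [Matrix.conjTranspose_mul, hWH]
    rw [h1, hAcW, Matrix.conjTranspose_sub, Matrix.conjTranspose_mul, Matrix.conjTranspose_mul,
      Matrix.conjTranspose_conjTranspose, hWH]
    have h2 := diagLyapunov_eq lc β hμ Bc
    rw [← hWc] at h2
    rw [sub_add_sub_comm, h2]
    abel
  -- Testing the Lyapunov identity on a left eigenvector gives 2 Re μ Re w = -|v Bc|² - 2β Re w with
  -- Re w > 0, which excludes Re μ ≥ 0.
  obtain ⟨v, hv0, hv⟩ : ∃ v : Fin N → ℂ, v ≠ 0 ∧ Matrix.vecMul v Ac = μ • v := by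
    rw [spectrum.mem_iff, Matrix.isUnit_iff_isUnit_det, isUnit_iff_ne_zero, not_not] at hμs
    obtain ⟨v, hv0, hv⟩ := Matrix.exists_vecMul_eq_zero_iff.2 hμs
    refine ⟨v, hv0, ?_⟩
    rw [Matrix.vecMul_sub, sub_eq_zero, Algebra.algebraMap_eq_smul_one, Matrix.vecMul_smul,
      Matrix.vecMul_one] at hv
    exact hv.symm
  have hr := hpos v hv0
  set w := dotProduct v (Wc.mulVec (star v))
  have h1 : dotProduct v ((Ac * Wc).mulVec (star v)) = μ * w := by
    rw [← Matrix.mulVec_mulVec, Matrix.dotProduct_mulVec, hv, smul_dotProduct, smul_eq_mul]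
  have h2 : dotProduct v ((Wc * Ac.conjTranspose).mulVec (star v)) = star μ * w := by
    rw [← Matrix.mulVec_mulVec, ← Matrix.star_vecMul, hv, star_smul, Matrix.mulVec_smul,
      dotProduct_smul, smul_eq_mul]
  have h3 : 0 ≤ (dotProduct v ((Bc * Bc.conjTranspose).mulVec (star v))).re := by
    rw [← Matrix.mulVec_mulVec, ← Matrix.star_vecMul, Matrix.dotProduct_mulVec]
    simp only [dotProduct, Pi.star_apply, Complex.re_sum]
    refine Finset.sum_nonneg fun i _ => ?_
    rw [Complex.star_def, Complex.mul_conj, Complex.ofReal_re]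
    exact Complex.normSq_nonneg _
  have h4 := congrArg (fun M => (dotProduct v (Matrix.mulVec M (star v))).re) hlyap
  simp only [Matrix.add_mulVec, dotProduct_add, h1, h2, Matrix.sub_mulVec, dotProduct_sub,
    Matrix.neg_mulVec, dotProduct_neg, Matrix.smul_mulVec, dotProduct_smul, smul_eq_mul,
    Complex.add_re, Complex.sub_re, Complex.neg_re, Complex.mul_re, Complex.star_def,
    Complex.conj_re, Complex.conj_im, Complex.ofReal_re, Complex.ofReal_im, Complex.re_ofNat,
    Complex.im_ofNat, Complex.mul_im] at h4
  have h5 : dotProduct v (Wc.mulVec (star v)) = w := rfl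
  rw [h5] at h4
  by_contra hcon
  rw [not_lt] at hcon
  nlinarith [mul_nonneg hcon hr.le, mul_pos hβ0 hr]

end Stabilization

/-! ### C₀-semigroups and their generators -/

section Semigroup

variable {𝕜 : Type*} [RCLike 𝕜]

lemma norm_exp_real_smul (r : ℝ) (z : 𝕜) :
    ‖NormedSpace.exp (r • z)‖ = Real.exp (r * RCLike.re z) := by
  rw [← norm_toC, NormedSpace.map_exp (toC 𝕜) continuous_toC, ← Complex.exp_eq_exp_ℂ,
    Complex.norm_exp, toC_re, RCLike.smul_re]

lemma hasDerivWithinAt_Ici_iff_tendsto {F : Type*} [NormedAddCommGroup F] [NormedSpace ℝ F]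
    {f : ℝ → F} {y : F} {t : ℝ} : HasDerivWithinAt f y (Ici t) t ↔
      Tendsto (fun h => h⁻¹ • (f (t + h) - f t)) (𝓝[>] 0) (𝓝 y) := by
  rw [← hasDerivWithinAt_Ioi_iff_Ici, hasDerivWithinAt_iff_tendsto_slope' self_notMem_Ioi]
  have h1 : 𝓝[>] t = map (fun h => t + h) (𝓝[>] 0) := by simp
  rw [h1, tendsto_map'_iff]
  refine tendsto_congr fun h => ?_
  simp [slope_def_module]

variable {H : Type*} [NormedAddCommGroup H] [InnerProductSpace 𝕜 H]

namespace IsC0Semigroup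

variable {S : ℝ → H →L[𝕜] H}

lemma tendsto_zero (hS : IsC0Semigroup S) (x : H) :
    Tendsto (fun t => S t x) (𝓝[≥] 0) (𝓝 x) := by
  have h : ContinuousWithinAt (fun t => S t x) (Ioi 0) 0 := by
    have := hS.strongly_continuous x
    simpa [ContinuousWithinAt, hS.zero] using this
  have h2 := continuousWithinAt_Ioi_iff_Ici.1 h
  simpa [ContinuousWithinAt, hS.zero] using h2

lemma apply_add (hS : IsC0Semigroup S) {s t : ℝ} (hs : 0 ≤ s) (ht : 0 ≤ t) (x : H) :
    S (s + t) x = S s (S t x) := by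
  rw [hS.add s t hs ht]; rfl

/-- Otherwise there are times t_n → 0 with ‖S(t_n)‖ > n, although every orbit converges along them;
this contradicts uniform boundedness. -/
lemma exists_bound_near_zero [CompleteSpace H] (hS : IsC0Semigroup S) :
    ∃ δ C : ℝ, 0 < δ ∧ ∀ t ∈ Icc 0 δ, ‖S t‖ ≤ C := by
  by_contra! hcon
  choose t ht hbig using fun n : ℕ => hcon (1 / (n + 1)) n (by positivity)
  have hlim : Tendsto t atTop (𝓝[≥] 0) := by
    refine tendsto_nhdsWithin_iff.2 ⟨?_, Eventually.of_forall fun n => (ht n).1⟩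
    exact squeeze_zero (fun n => (ht n).1) (fun n => (ht n).2) tendsto_one_div_add_atTop_nhds_zero_nat
  obtain ⟨C, hC⟩ := banach_steinhaus (g := fun n => S (t n)) fun x => by
    obtain ⟨C, hC⟩ := (Metric.isBounded_range_of_tendsto _
      ((hS.tendsto_zero x).comp hlim)).exists_norm_le
    exact ⟨C, fun n => hC _ ⟨n, rfl⟩⟩
  obtain ⟨n, hn⟩ := exists_nat_gt C
  exact absurd (hbig n) (not_lt.2 ((hC n).trans hn.le))

lemma exists_bound [CompleteSpace H] (hS : IsC0Semigroup S) (T : ℝ) :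
    ∃ C : ℝ, 0 ≤ C ∧ ∀ t ∈ Icc 0 T, ‖S t‖ ≤ C := by
  obtain ⟨δ, C, hδ, hC⟩ := hS.exists_bound_near_zero
  have key : ∀ n : ℕ, ∃ M : ℝ, 0 ≤ M ∧ ∀ t ∈ Icc 0 (n * δ), ‖S t‖ ≤ M := by
    intro n
    induction n with
    | zero =>
      refine ⟨‖S 0‖, norm_nonneg _, fun t ht => ?_⟩
      have : t = 0 := by
        obtain ⟨h1, h2⟩ := ht
        simp at h2
        linarith
      rw [this]
    | succ n ih =>
      obtain ⟨M, hM0, hM⟩ := ih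
      have hC0 : 0 ≤ C := (norm_nonneg _).trans (hC 0 ⟨le_rfl, hδ.le⟩)
      refine ⟨max M (C * M), le_max_of_le_left hM0, fun t ht => ?_⟩
      rcases le_total t (n * δ) with h | h
      · exact (hM t ⟨ht.1, h⟩).trans (le_max_left _ _)
      · refine le_trans ?_ (le_max_right _ _)
        have h2 := ht.2
        push_cast at h2
        have h0 : 0 ≤ n * δ := by positivity
        have h1 : S t = S (t - n * δ) * S (n * δ) := by
          rw [← hS.add _ _ (by linarith) h0, sub_add_cancel]
        rw [h1]
        refine (norm_mul_le _ _).trans ?_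
        gcongr
        · exact hC _ ⟨by linarith, by linarith⟩
        · exact hM _ ⟨h0, le_rfl⟩
  obtain ⟨n, hn⟩ := exists_nat_ge (T / δ)
  obtain ⟨M, hM0, hM⟩ := key n
  exact ⟨M, hM0, fun t ht => hM t ⟨ht.1, ht.2.trans ((div_le_iff₀ hδ).1 hn)⟩⟩

/-- Factoring out the semigroup at the earlier time reduces continuity at any time to strong
continuity at 0. -/
lemma norm_sub_le_of_le (hS : IsC0Semigroup S) {T C : ℝ} (hC : ∀ t ∈ Icc 0 T, ‖S t‖ ≤ C) (x : H)
    {s t : ℝ} (hs : s ∈ Icc 0 T) (ht : t ∈ Icc 0 T) :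
    ‖S t x - S s x‖ ≤ C * ‖S |t - s| x - x‖ := by
  have key : ∀ {s t : ℝ}, s ∈ Icc 0 T → t ∈ Icc 0 T → s ≤ t →
      ‖S t x - S s x‖ ≤ C * ‖S |t - s| x - x‖ := by
    intro s t hs ht hst
    have h1 : S t x = S s (S (t - s) x) := by
      rw [← hS.apply_add hs.1 (by linarith), add_sub_cancel]
    rw [h1, ← map_sub, abs_of_nonneg (sub_nonneg.2 hst)]
    exact (S s).le_of_opNorm_le (hC s hs) _
  rcases le_total s t with h | h
  · exact key hs ht h
  · rw [norm_sub_rev, abs_sub_comm]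
    exact key ht hs h

/-- Joint continuity of a `C₀`-semigroup, extended by the identity to negative times. -/
lemma continuous_uncurry [CompleteSpace H] (hS : IsC0Semigroup S) :
    Continuous fun p : ℝ × H => S (max p.1 0) p.2 := by
  rw [continuous_iff_continuousAt]
  rintro ⟨t₀, x₀⟩
  set T := max t₀ 0 + 1
  obtain ⟨C, hC0, hC⟩ := hS.exists_bound T
  have hT0 : max t₀ 0 ∈ Icc 0 T := ⟨le_max_right _ _, by simp [T]⟩
  have h1 : Tendsto (fun p : ℝ × H => |max p.1 0 - max t₀ 0|) (𝓝 (t₀, x₀)) (𝓝[≥] 0) := by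
    refine tendsto_nhdsWithin_iff.2 ⟨?_, Eventually.of_forall fun p => mem_Ici.2 (abs_nonneg _)⟩
    have : Continuous fun p : ℝ × H => |max p.1 0 - max t₀ 0| := by fun_prop
    simpa using this.tendsto (t₀, x₀)
  have h2 : Tendsto (fun p : ℝ × H => C * ‖S |max p.1 0 - max t₀ 0| x₀ - x₀‖ + C * ‖p.2 - x₀‖)
      (𝓝 (t₀, x₀)) (𝓝 0) := by
    have h3 : Tendsto (fun p : ℝ × H => C * ‖S |max p.1 0 - max t₀ 0| x₀ - x₀‖)
        (𝓝 (t₀, x₀)) (𝓝 0) := by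
      have := (((hS.tendsto_zero x₀).comp h1).sub_const x₀).norm.const_mul C
      simpa using this
    have h4 : Tendsto (fun p : ℝ × H => C * ‖p.2 - x₀‖) (𝓝 (t₀, x₀)) (𝓝 0) := by
      have : Continuous fun p : ℝ × H => C * ‖p.2 - x₀‖ := by fun_prop
      simpa using this.tendsto (t₀, x₀)
    simpa using h3.add h4
  rw [ContinuousAt, tendsto_iff_norm_sub_tendsto_zero]
  refine squeeze_zero' (Eventually.of_forall fun _ => norm_nonneg _) ?_ h2
  have hev : ∀ᶠ p : ℝ × H in 𝓝 (t₀, x₀), max p.1 0 < T :=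
    (Continuous.tendsto (by fun_prop : Continuous fun p : ℝ × H => max p.1 0)
      (t₀, x₀)).eventually (gt_mem_nhds (by simp [T]))
  filter_upwards [hev] with p hp
  have hpT : max p.1 0 ∈ Icc 0 T := ⟨le_max_right _ _, hp.le⟩
  have h5 : S (max p.1 0) p.2 - S (max t₀ 0) x₀ =
      (S (max p.1 0) x₀ - S (max t₀ 0) x₀) + S (max p.1 0) (p.2 - x₀) := by
    rw [map_sub]; abel
  rw [h5]
  exact (norm_add_le _ _).trans (add_le_add (hS.norm_sub_le_of_le hC x₀ hT0 hpT)
    ((S _).le_of_opNorm_le (hC _ hpT) _))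

lemma continuous_comp [CompleteSpace H] (hS : IsC0Semigroup S) {Y : Type*} [TopologicalSpace Y]
    {τ : Y → ℝ} {f : Y → H} (hτ : Continuous τ) (hf : Continuous f) :
    Continuous fun y => S (max (τ y) 0) (f y) :=
  hS.continuous_uncurry.comp (hτ.prodMk hf)

variable [NormedSpace ℝ H] [IsScalarTower ℝ 𝕜 H] {A : H →ₗ.[𝕜] H}

lemma tendsto_of_mem_graph (hA : IsGenerator A S) {x y : H} (h : (x, y) ∈ A.graph) :
    Tendsto (fun r : ℝ => r⁻¹ • (S r x - x)) (𝓝[>] 0) (𝓝 y) := by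
  simp only [RCLike.real_smul_eq_coe_smul (K := 𝕜)]
  exact (hA x y).1 h

lemma mem_graph_of_tendsto (hA : IsGenerator A S) {x y : H}
    (h : Tendsto (fun r : ℝ => r⁻¹ • (S r x - x)) (𝓝[>] 0) (𝓝 y)) : (x, y) ∈ A.graph := by
  simp only [RCLike.real_smul_eq_coe_smul (K := 𝕜)] at h
  exact (hA x y).2 h

lemma tendsto_slope_apply (hA : IsGenerator A S) {x y : H} (h : (x, y) ∈ A.graph) (t : ℝ) :
    Tendsto (fun r : ℝ => r⁻¹ • (S t (S r x) - S t x)) (𝓝[>] 0) (𝓝 (S t y)) := by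
  have h1 := ((S t).continuous.tendsto y).comp (tendsto_of_mem_graph hA h)
  refine h1.congr fun r => ?_
  simp only [Function.comp_apply, RCLike.real_smul_eq_coe_smul (K := 𝕜), map_smul, map_sub]

lemma mem_graph_apply (hS : IsC0Semigroup S) (hA : IsGenerator A S) {x y : H}
    (h : (x, y) ∈ A.graph) {t : ℝ} (ht : 0 ≤ t) : (S t x, S t y) ∈ A.graph := by
  refine mem_graph_of_tendsto hA ((tendsto_slope_apply hA h t).congr' ?_)
  filter_upwards [self_mem_nhdsWithin] with r hr
  rw [← hS.apply_add ht (le_of_lt hr), ← hS.apply_add (le_of_lt hr) ht, add_comm]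

lemma hasDerivWithinAt_right (hS : IsC0Semigroup S) (hA : IsGenerator A S) {x y : H}
    (h : (x, y) ∈ A.graph) {t : ℝ} (ht : 0 ≤ t) :
    HasDerivWithinAt (fun s => S s x) (S t y) (Ici t) t := by
  rw [hasDerivWithinAt_Ici_iff_tendsto]
  refine (tendsto_slope_apply hA h t).congr' ?_
  filter_upwards [self_mem_nhdsWithin] with r hr
  rw [← hS.apply_add ht (le_of_lt hr)]

/-- Orbits of points of the domain of the generator are continuously differentiable. -/
lemma hasDerivWithinAt_orbit [CompleteSpace H] (hS : IsC0Semigroup S) (hA : IsGenerator A S)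
    {x y : H} (h : (x, y) ∈ A.graph) {t : ℝ} (ht : 0 ≤ t) :
    HasDerivWithinAt (fun s => S (max s 0) x) (S t y) (Ici 0) t := by
  have hy : Continuous fun s => S (max s 0) y := hS.continuous_comp continuous_id continuous_const
  have hg : ∀ r, HasDerivAt (fun r => x + ∫ s in (0 : ℝ)..r, S (max s 0) y) (S (max r 0) y) r :=
    fun r => (hy.integral_hasStrictDerivAt 0 r).hasDerivAt.const_add x
  -- The semigroup law yields only a right derivative. Continuous functions with equal right
  -- derivatives and equal initial values coincide, so the orbit inherits the full derivative of the
  -- integral.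
  have heq : EqOn (fun s => S (max s 0) x) (fun r => x + ∫ s in (0 : ℝ)..r, S (max s 0) y)
      (Ici 0) := by
    intro T hT
    refine eq_of_has_deriv_right_eq (f' := fun r => S (max r 0) y) (a := 0) (b := T)
      (fun r hr => ?_) (fun r _ => (hg r).hasDerivWithinAt)
      (hS.continuous_comp continuous_id continuous_const).continuousOn
      (fun r _ => (hg r).continuousAt.continuousWithinAt) (by simp [hS.zero]) T ⟨hT, le_rfl⟩
    rw [max_eq_left hr.1]
    refine (hS.hasDerivWithinAt_right hA h hr.1).congr_of_mem (fun s hs => ?_) self_mem_Ici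
    change S (max s 0) x = S s x
    rw [max_eq_left (hr.1.trans hs)]
  have h1 := (hg t).hasDerivWithinAt (s := Ici 0)
  rw [max_eq_left ht] at h1
  exact h1.congr_of_mem heq ht

lemma apply_eigenvector [CompleteSpace H] (hS : IsC0Semigroup S) (hA : IsGenerator A S) {x : H}
    {μ : 𝕜} (h : (x, μ • x) ∈ A.graph) {t : ℝ} (ht : 0 ≤ t) :
    S t x = NormedSpace.exp (t • μ) • x := by
  let M : H →L[ℝ] H := (μ • ContinuousLinearMap.id 𝕜 H).restrictScalars ℝ
  have h1 := eqOn_of_hasDerivWithinAt_affine (M := fun _ => M) (C := ‖M‖) (g := fun _ => 0)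
    (z := fun s => S (max s 0) x) (w := fun s : ℝ => NormedSpace.exp (s • μ) • x)
    (fun _ _ => le_rfl) (fun s hs => ?_) (fun s _ => ?_) (by simp [hS.zero]) ht
  · simpa [max_eq_left ht] using h1
  · refine (hS.hasDerivWithinAt_orbit hA h hs).congr_deriv ?_
    simp [M, max_eq_left (mem_Ici.1 hs)]
  · have h2 : HasDerivAt (fun s : ℝ => NormedSpace.exp (s • μ) • x)
        ((μ * NormedSpace.exp (s • μ)) • x) s := by
      have h3 := hasDerivAt_exp_smul_const' (𝕂 := ℝ) μ s
      exact h3.smul_const x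
    refine h2.hasDerivWithinAt.congr_deriv ?_
    simp [M, smul_smul]

end IsC0Semigroup

/-! ### Riesz bases and the modal action of the semigroup -/

section Riesz

variable {φ ψ : ℕ → H}

lemma inner_biorthogonal_sum (hψ : IsBiorthogonal 𝕜 φ ψ) {N n : ℕ} (hn : n < N) (c : ℕ → 𝕜) :
    inner 𝕜 (ψ n) (∑ k ∈ Finset.range N, c k • φ k) = c n := by
  rw [inner_sum]
  simp only [inner_smul_right, hψ _ n]
  simp [hn]

lemma exists_sum_of_mem_span {x : H} (hx : x ∈ Submodule.span 𝕜 (range φ)) (N₀ : ℕ) :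
    ∃ N, N₀ ≤ N ∧ ∃ c : ℕ → 𝕜, x = ∑ k ∈ Finset.range N, c k • φ k := by
  obtain ⟨c, rfl⟩ := Finsupp.mem_span_range_iff_exists_finsupp.1 hx
  refine ⟨max N₀ (c.support.sup id + 1), le_max_left _ _, c, ?_⟩
  refine Finsupp.sum_of_support_subset c (fun k hk => ?_) _ (by simp)
  rw [Finset.mem_range, lt_max_iff]
  exact Or.inr (Nat.lt_succ_of_le (Finset.le_sup (f := id) hk))

/-- On finite combinations the functionals ⟨·, ψ_n⟩ read off the coefficients, and this is the lower
Riesz bound; density does the rest. -/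
lemma IsRieszBasis.bessel (hφ : IsRieszBasis 𝕜 φ) (hψ : IsBiorthogonal 𝕜 φ ψ) :
    ∃ mR : ℝ, 0 < mR ∧ ∀ (x : H) (N : ℕ),
      mR * ∑ n ∈ Finset.range N, ‖inner 𝕜 (ψ n) x‖ ^ 2 ≤ ‖x‖ ^ 2 := by
  obtain ⟨hd, mR, MR, hm, hM, h⟩ := hφ
  refine ⟨mR, hm, fun x N => ?_⟩
  refine hd.induction (P := fun x => mR * ∑ n ∈ Finset.range N, ‖inner 𝕜 (ψ n) x‖ ^ 2 ≤ ‖x‖ ^ 2)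
    (fun y hy => ?_) (isClosed_le (by fun_prop) (by fun_prop)) x
  obtain ⟨N', hN', c, rfl⟩ := exists_sum_of_mem_span hy N
  refine le_trans ?_ (h N' c).1
  gcongr
  refine le_trans (Finset.sum_le_sum_of_subset_of_nonneg (Finset.range_mono hN')
    fun _ _ _ => by positivity) (Finset.sum_le_sum fun n hn => ?_)
  rw [inner_biorthogonal_sum hψ (Finset.mem_range.1 hn)]

/-- The biorthogonal sequence of a Riesz basis is total. -/
lemma IsRieszBasis.eq_zero_of_inner_eq_zero (hφ : IsRieszBasis 𝕜 φ) (hψ : IsBiorthogonal 𝕜 φ ψ)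
    {x : H} (hx : ∀ n, inner 𝕜 (ψ n) x = 0) : x = 0 := by
  obtain ⟨b, hb, hbes⟩ := hφ.bessel hψ
  obtain ⟨hd, mR, MR, hm, hM, h⟩ := hφ
  -- For y in the span, y and y - x have the same coefficients, since every ψ_n annihilates x.
  -- Bessel bounds them by y - x, and the upper Riesz bound then controls y. At z = x the right side
  -- is 0.
  have key : ∀ z, b * ‖z‖ ^ 2 ≤ MR * ‖z - x‖ ^ 2 := by
    intro z
    refine hd.induction (P := fun z => b * ‖z‖ ^ 2 ≤ MR * ‖z - x‖ ^ 2) (fun y hy => ?_)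
      (isClosed_le (by fun_prop) (by fun_prop)) z
    obtain ⟨N, -, c, hc⟩ := exists_sum_of_mem_span hy 0
    have h1 := hbes (y - x) N
    have h2 : ∑ n ∈ Finset.range N, ‖inner 𝕜 (ψ n) (y - x)‖ ^ 2 =
        ∑ n ∈ Finset.range N, ‖c n‖ ^ 2 := by
      refine Finset.sum_congr rfl fun n hn => ?_
      rw [inner_sub_right, hx, sub_zero, hc, inner_biorthogonal_sum hψ (Finset.mem_range.1 hn)]
    rw [h2] at h1
    have h3 := (h N c).2
    rw [← hc] at h3
    calc b * ‖y‖ ^ 2 ≤ b * (MR * ∑ n ∈ Finset.range N, ‖c n‖ ^ 2) := by gcongr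
      _ = MR * (b * ∑ n ∈ Finset.range N, ‖c n‖ ^ 2) := by ring
      _ ≤ _ := by gcongr
  have h1 := key x
  rw [sub_self, norm_zero] at h1
  have h2 : ‖x‖ ^ 2 ≤ 0 := by
    by_contra hcon
    rw [not_le] at hcon
    nlinarith [mul_pos hb hcon]
  exact norm_eq_zero.1 (pow_eq_zero_iff two_ne_zero |>.1 (le_antisymm h2 (by positivity)))

/-- The projection onto the modes of index at least `N₀` along the first ones. -/
def tailProj (𝕜 : Type*) [RCLike 𝕜] {H : Type*} [NormedAddCommGroup H] [InnerProductSpace 𝕜 H]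
    (φ ψ : ℕ → H) (N₀ : ℕ) : H →L[𝕜] H :=
  ContinuousLinearMap.id 𝕜 H - ∑ n ∈ Finset.range N₀, (innerSL 𝕜 (ψ n)).smulRight (φ n)

lemma tailProj_apply (N₀ : ℕ) (x : H) : tailProj 𝕜 φ ψ N₀ x =
    x - ∑ n ∈ Finset.range N₀, inner 𝕜 (ψ n) x • φ n := by
  simp [tailProj]

variable [NormedSpace ℝ H] [IsScalarTower ℝ 𝕜 H] [CompleteSpace H] {A : H →ₗ.[𝕜] H}
  {S : ℝ → H →L[𝕜] H} {lam : ℕ → 𝕜}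

/-- Two continuous functionals that agree on each φ_k, by biorthogonality, agree everywhere. In
effect ψ_n is an eigenvector of the adjoint semigroup. -/
lemma inner_semigroup_apply (hS : IsC0Semigroup S) (hA : IsGenerator A S)
    (hR : IsRieszSpectral A lam φ) (hψ : IsBiorthogonal 𝕜 φ ψ) (n : ℕ) {t : ℝ} (ht : 0 ≤ t)
    (x : H) : inner 𝕜 (ψ n) (S t x) = NormedSpace.exp (t • lam n) * inner 𝕜 (ψ n) x := by
  have h1 : (innerSL 𝕜 (ψ n)) ∘L (S t) = NormedSpace.exp (t • lam n) • innerSL 𝕜 (ψ n) := by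
    refine ContinuousLinearMap.ext_on hR.rieszBasis.1 ?_
    rintro _ ⟨k, rfl⟩
    simp only [ContinuousLinearMap.comp_apply, innerSL_apply_apply, smul_apply,
      hS.apply_eigenvector hA (hR.eigen k) ht, inner_smul_right, hψ k n, smul_eq_mul]
    by_cases h : k = n
    · rw [h]
    · simp [h]
  exact congrArg (fun f : H →L[𝕜] 𝕜 => f x) h1

/-- Obtained by differentiating the scalar identity for the semigroup at time 0, so the adjoint of
the unbounded generator never enters. -/
lemma inner_generator (hS : IsC0Semigroup S) (hA : IsGenerator A S)
    (hR : IsRieszSpectral A lam φ) (hψ : IsBiorthogonal 𝕜 φ ψ) (n : ℕ) {x y : H}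
    (h : (x, y) ∈ A.graph) : inner 𝕜 (ψ n) y = lam n * inner 𝕜 (ψ n) x := by
  have h1 : Tendsto (fun r : ℝ => r⁻¹ • (inner 𝕜 (ψ n) (S r x) - inner 𝕜 (ψ n) x)) (𝓝[>] 0)
      (𝓝 (inner 𝕜 (ψ n) y)) := by
    have := ((innerSL 𝕜 (ψ n)).continuous.tendsto y).comp
      (IsC0Semigroup.tendsto_of_mem_graph hA h)
    refine this.congr fun r => ?_
    simp only [Function.comp_apply, RCLike.real_smul_eq_coe_smul (K := 𝕜), map_smul, map_sub,
      innerSL_apply_apply]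
  have h2 : Tendsto (fun r : ℝ => r⁻¹ • (inner 𝕜 (ψ n) (S r x) - inner 𝕜 (ψ n) x)) (𝓝[>] 0)
      (𝓝 (lam n * inner 𝕜 (ψ n) x)) := by
    have h3 := ((hasDerivAt_exp_smul_const (𝕂 := ℝ) (lam n) (0 : ℝ)).mul_const
      (inner 𝕜 (ψ n) x)).tendsto_slope_zero_right
    simp only [zero_add, zero_smul, NormedSpace.exp_zero, one_mul] at h3
    refine h3.congr' ?_
    filter_upwards [self_mem_nhdsWithin] with r hr
    rw [inner_semigroup_apply hS hA hR hψ n (le_of_lt hr)]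
  exact tendsto_nhds_unique h1 h2

lemma tailProj_semigroup (hS : IsC0Semigroup S) (hA : IsGenerator A S)
    (hR : IsRieszSpectral A lam φ) (hψ : IsBiorthogonal 𝕜 φ ψ) (N₀ : ℕ) {t : ℝ} (ht : 0 ≤ t)
    (x : H) : tailProj 𝕜 φ ψ N₀ (S t x) = S t (tailProj 𝕜 φ ψ N₀ x) := by
  simp only [tailProj_apply, map_sub, map_sum, map_smul,
    inner_semigroup_apply hS hA hR hψ _ ht, hS.apply_eigenvector hA (hR.eigen _) ht, smul_smul]
  simp only [mul_comm]

/-- Exponential decay of the semigroup on the stable modes. -/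
lemma exists_norm_semigroup_tailProj_le (hS : IsC0Semigroup S) (hA : IsGenerator A S)
    (hR : IsRieszSpectral A lam φ) (hψ : IsBiorthogonal 𝕜 φ ψ) {N₀ : ℕ} {α : ℝ}
    (hα : ∀ n, N₀ ≤ n → RCLike.re (lam n) ≤ -α) :
    ∃ C : ℝ, 0 ≤ C ∧ ∀ t : ℝ, 0 ≤ t → ∀ x,
      ‖S t (tailProj 𝕜 φ ψ N₀ x)‖ ≤ C * Real.exp (-α * t) * ‖x‖ := by
  obtain ⟨hd, mR, MR, hm, hM, h⟩ := hR.rieszBasis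
  refine ⟨√(MR / mR), Real.sqrt_nonneg _, fun t ht x => ?_⟩
  refine hd.induction (P := fun x => ‖S t (tailProj 𝕜 φ ψ N₀ x)‖ ≤
    √(MR / mR) * Real.exp (-α * t) * ‖x‖) (fun y hy => ?_)
    (isClosed_le (by fun_prop) (by fun_prop)) x
  obtain ⟨N, hN, c, rfl⟩ := exists_sum_of_mem_span hy N₀
  -- Coefficients after the first modes are removed and the others evolved. The two Riesz bounds
  -- compare norms at the price of √(MR / mR).
  let c' : ℕ → 𝕜 := fun n => if n < N₀ then 0 else NormedSpace.exp (t • lam n) * c n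
  have h1 : S t (tailProj 𝕜 φ ψ N₀ (∑ k ∈ Finset.range N, c k • φ k)) =
      ∑ k ∈ Finset.range N, c' k • φ k := by
    rw [tailProj_apply]
    have h2 : ∑ n ∈ Finset.range N₀, inner 𝕜 (ψ n) (∑ k ∈ Finset.range N, c k • φ k) • φ n =
        ∑ n ∈ Finset.range N, (if n < N₀ then c n else 0) • φ n := by
      rw [← Finset.sum_subset (f := fun n => (if n < N₀ then c n else 0) • φ n)
        (Finset.range_mono hN)]
      · refine Finset.sum_congr rfl fun n hn => ?_
        have hn' := Finset.mem_range.1 hn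
        rw [inner_biorthogonal_sum hψ (hn'.trans_le hN), if_pos hn']
      · intro n _ hn
        have hn' : ¬ n < N₀ := by simpa using hn
        rw [if_neg hn', zero_smul]
    rw [h2, ← Finset.sum_sub_distrib, map_sum]
    refine Finset.sum_congr rfl fun n _ => ?_
    rw [← sub_smul, map_smul, hS.apply_eigenvector hA (hR.eigen n) ht, smul_smul]
    by_cases hn : n < N₀
    · simp [c', hn]
    · simp [c', hn, mul_comm]
  have h3 : ∑ n ∈ Finset.range N, ‖c' n‖ ^ 2 ≤
      Real.exp (-α * t) ^ 2 * ∑ n ∈ Finset.range N, ‖c n‖ ^ 2 := by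
    rw [Finset.mul_sum]
    refine Finset.sum_le_sum fun n _ => ?_
    by_cases hn : n < N₀
    · have h0 : c' n = 0 := if_pos hn
      rw [h0, norm_zero, zero_pow two_ne_zero]
      positivity
    · simp only [c', if_neg hn, norm_mul, mul_pow, norm_exp_real_smul]
      refine mul_le_mul_of_nonneg_right (pow_le_pow_left₀ (Real.exp_pos _).le ?_ 2) (sq_nonneg _)
      rw [Real.exp_le_exp, mul_comm]
      exact mul_le_mul_of_nonneg_right (hα n (not_lt.1 hn)) ht
  rw [h1]
  refine abs_le_of_sq_le_sq' ?_ (by positivity) |>.2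
  rw [mul_pow, mul_pow, Real.sq_sqrt (by positivity)]
  calc _ ≤ MR * ∑ n ∈ Finset.range N, ‖c' n‖ ^ 2 := (h N c').2
    _ ≤ MR * (Real.exp (-α * t) ^ 2 * ∑ n ∈ Finset.range N, ‖c n‖ ^ 2) := by gcongr
    _ = MR / mR * Real.exp (-α * t) ^ 2 * (mR * ∑ n ∈ Finset.range N, ‖c n‖ ^ 2) := by
        field_simp
    _ ≤ _ := by
        gcongr
        exact (h N c).1

end Riesz

end Semigroup

/-! ### Convolutions and the inhomogeneous Cauchy problem -/

section Inhomogeneous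

open MeasureTheory

/-- Between t and τ the integrand stays within ε of k(t, t) by joint continuity at that point; no
differentiability in τ is needed. -/
lemma hasDerivAt_integral_moving_endpoint {F : Type*} [NormedAddCommGroup F] [NormedSpace ℝ F]
    [CompleteSpace F] {k : ℝ → ℝ → F} (hk : Continuous fun p : ℝ × ℝ => k p.1 p.2) (t : ℝ) :
    HasDerivAt (fun τ => ∫ s in t..τ, k s τ) (k t t) t := by
  rw [hasDerivAt_iff_isLittleO, Asymptotics.isLittleO_iff]
  intro ε hε
  obtain ⟨δ, hδ, hball⟩ := Metric.continuousAt_iff.1 (hk.continuousAt (x := (t, t))) ε hε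
  filter_upwards [Metric.ball_mem_nhds t hδ] with τ hτ
  rw [Metric.mem_ball, Real.dist_eq] at hτ
  have hint : IntervalIntegrable (fun s => k s τ) volume t τ :=
    Continuous.intervalIntegrable (by fun_prop) _ _
  rw [intervalIntegral.integral_same, sub_zero, ← intervalIntegral.integral_const,
    ← intervalIntegral.integral_sub hint intervalIntegrable_const]
  refine intervalIntegral.norm_integral_le_of_norm_le_const fun s hs => ?_
  rw [← dist_eq_norm]
  refine (hball (x := (s, τ)) ?_).le
  rw [Prod.dist_eq]
  refine max_lt ?_ (by rwa [Real.dist_eq])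
  rw [Real.dist_eq]
  refine lt_of_le_of_lt ?_ hτ
  exact abs_sub_left_of_mem_uIcc (uIoc_subset_uIcc hs)

lemma hasDerivAt_integral_of_continuous_deriv {F : Type*} [NormedAddCommGroup F]
    [NormedSpace ℝ F] [CompleteSpace F] {k k' : ℝ → ℝ → F}
    (hk : Continuous fun p : ℝ × ℝ => k p.1 p.2) (hk' : Continuous fun p : ℝ × ℝ => k' p.1 p.2)
    (hd : ∀ s τ, HasDerivAt (fun τ => k s τ) (k' s τ) τ) (t : ℝ) :
    HasDerivAt (fun τ => ∫ s in (0 : ℝ)..τ, k s τ) (k t t + ∫ s in (0 : ℝ)..t, k' s t) t := by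
  have hcont : ∀ τ, Continuous fun s => k s τ := fun τ => by fun_prop
  have hcont' : ∀ τ, Continuous fun s => k' s τ := fun τ => by fun_prop
  have h1 : HasDerivAt (fun τ => ∫ s in (0 : ℝ)..t, k s τ) (∫ s in (0 : ℝ)..t, k' s t) t := by
    obtain ⟨C, hC⟩ := (isCompact_uIcc.prod (isCompact_closedBall t 1)).exists_bound_of_continuousOn
      (hk'.continuousOn (s := uIcc 0 t ×ˢ Metric.closedBall t 1))
    refine (intervalIntegral.hasDerivAt_integral_of_dominated_loc_of_deriv_le
      (F := fun τ s => k s τ) (F' := fun τ s => k' s τ) (bound := fun _ => C)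
      (Metric.closedBall_mem_nhds t one_pos)
      (Eventually.of_forall fun τ => (hcont τ).aestronglyMeasurable)
      ((hcont t).intervalIntegrable _ _) (hcont' t).aestronglyMeasurable ?_
      intervalIntegrable_const ?_).2
    · exact Eventually.of_forall fun s hs τ hτ => hC (s, τ) ⟨uIoc_subset_uIcc hs, hτ⟩
    · exact Eventually.of_forall fun s _ τ _ => hd s τ
  have h2 := h1.add (hasDerivAt_integral_moving_endpoint hk t)
  rw [add_comm (k t t)]
  convert h2 using 1
  funext τ
  rw [Pi.add_apply, intervalIntegral.integral_add_adjacent_intervals]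
  · exact (hcont τ).intervalIntegrable _ _
  · exact (hcont τ).intervalIntegrable _ _

variable {𝕜 : Type*} [RCLike 𝕜] {H : Type*} [NormedAddCommGroup H] [InnerProductSpace 𝕜 H]
  [CompleteSpace H] {S : ℝ → H →L[𝕜] H}

lemma IsC0Semigroup.continuous_conv_integrand (hS : IsC0Semigroup S) {f : ℝ → H} (hf : Continuous f) :
    Continuous fun p : ℝ × ℝ => S (max p.1 0) (f (p.2 - p.1)) :=
  hS.continuous_comp (τ := fun p : ℝ × ℝ => p.1) (f := fun p : ℝ × ℝ => f (p.2 - p.1))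
    (by fun_prop) (by fun_prop)

variable [NormedSpace ℝ H]

/-- The convolution of a `C₀`-semigroup with a continuous function. -/
def IsC0Semigroup.conv {𝕜 : Type*} [RCLike 𝕜] {H : Type*} [NormedAddCommGroup H]
    [InnerProductSpace 𝕜 H] [NormedSpace ℝ H] (S : ℝ → H →L[𝕜] H) (f : ℝ → H) (t : ℝ) : H := ∫ s in (0 : ℝ)..t, S (max s 0) (f (t - s))

lemma IsC0Semigroup.continuous_conv (hS : IsC0Semigroup S) {f : ℝ → H} (hf : Continuous f) :
    Continuous (conv S f) := by
  have h1 : Continuous fun p : ℝ × ℝ => S (max p.2 0) (f (p.1 - p.2)) :=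
    hS.continuous_comp (τ := fun p : ℝ × ℝ => p.2) (f := fun p : ℝ × ℝ => f (p.1 - p.2))
      (by fun_prop) (by fun_prop)
  exact intervalIntegral.continuous_parametric_intervalIntegral_of_continuous h1 continuous_id

variable [IsScalarTower ℝ 𝕜 H] {A : H →ₗ.[𝕜] H}

lemma map_intervalIntegral (L : H →L[𝕜] H) {f : ℝ → H} (hf : Continuous f) (a b : ℝ) :
    ∫ s in a..b, L (f s) = L (∫ s in a..b, f s) :=
  (L.restrictScalars ℝ).intervalIntegral_comp_comm (hf.intervalIntegrable a b)

namespace IsC0Semigroup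

/-- The time variable sits in f and not in S, so the derivative falls on f and no value of f needs
to lie in the domain of A. -/
lemma hasDerivAt_conv (hS : IsC0Semigroup S) {f : ℝ → H} (hf : ContDiff ℝ 1 f) (t : ℝ) :
    HasDerivAt (conv S f) (S (max t 0) (f 0) + conv S (deriv f) t) t := by
  have hf' : Continuous (deriv f) := hf.continuous_deriv le_rfl
  have h := hasDerivAt_integral_of_continuous_deriv
    (k := fun s τ => S (max s 0) (f (τ - s))) (k' := fun s τ => S (max s 0) (deriv f (τ - s)))
    (hS.continuous_conv_integrand hf.continuous) (hS.continuous_conv_integrand hf')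
    (fun s τ => ?_) t
  · rw [sub_self] at h
    exact h
  · have h1 : HasDerivAt (fun τ => f (τ - s)) (deriv f (τ - s)) τ := by
      have h2 := (hf.differentiable one_ne_zero (τ - s)).hasDerivAt
      simpa using h2.comp_sub_const τ s
    exact ((S (max s 0)).restrictScalars ℝ).hasFDerivAt.comp_hasDerivAt τ h1

lemma apply_conv (hS : IsC0Semigroup S) {f : ℝ → H} (hf : Continuous f) {h t : ℝ} (hh : 0 ≤ h)
    (ht : 0 ≤ t) : S h (conv S f t) =
      conv S f (t + h) - ∫ s in (0 : ℝ)..h, S (max s 0) (f (t + h - s)) := by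
  have hc : ∀ τ, Continuous fun s => S (max s 0) (f (τ - s)) := fun τ =>
    (hS.continuous_conv_integrand hf).comp (continuous_id.prodMk continuous_const)
  rw [conv, ← map_intervalIntegral _ (hc t)]
  have h1 : ∫ s in (0 : ℝ)..t, S h (S (max s 0) (f (t - s))) =
      ∫ s in (0 : ℝ)..t, S (max (s + h) 0) (f (t + h - (s + h))) := by
    refine intervalIntegral.integral_congr fun s hs => ?_
    rw [uIcc_of_le ht] at hs
    rw [max_eq_left hs.1, ← hS.apply_add hh hs.1, max_eq_left (by linarith [hs.1]), add_comm h s,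
      add_sub_add_right_eq_sub]
  rw [h1, intervalIntegral.integral_comp_add_right
    (fun s => S (max s 0) (f (t + h - s))), zero_add, conv, eq_sub_iff_add_eq',
    intervalIntegral.integral_add_adjacent_intervals]
  · exact (hc _).intervalIntegrable _ _
  · exact (hc _).intervalIntegrable _ _

/-- By `apply_conv`, the difference quotient of S at the convolution is the difference quotient of
the convolution in time minus an average over [0, h], which tends to f(t). -/
lemma conv_mem_graph (hS : IsC0Semigroup S) (hA : IsGenerator A S) {f : ℝ → H}
    (hf : ContDiff ℝ 1 f) {t : ℝ} (ht : 0 ≤ t) :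
    (conv S f t, S t (f 0) + conv S (deriv f) t - f t) ∈ A.graph := by
  refine mem_graph_of_tendsto hA ?_
  have h1 := (hS.hasDerivAt_conv hf t).tendsto_slope_zero_right
  rw [max_eq_left ht] at h1
  have hc := hf.continuous
  have h2 := (hasDerivAt_integral_moving_endpoint
    (k := fun s τ => S (max s 0) (f (t + τ - s)))
    (hS.continuous_comp (τ := fun p : ℝ × ℝ => p.1) (f := fun p : ℝ × ℝ => f (t + p.2 - p.1))
      (by fun_prop) (by fun_prop)) 0).tendsto_slope_zero_right
  simp only [max_self, hS.zero, add_zero, sub_zero, one_apply_eq_self, zero_add,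
    intervalIntegral.integral_same] at h2
  refine (h1.sub h2).congr' ?_
  filter_upwards [self_mem_nhdsWithin] with r hr
  rw [hS.apply_conv hc (le_of_lt hr) ht, ← smul_sub]
  congr 1
  abel

/-- Classical solutions of `w' = A w + f` for continuously differentiable `f`. -/
theorem exists_classical_solution (hS : IsC0Semigroup S) (hA : IsGenerator A S) {f : ℝ → H}
    (hf : ContDiff ℝ 1 f) {w₀ : H} (hw₀ : w₀ ∈ A.domain) :
    ∃ Aw : ℝ → H, Continuous Aw ∧ ∀ t : ℝ, 0 ≤ t →
      (S (max t 0) w₀ + conv S f t, Aw t) ∈ A.graph ∧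
      HasDerivWithinAt (fun t => S (max t 0) w₀ + conv S f t) (Aw t + f t) (Ici 0) t := by
  have hg : (w₀, A ⟨w₀, hw₀⟩) ∈ A.graph := A.mem_graph ⟨w₀, hw₀⟩
  set y := A ⟨w₀, hw₀⟩
  have hf' : Continuous (deriv f) := hf.continuous_deriv le_rfl
  refine ⟨fun t => S (max t 0) y + (S (max t 0) (f 0) + conv S (deriv f) t - f t), ?_,
    fun t ht => ⟨?_, ?_⟩⟩
  · exact (hS.continuous_comp continuous_id continuous_const).add
      (((hS.continuous_comp continuous_id continuous_const).add (hS.continuous_conv hf')).sub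
        hf.continuous)
  · change (_, S (max t 0) y + (S (max t 0) (f 0) + conv S (deriv f) t - f t)) ∈ _
    rw [max_eq_left ht]
    exact A.graph.add_mem (hS.mem_graph_apply hA hg ht) (hS.conv_mem_graph hA hf ht)
  · have h1 := (hS.hasDerivWithinAt_orbit hA hg ht).add
      ((hS.hasDerivAt_conv hf t).hasDerivWithinAt (s := Ici 0))
    refine h1.congr_deriv ?_
    simp only [max_eq_left ht]
    abel

end IsC0Semigroup

lemma integral_exp_neg_mul_le {γ : ℝ} (hγ : 0 < γ) (t : ℝ) :
    ∫ s in (0 : ℝ)..t, Real.exp (-γ * s) ≤ 1 / γ := by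
  rw [intervalIntegral.integral_comp_mul_left (fun x => Real.exp x) (neg_ne_zero.2 hγ.ne'),
    integral_exp, smul_eq_mul, mul_zero, Real.exp_zero]
  have h1 := Real.exp_pos (-γ * t)
  rw [inv_neg, neg_mul, ← mul_neg, neg_sub, inv_mul_eq_div]
  gcongr
  linarith

/-- Integral of decaying exponentials against a forcing bounded by a decaying exponential plus a
constant. -/
lemma integral_exp_mul_le {α κ : ℝ} (hκ : 0 < κ) (hκα : κ < α) {a b : ℝ} (ha : 0 ≤ a)
    (hb : 0 ≤ b) (t : ℝ) :
    ∫ s in (0 : ℝ)..t, Real.exp (-α * s) * (a * Real.exp (-κ * (t - s)) + b) ≤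
      a * Real.exp (-κ * t) / (α - κ) + b / α := by
  have hα : 0 < α := hκ.trans hκα
  have hδ : 0 < α - κ := sub_pos.2 hκα
  have h1 : ∀ s, Real.exp (-α * s) * (a * Real.exp (-κ * (t - s)) + b) =
      a * Real.exp (-κ * t) * Real.exp (-(α - κ) * s) + b * Real.exp (-α * s) := by
    intro s
    rw [mul_add, mul_left_comm, mul_assoc a, ← Real.exp_add, ← Real.exp_add, mul_comm _ b]
    congr 3
    ring_nf
  simp_rw [h1]
  rw [intervalIntegral.integral_add (Continuous.intervalIntegrable (by fun_prop) _ _)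
    (Continuous.intervalIntegrable (by fun_prop) _ _), intervalIntegral.integral_const_mul,
    intervalIntegral.integral_const_mul, div_eq_mul_one_div, div_eq_mul_one_div b]
  gcongr
  · exact integral_exp_neg_mul_le hδ t
  · exact integral_exp_neg_mul_le hα t

end Inhomogeneous

/-! ### Extension of the data to the whole line -/

section Extensions

/-- A `C¹` function on `[0, ∞)` extends to a `C¹` function on `ℝ`. -/
lemma exists_contDiff_one_extension {F : Type*} [NormedAddCommGroup F] [NormedSpace ℝ F]
    [CompleteSpace F] {d : ℝ → F} (hd : ContDiffOn ℝ 1 d (Ici 0)) :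
    ∃ d' : ℝ → F, ContDiff ℝ 1 d' ∧ EqOn d' d (Ici 0) := by
  -- The derivative is frozen at its value at 0 for negative times and then integrated.
  let g : ℝ → F := fun s => derivWithin d (Ici 0) (max s 0)
  have hg : Continuous g :=
    (hd.continuousOn_derivWithin (uniqueDiffOn_Ici 0) le_rfl).comp_continuous (by fun_prop)
      fun s => mem_Ici.2 (le_max_right _ _)
  have hder : ∀ t, HasDerivAt (fun t => d 0 + ∫ s in (0 : ℝ)..t, g s) (g t) t := fun t =>
    (hg.integral_hasStrictDerivAt 0 t).hasDerivAt.const_add _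
  refine ⟨fun t => d 0 + ∫ s in (0 : ℝ)..t, g s, ?_, fun T hT => ?_⟩
  · rw [contDiff_one_iff_deriv]
    refine ⟨fun t => (hder t).differentiableAt, ?_⟩
    have : deriv (fun t => d 0 + ∫ s in (0 : ℝ)..t, g s) = g := funext fun t => (hder t).deriv
    rwa [this]
  · refine eq_of_has_deriv_right_eq (f' := g) (a := 0) (b := T)
      (fun t _ => (hder t).hasDerivWithinAt) (fun t ht => ?_)
      (fun t _ => (hder t).continuousAt.continuousWithinAt)
      (hd.continuousOn.mono Icc_subset_Ici_self) (by simp) T ⟨hT, le_rfl⟩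
    have h1 := (hd.differentiableOn one_ne_zero t ht.1).hasDerivWithinAt
    have h2 : g t = derivWithin d (Ici 0) t := by simp only [g, max_eq_left ht.1]
    rw [h2]
    exact h1.mono (Ici_subset_Ici.2 ht.1)

/-- Since χ vanishes on [-D, 0] and D > 0, continuation by zero agrees with χ on an overlap, so no
smoothness is lost. A function on ℝ makes u a C² input on the whole line, zero at negative times. -/
lemma IsTransition.exists_extension {D t₀ : ℝ} (hD : 0 < D) {χ : ℝ → ℝ}
    (h : IsTransition D t₀ χ) : ∃ η : ℝ → ℝ, ContDiff ℝ 2 η ∧ (∀ t, 0 ≤ t → η t = χ t) ∧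
      (∀ t, t ≤ 0 → η t = 0) ∧ (∀ t, η t ∈ Icc (0 : ℝ) 1) ∧
      ∀ t, 0 < t → t₀ ≤ t → η t = 1 := by
  let η : ℝ → ℝ := fun t => if t ≤ 0 then 0 else χ t
  have hηχ : ∀ t, -D ≤ t → η t = χ t := by
    intro t ht
    by_cases h0 : t ≤ 0
    · simp only [η, if_pos h0]
      exact (h.eq_zero t ⟨ht, h0⟩).symm
    · simp only [η, if_neg h0]
  refine ⟨η, ?_, fun t ht => hηχ t (by linarith), fun t ht => if_pos ht, fun t => ?_,
    fun t ht ht₀ => ?_⟩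
  · rw [contDiff_iff_contDiffAt]
    intro t
    rcases lt_or_ge (-D) t with ht | ht
    · refine (h.contDiffOn.contDiffAt (Ici_mem_nhds ht)).congr_of_eventuallyEq ?_
      filter_upwards [lt_mem_nhds ht] with s hs using hηχ s hs.le
    · refine (contDiffAt_const (c := (0 : ℝ))).congr_of_eventuallyEq ?_
      filter_upwards [gt_mem_nhds (show t < 0 by linarith)] with s hs using if_pos hs.le
  · by_cases h0 : t ≤ 0
    · simp [η, h0]
    · simp only [η, if_neg h0]
      exact h.mem_Icc t (mem_Ici.2 (by linarith))
  · simp only [η, if_neg (not_le.2 ht)]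
    exact h.eq_one t ht₀

end Extensions

/-! ### Stability of the predictor equation -/

section Feedback

open MeasureTheory

variable {E : Type*} [NormedAddCommGroup E] [NormedSpace ℝ E] [CompleteSpace E]

lemma hasDerivAt_exp_smul (a : E →L[ℝ] E) (t : ℝ) :
    HasDerivAt (fun t : ℝ => NormedSpace.exp (t • a)) (a * NormedSpace.exp (t • a)) t :=
  hasDerivAt_exp_smul_const' a t

lemma continuous_exp_smul (a : E →L[ℝ] E) : Continuous fun t : ℝ => NormedSpace.exp (t • a) :=
  continuous_iff_continuousAt.2 fun t => (hasDerivAt_exp_smul a t).continuousAt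

lemma exp_add_smul (a : E →L[ℝ] E) (s t : ℝ) :
    NormedSpace.exp ((s + t) • a) = NormedSpace.exp (s • a) * NormedSpace.exp (t • a) := by
  let _ : NormedAlgebra ℚ (E →L[ℝ] E) := NormedAlgebra.restrictScalars ℚ ℝ _
  rw [add_smul, NormedSpace.exp_add_of_commute]
  exact ((Commute.refl a).smul_left _).smul_right _

/-- Stability of `z' = (a + χ(t) G) z + g` when `a + G` is exponentially stable and `χ = 1` on
`[t₀, ∞)`. -/
theorem exists_norm_le_of_eventually_stable (a G : E →L[ℝ] E) {κ C : ℝ} (hκ : 0 < κ)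
    (hC0 : 0 ≤ C)
    (hC : ∀ t : ℝ, 0 ≤ t → ‖NormedSpace.exp (t • (a + G))‖ ≤ C * Real.exp (-κ * t))
    {t₀ : ℝ} (ht₀ : 0 < t₀) :
    ∃ C' : ℝ, 0 ≤ C' ∧ ∀ (η : ℝ → ℝ) (g z : ℝ → E), (∀ t, η t ∈ Icc (0 : ℝ) 1) →
      (∀ t, t₀ ≤ t → η t = 1) → Continuous g →
      (∀ t, HasDerivAt z ((a + η t • G) (z t) + g t) t) → ∀ t δ : ℝ, 0 ≤ t →
        (∀ s ∈ Icc 0 t, ‖g s‖ ≤ δ) → ‖z t‖ ≤ C' * (Real.exp (-κ * t) * ‖z 0‖ + δ) := by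
  -- The added 1 gives L ≥ 1, hence δ / L ≤ δ in Grönwall's bound.
  set L := ‖a‖ + ‖G‖ + 1 with hL
  have hL1 : 1 ≤ L := by
    have := norm_nonneg a
    have := norm_nonneg G
    linarith
  have hL0 : 0 < L := by linarith
  set C₁ := Real.exp (L * t₀) with hC₁
  have hC₁0 : 0 < C₁ := Real.exp_pos _
  have hE1 : 1 ≤ Real.exp (κ * t₀) := Real.one_le_exp (by positivity)
  -- C₁ is the growth allowed up to t₀, e^{κt₀} turns it into a decaying bound, C propagates it
  -- beyond t₀, and C / κ integrates the forcing after t₀.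
  refine ⟨Real.exp (κ * t₀) * C₁ * (1 + C) + C / κ, by positivity, ?_⟩
  intro η g z hη hη1 hg hz t δ ht hδ
  have hδ0 : 0 ≤ δ := (norm_nonneg _).trans (hδ 0 ⟨le_rfl, ht⟩)
  have hshort : ∀ r, 0 ≤ r → r ≤ t → r ≤ t₀ → ‖z r‖ ≤ C₁ * (‖z 0‖ + δ) := by
    intro r hr hrt hrt₀
    have h1 := norm_le_gronwallBound_of_norm_deriv_right_le (f := z)
      (f' := fun t => (a + η t • G) (z t) + g t) (δ := ‖z 0‖) (K := L) (ε := δ) (a := 0) (b := r)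
      (fun s _ => (hz s).continuousAt.continuousWithinAt) (fun s _ => (hz s).hasDerivWithinAt)
      le_rfl (fun s hs => ?_) r ⟨hr, le_rfl⟩
    · rw [gronwallBound_of_K_ne_0 hL0.ne', sub_zero] at h1
      refine h1.trans ?_
      have h2 : Real.exp (L * r) ≤ C₁ := Real.exp_le_exp.2 (by gcongr)
      have h3 : δ / L * (Real.exp (L * r) - 1) ≤ δ * C₁ := by
        refine mul_le_mul (div_le_self hδ0 hL1) (by linarith) ?_ hδ0
        exact sub_nonneg.2 (Real.one_le_exp (by positivity))
      have h4 := mul_le_mul_of_nonneg_left h2 (norm_nonneg (z 0))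
      linarith
    · refine (norm_add_le _ _).trans (add_le_add ?_ (hδ s ⟨hs.1, hs.2.le.trans hrt⟩))
      refine (ContinuousLinearMap.le_opNorm _ _).trans ?_
      gcongr
      refine (norm_add_le _ _).trans ?_
      have h2 : ‖η s • G‖ ≤ ‖G‖ := by
        rw [norm_smul, Real.norm_eq_abs, abs_of_nonneg (hη s).1]
        exact mul_le_of_le_one_left (norm_nonneg _) (hη s).2
      linarith
  rcases le_total t t₀ with h | h
  · have h1 := hshort t ht le_rfl h
    have h2 : 1 ≤ Real.exp (κ * t₀) * Real.exp (-κ * t) := by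
      rw [← Real.exp_add]
      refine Real.one_le_exp ?_
      nlinarith
    calc ‖z t‖ ≤ C₁ * (1 * ‖z 0‖ + 1 * δ) := by simpa using h1
      _ ≤ C₁ * (Real.exp (κ * t₀) * Real.exp (-κ * t) * ‖z 0‖ + Real.exp (κ * t₀) * δ) := by
          gcongr
      _ = Real.exp (κ * t₀) * C₁ * 1 * (Real.exp (-κ * t) * ‖z 0‖ + δ) := by ring
      _ ≤ _ := by
          refine mul_le_mul_of_nonneg_right ?_ (by positivity)
          have : 0 ≤ C / κ := by positivity
          have h3 : Real.exp (κ * t₀) * C₁ * 1 ≤ Real.exp (κ * t₀) * C₁ * (1 + C) := by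
            gcongr
            linarith
          linarith
  · set M := a + G with hM
    -- Duhamel's formula from t₀ to t, where η = 1 and the equation has the constant stable matrix
    -- M.
    have hder : ∀ s ∈ uIcc t₀ t, HasDerivAt (fun s => NormedSpace.exp ((t - s) • M) (z s))
        (NormedSpace.exp ((t - s) • M) (g s)) s := by
      intro s hs
      rw [uIcc_of_le h] at hs
      have h1 : HasDerivAt (fun s => NormedSpace.exp ((t - s) • M))
          ((-1 : ℝ) • (NormedSpace.exp ((t - s) • M) * M)) s := by
        have h2 := (hasDerivAt_exp_smul_const M (t - s)).scomp s
          ((hasDerivAt_id s).const_sub t)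
        exact h2
      have h3 := h1.clm_apply (hz s)
      rw [hη1 s hs.1, one_smul, ← hM] at h3
      refine h3.congr_deriv ?_
      simp
    have hint := intervalIntegral.integral_eq_sub_of_hasDerivAt hder
      (Continuous.intervalIntegrable (by
        have := (continuous_exp_smul M).comp (by fun_prop : Continuous fun s : ℝ => t - s)
        exact this.clm_apply hg) _ _)
    rw [sub_self, zero_smul, NormedSpace.exp_zero, eq_sub_iff_add_eq'] at hint
    change _ = z t at hint
    have h1 : ‖NormedSpace.exp ((t - t₀) • M) (z t₀)‖ ≤
        C * (Real.exp (κ * t₀) * Real.exp (-κ * t)) * (C₁ * (‖z 0‖ + δ)) := by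
      refine (ContinuousLinearMap.le_opNorm _ _).trans ?_
      refine mul_le_mul ?_ (hshort t₀ ht₀.le h le_rfl) (norm_nonneg _) (by positivity)
      refine (hC _ (by linarith)).trans_eq ?_
      rw [← Real.exp_add]
      ring_nf
    have h2 : ‖∫ s in t₀..t, NormedSpace.exp ((t - s) • M) (g s)‖ ≤ C / κ * δ := by
      have h3 : ‖∫ s in t₀..t, NormedSpace.exp ((t - s) • M) (g s)‖ ≤
          ∫ s in t₀..t, C * δ * Real.exp (-κ * (t - s)) := by
        refine intervalIntegral.norm_integral_le_of_norm_le h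
          (Eventually.of_forall fun s hs => ?_) (Continuous.intervalIntegrable (by fun_prop) _ _)
        refine (ContinuousLinearMap.le_opNorm _ _).trans ?_
        rw [mul_right_comm]
        exact mul_le_mul (hC _ (by linarith [hs.2])) (hδ s ⟨by linarith [hs.1], hs.2⟩)
          (norm_nonneg _) (by positivity)
      refine h3.trans ?_
      rw [intervalIntegral.integral_const_mul,
        intervalIntegral.integral_comp_sub_left (fun s => Real.exp (-κ * s)), sub_self]
      calc _ ≤ C * δ * (1 / κ) := by
            gcongr
            exact integral_exp_neg_mul_le hκ _
        _ = _ := by ring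
    have hexp1 : Real.exp (-κ * t) ≤ 1 := Real.exp_le_one_iff.2 (by nlinarith)
    rw [← hint]
    refine (norm_add_le _ _).trans ((add_le_add h1 h2).trans ?_)
    calc _ = Real.exp (κ * t₀) * C₁ * C * (Real.exp (-κ * t) * ‖z 0‖ + Real.exp (-κ * t) * δ)
          + C / κ * (0 + δ) := by ring
      _ ≤ Real.exp (κ * t₀) * C₁ * (1 + C) * (Real.exp (-κ * t) * ‖z 0‖ + 1 * δ)
          + C / κ * (Real.exp (-κ * t) * ‖z 0‖ + δ) := by
          gcongr
          · linarith
          · positivity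
      _ = _ := by ring

variable {U : Type*} [NormedAddCommGroup U] [NormedSpace ℝ U]

/-- The closed-loop state predictor and its feedback law `u = η K z`, with exponential estimates
for `z`, `u` and `u'`. -/
theorem exists_predictor (a : E →L[ℝ] E) (b : U →L[ℝ] E) (K : E →L[ℝ] U) {κ C : ℝ} (hκ : 0 < κ)
    (hC0 : 0 ≤ C)
    (hC : ∀ t : ℝ, 0 ≤ t → ‖NormedSpace.exp (t • (a + b ∘L K))‖ ≤ C * Real.exp (-κ * t))
    {t₀ : ℝ} (ht₀ : 0 < t₀) {η : ℝ → ℝ} (hη : ContDiff ℝ 2 η)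
    (hηI : ∀ t, η t ∈ Icc (0 : ℝ) 1) (hη1 : ∀ t, t₀ ≤ t → η t = 1) :
    ∃ C' : ℝ, 0 ≤ C' ∧ ∀ (g : ℝ → E) (z₀ : E), ContDiff ℝ 1 g → ∃ z : ℝ → E, z 0 = z₀ ∧
      (∀ t, HasDerivAt z ((a + η t • (b ∘L K)) (z t) + g t) t) ∧
      ContDiff ℝ 2 (fun t => η t • K (z t)) ∧ ∀ t δ : ℝ, 0 ≤ t → (∀ s ∈ Icc 0 t, ‖g s‖ ≤ δ) →
        ‖z t‖ ≤ C' * (Real.exp (-κ * t) * ‖z₀‖ + δ) ∧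
        ‖η t • K (z t)‖ ≤ C' * (Real.exp (-κ * t) * ‖z₀‖ + δ) ∧
        ‖deriv (fun t => η t • K (z t)) t‖ ≤ C' * (Real.exp (-κ * t) * ‖z₀‖ + δ) := by
  set G := b ∘L K with hG
  obtain ⟨C₁, hC₁0, hC₁⟩ := exists_norm_le_of_eventually_stable a G hκ hC0 hC ht₀
  obtain ⟨R, hR⟩ := (isCompact_Icc (a := (0 : ℝ)) (b := t₀)).exists_bound_of_continuousOn
    (hη.continuous_deriv one_le_two).continuousOn
  have hR0 : 0 ≤ R := (norm_nonneg _).trans (hR 0 ⟨le_rfl, ht₀.le⟩)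
  -- The derivative of η is bounded on [0, t₀] by compactness and zero afterwards.
  have hR' : ∀ t, 0 ≤ t → |deriv η t| ≤ R := by
    intro t ht
    rcases le_or_gt t t₀ with h | h
    · exact hR t ⟨ht, h⟩
    · have : deriv η t = 0 := by
        have h1 : η =ᶠ[𝓝 t] fun _ => 1 := by
          filter_upwards [lt_mem_nhds h] with s hs using hη1 s hs.le
        rw [h1.deriv_eq, deriv_const]
      rw [this, abs_zero]
      exact hR0
  have habs : ∀ t, |η t| ≤ 1 := fun t => abs_le.2 ⟨by linarith [(hηI t).1], (hηI t).2⟩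
  have hM : ∀ t, ‖a + η t • G‖ ≤ ‖a‖ + ‖G‖ := by
    intro t
    refine (norm_add_le _ _).trans ?_
    gcongr
    rw [norm_smul, Real.norm_eq_abs]
    exact mul_le_of_le_one_left (norm_nonneg _) (habs t)
  refine ⟨C₁ + ‖K‖ * C₁ + (R * (‖K‖ * C₁) + ‖K‖ * ((‖a‖ + ‖G‖) * C₁ + 1)), by positivity,
    fun g z₀ hg => ?_⟩
  have hηc := hη.continuous
  obtain ⟨z, hz0, hz⟩ := exists_hasDerivAt_affine (fun t => a + η t • G) (by fun_prop) _ hM g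
    hg.continuous z₀
  have hz2 : ContDiff ℝ 2 z := by
    refine contDiff_two_of_hasDerivAt_affine (M := fun t => a + η t • G) ?_ hg hz
    exact contDiff_const.add ((hη.of_le one_le_two).smul contDiff_const)
  refine ⟨z, hz0, hz, hη.smul (K.contDiff.comp hz2), fun t δ ht hδ => ?_⟩
  have hδ0 : 0 ≤ δ := (norm_nonneg _).trans (hδ 0 ⟨le_rfl, ht⟩)
  have hzt := hC₁ η g z hηI hη1 hg.continuous hz t δ ht hδ
  rw [hz0] at hzt
  set B := Real.exp (-κ * t) * ‖z₀‖ + δ with hB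
  have hδB : δ ≤ B := le_add_of_nonneg_left (by positivity)
  have hB0 : 0 ≤ B := hδ0.trans hδB
  have hKz : ‖K (z t)‖ ≤ ‖K‖ * C₁ * B := by
    refine (K.le_opNorm _).trans ?_
    rw [mul_assoc]
    gcongr
  have hder : deriv (fun t => η t • K (z t)) t =
      η t • K ((a + η t • G) (z t) + g t) + deriv η t • K (z t) :=
    ((hη.differentiable two_ne_zero t).hasDerivAt.smul
      (K.hasFDerivAt.comp_hasDerivAt t (hz t))).deriv
  have hz't : ‖(a + η t • G) (z t) + g t‖ ≤ ((‖a‖ + ‖G‖) * C₁ + 1) * B := by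
    refine (norm_add_le _ _).trans ?_
    have h1 := (a + η t • G).le_of_opNorm_le_of_le (hM t) hzt
    have h2 := (hδ t ⟨ht, le_rfl⟩).trans hδB
    linarith
  have n1 : 0 ≤ C₁ * B := by positivity
  have n2 : 0 ≤ ‖K‖ * C₁ * B := by positivity
  have n3 : 0 ≤ R * (‖K‖ * C₁) * B := by positivity
  have n4 : 0 ≤ ‖K‖ * ((‖a‖ + ‖G‖) * C₁ + 1) * B := by positivity
  refine ⟨by linarith, ?_, ?_⟩
  · rw [norm_smul, Real.norm_eq_abs]
    have := mul_le_mul (habs t) hKz (norm_nonneg _) zero_le_one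
    linarith
  · rw [hder]
    refine (norm_add_le _ _).trans ?_
    rw [norm_smul, norm_smul, Real.norm_eq_abs, Real.norm_eq_abs]
    have h1 : |η t| * ‖K ((a + η t • G) (z t) + g t)‖ ≤
        1 * (‖K‖ * (((‖a‖ + ‖G‖) * C₁ + 1) * B)) :=
      mul_le_mul (habs t) (K.le_opNorm_of_le hz't) (norm_nonneg _) zero_le_one
    have h2 := mul_le_mul (hR' t ht) hKz (norm_nonneg _) hR0
    linarith

end Feedback

/-! ### Artstein's reduction of the input delay -/

section Artstein

open MeasureTheory

variable {E : Type*} [NormedAddCommGroup E] [NormedSpace ℝ E]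
  {U : Type*} [NormedAddCommGroup U] [NormedSpace ℝ U]

/-- The distributed part of the Artstein transform. -/
def delayIntegral (a : E →L[ℝ] E) (b : U →L[ℝ] E) (D : ℝ) (u : ℝ → U) (t : ℝ) : E :=
  ∫ s in (t - D)..t, NormedSpace.exp ((t - s - D) • a) (b (u s))

lemma delayIntegral_zero (a : E →L[ℝ] E) (b : U →L[ℝ] E) {D : ℝ} (hD : 0 ≤ D) {u : ℝ → U}
    (hu : ∀ t ∈ Icc (-D) 0, u t = 0) : delayIntegral a b D u 0 = 0 := by
  rw [delayIntegral, intervalIntegral.integral_congr (g := fun _ => (0 : E))]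
  · simp
  · intro s hs
    rw [zero_sub, uIcc_of_le (by linarith)] at hs
    simp [hu s hs]

lemma delayIntegral_congr (a : E →L[ℝ] E) (b : U →L[ℝ] E) {D : ℝ} (hD : 0 ≤ D) {u v : ℝ → U}
    (h : EqOn u v (Ici (-D))) {t : ℝ} (ht : 0 ≤ t) :
    delayIntegral a b D u t = delayIntegral a b D v t := by
  refine intervalIntegral.integral_congr fun s hs => ?_
  rw [uIcc_of_le (by linarith)] at hs
  have : u s = v s := h (mem_Ici.2 (by linarith [hs.1]))
  simp only [this]

variable [CompleteSpace E]

/-- Factoring the group leaves t only in the endpoints of the integral. -/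
lemma delayIntegral_eq (a : E →L[ℝ] E) (b : U →L[ℝ] E) (D : ℝ) (u : ℝ → U) {t : ℝ}
    (hu : IntervalIntegrable (fun s => NormedSpace.exp (-s • a) (b (u s))) volume (t - D) t) :
    delayIntegral a b D u t =
      NormedSpace.exp ((t - D) • a) (∫ s in (t - D)..t, NormedSpace.exp (-s • a) (b (u s))) := by
  rw [← ContinuousLinearMap.intervalIntegral_comp_comm _ hu, delayIntegral]
  refine intervalIntegral.integral_congr fun s _ => ?_
  have h : t - s - D = (t - D) + -s := by ring
  simp only [h, exp_add_smul]
  rfl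

lemma hasDerivAt_delayIntegral (a : E →L[ℝ] E) (b : U →L[ℝ] E) (D : ℝ) {u : ℝ → U}
    (hu : Continuous u) (t : ℝ) : HasDerivAt (delayIntegral a b D u)
      (a (delayIntegral a b D u t) + NormedSpace.exp (-D • a) (b (u t)) - b (u (t - D))) t := by
  set k : ℝ → E := fun s => NormedSpace.exp (-s • a) (b (u s)) with hk
  have hkc : Continuous k := by
    have := (continuous_exp_smul a).comp continuous_neg
    exact this.clm_apply (by fun_prop)
  have heq : ∀ t, delayIntegral a b D u t = NormedSpace.exp ((t - D) • a)
      ((∫ s in (0 : ℝ)..t, k s) - ∫ s in (0 : ℝ)..(t - D), k s) := by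
    intro t
    rw [delayIntegral_eq a b D u (hkc.intervalIntegrable _ _),
      intervalIntegral.integral_interval_sub_left (hkc.intervalIntegrable _ _)
        (hkc.intervalIntegrable _ _)]
  have hF := fun r => (hkc.integral_hasStrictDerivAt 0 r).hasDerivAt
  have h1 := (hF t).sub ((hF (t - D)).comp_sub_const t D)
  have h2 := ((hasDerivAt_exp_smul a (t - D)).comp_sub_const t D).clm_apply h1
  rw [funext heq]
  refine h2.congr_deriv ?_
  have h3 : ∀ r s : ℝ, NormedSpace.exp (r • a) (NormedSpace.exp (s • a) (b (u t))) =
      NormedSpace.exp ((r + s) • a) (b (u t)) := fun r s => by rw [exp_add_smul]; rfl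
  have h4 : NormedSpace.exp ((t - D) • a) (k (t - D)) = b (u (t - D)) := by
    simp only [hk]
    rw [← ContinuousLinearMap.comp_apply, ← ContinuousLinearMap.mul_def, ← exp_add_smul]
    simp
  have h5 : NormedSpace.exp ((t - D) • a) (k t) = NormedSpace.exp (-D • a) (b (u t)) := by
    simp only [hk]
    rw [← ContinuousLinearMap.comp_apply, ← ContinuousLinearMap.mul_def, ← exp_add_smul]
    ring_nf
  rw [map_sub _ (k t), h4, h5]
  simp only [Pi.sub_apply]
  exact (add_sub_assoc _ _ _).symm

/-- The endpoint s = t - D contributes -b u(t - D), which cancels the delayed input of Y; the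
endpoint s = t brings the present input through e^{-Da} b. -/
lemma hasDerivWithinAt_add_delayIntegral (a : E →L[ℝ] E) (b : U →L[ℝ] E) (D : ℝ) {u : ℝ → U}
    (hu : Continuous u) {Y g : ℝ → E} {t : ℝ}
    (hY : HasDerivWithinAt Y (a (Y t) + b (u (t - D)) + g t) (Ici 0) t) :
    HasDerivWithinAt (fun t => Y t + delayIntegral a b D u t)
      (a (Y t + delayIntegral a b D u t) + NormedSpace.exp (-D • a) (b (u t)) + g t) (Ici 0) t := by
  refine (hY.add (hasDerivAt_delayIntegral a b D hu t).hasDerivWithinAt).congr_deriv ?_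
  rw [map_add]
  abel

/-- Continuity of the delay term for locally integrable inputs. -/
lemma continuousOn_delayIntegral (a : E →L[ℝ] E) (b : U →L[ℝ] E) {D : ℝ} (hD : 0 ≤ D) {u : ℝ → U}
    (hu : LocallyIntegrableOn u (Ici (-D))) : ContinuousOn (delayIntegral a b D u) (Ici 0) := by
  set k : ℝ → E := fun s => NormedSpace.exp (-s • a) (b (u s)) with hk
  have hec : Continuous fun s : ℝ => NormedSpace.exp (-s • a) ∘L b :=
    ((continuous_exp_smul a).comp continuous_neg).clm_comp continuous_const
  have hint : ∀ T, -D ≤ T → IntegrableOn k (Icc (-D) T) := by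
    intro T _
    have h1 : IntegrableOn u (Icc (-D) T) :=
      hu.integrableOn_compact_subset Icc_subset_Ici_self isCompact_Icc
    obtain ⟨C, hC⟩ := (isCompact_Icc (a := -D) (b := T)).exists_bound_of_continuousOn
      hec.continuousOn
    refine Integrable.mono' (h1.norm.const_mul C) ?_ ?_
    · exact ContinuousLinearMap.aestronglyMeasurable_comp₂
        (ContinuousLinearMap.id ℝ (U →L[ℝ] E)) hec.aestronglyMeasurable h1.aestronglyMeasurable
    · filter_upwards [ae_restrict_mem measurableSet_Icc] with s hs
      exact (NormedSpace.exp (-s • a) ∘L b).le_of_opNorm_le (hC s hs) _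
  have hii : ∀ p q, -D ≤ p → -D ≤ q → IntervalIntegrable k volume p q := by
    intro p q hp hq
    rw [intervalIntegrable_iff]
    refine (hint (max p q) (le_max_of_le_left hp)).mono_set fun s hs => ?_
    rw [uIoc, mem_Ioc] at hs
    exact ⟨(le_min hp hq).trans hs.1.le, hs.2⟩
  have hprim : ContinuousOn (fun t => ∫ s in (-D)..t, k s) (Ici (-D)) := by
    intro t ht
    have h1 : ContinuousOn (fun t => ∫ s in (-D)..t, k s) (uIcc (-D) (t + 1)) :=
      intervalIntegral.continuousOn_primitive_interval'
        (hii _ _ le_rfl (by linarith [mem_Ici.1 ht])) left_mem_uIcc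
    have ht' := mem_Ici.1 ht
    rw [uIcc_of_le (by linarith)] at h1
    refine (h1 t ⟨ht, by linarith⟩).mono_of_mem_nhdsWithin ?_
    rw [← Ici_inter_Iic]
    exact inter_mem_nhdsWithin _ (Iic_mem_nhds (by linarith))
  have heq : EqOn (delayIntegral a b D u) (fun t => NormedSpace.exp ((t - D) • a)
      ((∫ s in (-D)..t, k s) - ∫ s in (-D)..(t - D), k s)) (Ici 0) := by
    intro t ht
    have ht' := mem_Ici.1 ht
    simp only
    rw [delayIntegral_eq a b D u (hii _ _ (by linarith) (by linarith)),
      intervalIntegral.integral_interval_sub_left (hii _ _ le_rfl (by linarith))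
        (hii _ _ le_rfl (by linarith))]
  refine ContinuousOn.congr ?_ heq
  refine ContinuousOn.clm_apply
    ((continuous_exp_smul a).comp (by fun_prop : Continuous fun t : ℝ => t - D)).continuousOn ?_
  refine (hprim.mono (Ici_subset_Ici.2 (by linarith))).sub
    (hprim.comp (by fun_prop : ContinuousOn (fun t : ℝ => t - D) _) fun t ht => ?_)
  have ht' := mem_Ici.1 ht
  exact mem_Ici.2 (by linarith)

/-- On the window the exponent t - s - D ranges over [-D, 0] only, so the constant does not depend
on t. -/
lemma exists_norm_delayIntegral_le (a : E →L[ℝ] E) (b : U →L[ℝ] E) {D : ℝ} (hD : 0 ≤ D) :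
    ∃ C : ℝ, 0 ≤ C ∧ ∀ (u : ℝ → U) (t β : ℝ), (∀ s ∈ Icc (t - D) t, ‖u s‖ ≤ β) →
      ‖delayIntegral a b D u t‖ ≤ C * β := by
  obtain ⟨M, hM⟩ := (isCompact_Icc (a := -D) (b := 0)).exists_bound_of_continuousOn
    (continuous_exp_smul a).continuousOn
  have hM0 : 0 ≤ M := (norm_nonneg _).trans (hM 0 ⟨by linarith, le_rfl⟩)
  refine ⟨M * ‖b‖ * D, by positivity, fun u t β hβ => ?_⟩
  have h := intervalIntegral.norm_integral_le_of_norm_le_const (a := t - D) (b := t)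
    (f := fun s => NormedSpace.exp ((t - s - D) • a) (b (u s))) (C := M * (‖b‖ * β)) fun s hs => ?_
  · rw [sub_sub_cancel, abs_of_nonneg hD] at h
    calc _ ≤ M * (‖b‖ * β) * D := h
      _ = _ := by ring
  · rw [uIoc_of_le (by linarith)] at hs
    refine ContinuousLinearMap.le_of_opNorm_le_of_le _
      (hM _ ⟨by linarith [hs.2], by linarith [hs.1]⟩) ?_
    exact b.le_opNorm_of_le (hβ s ⟨hs.1.le, hs.2⟩)

end Artstein

/-! ### Modal dynamics, uniqueness, and solutions for smooth inputs -/

section ClosedLoop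

open MeasureTheory

variable {𝕜 : Type*} [RCLike 𝕜] {H : Type*} [NormedAddCommGroup H] [InnerProductSpace 𝕜 H]
  {m : ℕ} {A : H →ₗ.[𝕜] H} {𝓑 : H →ₗ.[𝕜] EuclideanSpace 𝕜 (Fin m)}

lemma mem_graph_disturbanceFree {x y : H} :
    (x, y) ∈ (disturbanceFree A 𝓑).graph ↔ (x, y) ∈ A.graph ∧ (x, 0) ∈ 𝓑.graph := by
  constructor
  · intro h
    obtain ⟨⟨z, hz⟩, rfl, rfl⟩ := (LinearPMap.mem_graph_iff _).1 h
    obtain ⟨⟨w, hw, hwz⟩, hzA⟩ := hz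
    refine ⟨(LinearPMap.mem_graph_iff _).2 ⟨⟨z, hzA⟩, rfl, ?_⟩,
      (LinearPMap.mem_graph_iff _).2 ⟨w, hwz, hw⟩⟩
    exact (LinearPMap.domRestrict_apply (f := A) rfl).symm
  · rintro ⟨h1, h2⟩
    obtain ⟨⟨z, hz⟩, rfl, rfl⟩ := (LinearPMap.mem_graph_iff _).1 h1
    obtain ⟨w, hw, hw0⟩ := (LinearPMap.mem_graph_iff _).1 h2
    refine (LinearPMap.mem_graph_iff _).2 ⟨⟨z, ⟨w, hw0, hw⟩, hz⟩, rfl, ?_⟩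
    exact LinearPMap.domRestrict_apply (f := A) rfl

lemma sub_lift_mem_graph (L : LiftingOperator A 𝓑) {x y : H} {v : EuclideanSpace 𝕜 (Fin m)}
    (hA : (x, y) ∈ A.graph) (hB : (x, v) ∈ 𝓑.graph) :
    (x - L.B v, y - L.AB v) ∈ (disturbanceFree A 𝓑).graph := by
  refine mem_graph_disturbanceFree.2 ⟨A.graph.sub_mem hA (L.AB_spec v), ?_⟩
  simpa using 𝓑.graph.sub_mem hB (L.lift_spec v)

lemma add_lift_mem_graph (L : LiftingOperator A 𝓑) {x y : H} (v : EuclideanSpace 𝕜 (Fin m))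
    (h : (x, y) ∈ (disturbanceFree A 𝓑).graph) :
    (x + L.B v, y + L.AB v) ∈ A.graph ∧ (x + L.B v, v) ∈ 𝓑.graph := by
  obtain ⟨h1, h2⟩ := mem_graph_disturbanceFree.1 h
  refine ⟨A.graph.add_mem h1 (L.AB_spec v), ?_⟩
  simpa using 𝓑.graph.add_mem h2 (L.lift_spec v)

lemma truncB_mulVec (L : LiftingOperator A 𝓑) (lam : ℕ → 𝕜) (ψ : ℕ → H) (N₀ : ℕ)
    (v : EuclideanSpace 𝕜 (Fin m)) (n : Fin N₀) :
    (truncB L lam ψ N₀).mulVec v.ofLp n =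
      -lam n * inner 𝕜 (ψ n) (L.B v) + inner 𝕜 (ψ n) (L.AB v) := by
  have hv : v = ∑ k, v k • EuclideanSpace.single k (1 : 𝕜) := by
    ext i
    simp [Pi.single_apply]
  conv_rhs => rw [hv]
  simp only [map_sum, map_smul, inner_sum, inner_smul_right, Finset.mul_sum,
    ← Finset.sum_add_distrib, Matrix.mulVec, dotProduct, truncB, Matrix.of_apply]
  refine Finset.sum_congr rfl fun k _ => ?_
  ring

lemma matCLM_closedLoopMatrix {N : ℕ} (M : Matrix (Fin N) (Fin N) 𝕜)
    (B : Matrix (Fin N) (Fin m) 𝕜) (D : ℝ) (K : Matrix (Fin m) (Fin N) 𝕜) :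
    matCLM (closedLoopMatrix M B D K) =
      matCLM M + (NormedSpace.exp (-D • matCLM M) ∘L matCLM B) ∘L matCLM K := by
  rw [closedLoopMatrix, matCLM_add, matCLM_mul, matCLM_mul, matCLM_exp]

lemma artstein_eq {N : ℕ} (M : Matrix (Fin N) (Fin N) 𝕜) (B : Matrix (Fin N) (Fin m) 𝕜) (D : ℝ)
    (Y : ℝ → EuclideanSpace 𝕜 (Fin N)) (u : ℝ → EuclideanSpace 𝕜 (Fin m)) (t : ℝ) :
    artstein M B D Y u t = Y t + delayIntegral (matCLM M) (matCLM B) D u t := by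
  rw [artstein, delayIntegral]
  congr 1
  refine intervalIntegral.integral_congr fun s _ => ?_
  change matCLM _ (u s) = _
  rw [matCLM_mul, matCLM_exp]
  rfl

variable [NormedSpace ℝ H] [IsScalarTower ℝ 𝕜 H]

/-- `coeffs` as a continuous real-linear map. -/
def coeffsCLM (𝕜 : Type*) [RCLike 𝕜] {H : Type*} [NormedAddCommGroup H] [InnerProductSpace 𝕜 H]
    [NormedSpace ℝ H] [IsScalarTower ℝ 𝕜 H] (ψ : ℕ → H) (N₀ : ℕ) :
    H →L[ℝ] EuclideanSpace 𝕜 (Fin N₀) :=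
  (PiLp.continuousLinearEquiv 2 ℝ fun _ : Fin N₀ => 𝕜).symm.toContinuousLinearMap ∘L
    ContinuousLinearMap.pi fun n => (innerSL 𝕜 (ψ n)).restrictScalars ℝ

lemma coeffsCLM_apply (ψ : ℕ → H) (N₀ : ℕ) (x : H) :
    coeffsCLM 𝕜 ψ N₀ x = coeffs 𝕜 ψ N₀ x := rfl

/-- Synthesis with the first `N₀` elements of a sequence. -/
def synthCLM (𝕜 : Type*) [RCLike 𝕜] {H : Type*} [NormedAddCommGroup H] [InnerProductSpace 𝕜 H]
    [NormedSpace ℝ H] [IsScalarTower ℝ 𝕜 H] (φ : ℕ → H) (N₀ : ℕ) :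
    EuclideanSpace 𝕜 (Fin N₀) →L[ℝ] H :=
  (∑ n : Fin N₀, (EuclideanSpace.proj (𝕜 := 𝕜) n).smulRight (φ n) :
    EuclideanSpace 𝕜 (Fin N₀) →L[𝕜] H).restrictScalars ℝ

lemma tailProj_add_synthCLM (φ ψ : ℕ → H) (N₀ : ℕ) (x : H) :
    tailProj 𝕜 φ ψ N₀ x + synthCLM 𝕜 φ N₀ (coeffsCLM 𝕜 ψ N₀ x) = x := by
  have h : synthCLM 𝕜 φ N₀ (coeffsCLM 𝕜 ψ N₀ x) =
      ∑ n ∈ Finset.range N₀, inner 𝕜 (ψ n) x • φ n := by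
    rw [Finset.sum_range]
    simp [synthCLM, coeffsCLM_apply, coeffs]
  rw [h, tailProj_apply, sub_add_cancel]

variable [CompleteSpace H] {S : ℝ → H →L[𝕜] H} {lam : ℕ → 𝕜} {φ ψ : ℕ → H}

/-- The eigenvalue relation holds on D(A₀) only, hence for x - B v. The two lift terms that this
leaves are exactly the rows of `truncB`. -/
lemma coeffsCLM_of_mem_graph (hS : IsC0Semigroup S) (hA : IsGenerator (disturbanceFree A 𝓑) S)
    (hR : IsRieszSpectral (disturbanceFree A 𝓑) lam φ) (hψ : IsBiorthogonal 𝕜 φ ψ)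
    (L : LiftingOperator A 𝓑) (N₀ : ℕ) {x y : H} {v : EuclideanSpace 𝕜 (Fin m)}
    (h1 : (x, y) ∈ A.graph) (h2 : (x, v) ∈ 𝓑.graph) :
    coeffsCLM 𝕜 ψ N₀ y = matCLM (truncA lam N₀) (coeffsCLM 𝕜 ψ N₀ x) +
      matCLM (truncB L lam ψ N₀) v := by
  ext n
  have h := inner_generator hS hA hR hψ n (sub_lift_mem_graph L h1 h2)
  rw [inner_sub_right, inner_sub_right] at h
  have h3 : (matCLM (truncB L lam ψ N₀) v) n = (truncB L lam ψ N₀).mulVec v.ofLp n := rfl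
  have h4 : (matCLM (truncA lam N₀) (coeffsCLM 𝕜 ψ N₀ x)) n = lam n * inner 𝕜 (ψ n) x := by
    change (Matrix.diagonal _).mulVec _ n = _
    rw [Matrix.mulVec_diagonal]
    rfl
  rw [PiLp.add_apply, h3, h4, truncB_mulVec]
  change inner 𝕜 (ψ n) y = _
  linear_combination h

variable {N₀ : ℕ} {D : ℝ} {K : Matrix (Fin m) (Fin N₀) 𝕜} {χ : ℝ → ℝ} {X₀ : H} {d : ℝ → H}
  {L : LiftingOperator A 𝓑}

/-- The state predictor attached to a closed-loop solution solves a linear differential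
equation. -/
lemma IsClosedLoopSolution.predictor (hS : IsC0Semigroup S)
    (hA : IsGenerator (disturbanceFree A 𝓑) S)
    (hR : IsRieszSpectral (disturbanceFree A 𝓑) lam φ) (hψ : IsBiorthogonal 𝕜 φ ψ)
    (hD : 0 < D) (hχ : ContinuousOn χ (Ici 0)) {X : ℝ → H} {u : ℝ → EuclideanSpace 𝕜 (Fin m)}
    (h : IsClosedLoopSolution L lam ψ N₀ D K χ X₀ d X u) :
    ∃ Z : ℝ → EuclideanSpace 𝕜 (Fin N₀), Z 0 = coeffsCLM 𝕜 ψ N₀ X₀ ∧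
      (∀ t ∈ Ici (0 : ℝ), u t = χ t • matCLM K (Z t)) ∧
      ∀ t ∈ Ici (0 : ℝ), HasDerivWithinAt Z ((matCLM (truncA lam N₀) +
        χ t • ((NormedSpace.exp (-D • matCLM (truncA lam N₀)) ∘L matCLM (truncB L lam ψ N₀)) ∘L
          matCLM K)) (Z t) + coeffsCLM 𝕜 ψ N₀ (d t)) (Ici 0) t := by
  set a := matCLM (truncA lam N₀)
  set b := matCLM (truncB L lam ψ N₀)
  set P := coeffsCLM 𝕜 ψ N₀
  obtain ⟨AX, -, hX⟩ := h.state_eq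
  have hXc : ContinuousOn X (Ici 0) := fun t ht => (hX t ht).2.continuousWithinAt
  have hu : ∀ t ∈ Ici (0 : ℝ), u t = χ t • matCLM K (P (X t) + delayIntegral a b D u t) := by
    intro t ht
    rw [h.control_eq t ht, artstein_eq, ← RCLike.real_smul_eq_coe_smul]
    rfl
  -- Integrability of u already makes the delay term continuous, and the feedback law returns this
  -- continuity to u.
  have huc : ContinuousOn u (Ici 0) := by
    refine ContinuousOn.congr ?_ hu
    exact hχ.smul ((matCLM K).continuous.comp_continuousOn ((P.continuous.comp_continuousOn hXc).add
      (continuousOn_delayIntegral a b hD.le h.control_integrable)))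
  -- A globally continuous input that agrees with u on [-D, ∞), since u vanishes on [-D, 0].
  let w : ℝ → EuclideanSpace 𝕜 (Fin m) := fun t => u (max t 0)
  have hw : Continuous w :=
    huc.comp_continuous (by fun_prop) fun t => mem_Ici.2 (le_max_right _ _)
  have huw : EqOn u w (Ici (-D)) := by
    intro t ht
    rcases le_total t 0 with h0 | h0
    · simp only [w, max_eq_right h0]
      rw [h.control_eq_zero t ⟨ht, h0⟩, h.control_eq_zero 0 ⟨by linarith, le_rfl⟩]
    · simp only [w, max_eq_left h0]
  refine ⟨fun t => P (X t) + delayIntegral a b D w t, ?_, fun t ht => ?_, fun t ht => ?_⟩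
  · change P (X 0) + delayIntegral a b D w 0 = P X₀
    rw [h.initial, delayIntegral_zero a b hD.le, add_zero]
    intro t ht
    rw [← huw (mem_Ici.2 ht.1), h.control_eq_zero t ht]
  · rw [hu t ht, delayIntegral_congr a b hD.le huw ht]
  · have ht' := mem_Ici.1 ht
    have hY : HasDerivWithinAt (fun t => P (X t)) (a (P (X t)) + b (w (t - D)) + P (d t))
        (Ici 0) t := by
      refine (P.hasFDerivAt.comp_hasDerivWithinAt t (hX t ht).2).congr_deriv ?_
      have h1 : P (AX t) = a (P (X t)) + b (u (t - D)) :=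
        coeffsCLM_of_mem_graph hS hA hR hψ L N₀ (hX t ht).1 (h.boundary_eq t ht)
      have h2 : u (t - D) = w (t - D) := huw (mem_Ici.2 (by linarith))
      rw [← h2, ← h1, map_add]
    refine (hasDerivWithinAt_add_delayIntegral a b D hw (Y := fun t => P (X t))
      (g := fun t => P (d t)) hY).congr_deriv ?_
    have h1 : w t = χ t • matCLM K (P (X t) + delayIntegral a b D w t) := by
      rw [← huw (mem_Ici.2 (by linarith)), hu t ht, delayIntegral_congr a b hD.le huw ht]
    conv_lhs => rw [h1]
    simp only [map_smul, add_apply, smul_apply, ContinuousLinearMap.comp_apply]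

/-- Uniqueness of closed-loop solutions. -/
theorem IsClosedLoopSolution.unique (hS : IsC0Semigroup S)
    (hA : IsGenerator (disturbanceFree A 𝓑) S)
    (hR : IsRieszSpectral (disturbanceFree A 𝓑) lam φ) (hψ : IsBiorthogonal 𝕜 φ ψ)
    (hD : 0 < D) (hχ : ContinuousOn χ (Ici 0)) (hχI : ∀ t ∈ Ici (0 : ℝ), χ t ∈ Icc (0 : ℝ) 1)
    {X X' : ℝ → H} {u u' : ℝ → EuclideanSpace 𝕜 (Fin m)}
    (h' : IsClosedLoopSolution L lam ψ N₀ D K χ X₀ d X' u')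
    (h : IsClosedLoopSolution L lam ψ N₀ D K χ X₀ d X u) :
    EqOn X' X (Ici 0) ∧ EqOn u' u (Ici (-D)) := by
  obtain ⟨Z, hZ0, hZu, hZ⟩ := h.predictor hS hA hR hψ hD hχ
  obtain ⟨Z', hZ0', hZu', hZ'⟩ := h'.predictor hS hA hR hψ hD hχ
  set a := matCLM (truncA lam N₀)
  set G := (NormedSpace.exp (-D • a) ∘L matCLM (truncB L lam ψ N₀)) ∘L matCLM K
  have hZZ : EqOn Z' Z (Ici 0) := by
    refine eqOn_of_hasDerivWithinAt_affine (M := fun t => a + χ t • G) (C := ‖a‖ + ‖G‖)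
      (g := fun t => coeffsCLM 𝕜 ψ N₀ (d t)) (fun t ht => ?_) hZ' hZ (hZ0'.trans hZ0.symm)
    refine (norm_add_le _ _).trans ?_
    gcongr
    rw [norm_smul, Real.norm_eq_abs, abs_of_nonneg (hχI t ht).1]
    exact mul_le_of_le_one_left (norm_nonneg _) (hχI t ht).2
  have huu : EqOn u' u (Ici (-D)) := by
    intro t ht
    rcases le_total t 0 with h0 | h0
    · rw [h.control_eq_zero t ⟨ht, h0⟩, h'.control_eq_zero t ⟨ht, h0⟩]
    · rw [hZu t h0, hZu' t h0, hZZ h0]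
  refine ⟨?_, huu⟩
  obtain ⟨AX, -, hX⟩ := h.state_eq
  obtain ⟨AX', -, hX'⟩ := h'.state_eq
  -- Equal inputs put the difference of the states in D(A₀), so each mode solves y' = λ_n y with
  -- y(0) = 0.
  have hmode : ∀ n, EqOn (fun t => inner 𝕜 (ψ n) (X' t - X t)) (fun _ => 0) (Ici 0) := by
    intro n
    refine eqOn_of_hasDerivWithinAt_affine (M := fun _ => ContinuousLinearMap.mul ℝ 𝕜 (lam n))
      (C := ‖ContinuousLinearMap.mul ℝ 𝕜 (lam n)‖) (g := fun _ => 0) (fun _ _ => le_rfl)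
      (fun t ht => ?_) (fun t _ => ?_) (by simp [h.initial, h'.initial])
    · have ht' := mem_Ici.1 ht
      have h1 := ((innerSL 𝕜 (ψ n)).restrictScalars ℝ).hasFDerivAt.comp_hasDerivWithinAt t
        ((hX' t ht).2.sub (hX t ht).2)
      refine h1.congr_deriv ?_
      have h2 : (X' t - X t, AX' t - AX t) ∈ (disturbanceFree A 𝓑).graph := by
        refine mem_graph_disturbanceFree.2 ⟨A.graph.sub_mem (hX' t ht).1 (hX t ht).1, ?_⟩
        have h3 := 𝓑.graph.sub_mem (h'.boundary_eq t ht) (h.boundary_eq t ht)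
        rw [huu (mem_Ici.2 (by linarith))] at h3
        simpa using h3
      have h4 := inner_generator hS hA hR hψ n h2
      rw [add_sub_add_right_eq_sub]
      simpa using h4
    · simpa using hasDerivWithinAt_const t (Ici (0 : ℝ)) (0 : 𝕜)
  intro t ht
  exact sub_eq_zero.1 (hR.rieszBasis.eq_zero_of_inner_eq_zero hψ fun n => hmode n ht)

/-- Classical solutions of the boundary control system for a `C²` input, with a decay estimate on
the stable modes. -/
theorem exists_boundary_solution (hS : IsC0Semigroup S)
    (hA : IsGenerator (disturbanceFree A 𝓑) S)
    (hR : IsRieszSpectral (disturbanceFree A 𝓑) lam φ) (hψ : IsBiorthogonal 𝕜 φ ψ)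
    (L : LiftingOperator A 𝓑) {α κ : ℝ} (hκ : 0 < κ) (hκα : κ < α)
    (hα : ∀ n, N₀ ≤ n → RCLike.re (lam n) ≤ -α) :
    ∃ C : ℝ, 0 ≤ C ∧ ∀ (X₀ : H) (v : ℝ → EuclideanSpace 𝕜 (Fin m)) (d : ℝ → H),
      X₀ ∈ (disturbanceFree A 𝓑).domain → ContDiff ℝ 2 v → v 0 = 0 → ContDiff ℝ 1 d →
      ∃ X AX : ℝ → H, X 0 = X₀ ∧ ContinuousOn AX (Ici 0) ∧
        (∀ t ∈ Ici (0 : ℝ), (X t, AX t) ∈ A.graph ∧ (X t, v t) ∈ 𝓑.graph ∧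
          HasDerivWithinAt X (AX t + d t) (Ici 0) t) ∧
        ∀ t p δ : ℝ, 0 ≤ t → 0 ≤ p → 0 ≤ δ →
          (∀ s ∈ Icc 0 t, ‖v s‖ ≤ p * Real.exp (-κ * s) + δ ∧
            ‖deriv v s‖ ≤ p * Real.exp (-κ * s) + δ ∧ ‖d s‖ ≤ δ) →
          ‖tailProj 𝕜 φ ψ N₀ (X t - L.B (v t))‖ ≤
            C * (Real.exp (-κ * t) * (‖X₀‖ + p) + δ) := by
  obtain ⟨Cs, hCs0, hCs⟩ := exists_norm_semigroup_tailProj_le hS hA hR hψ hα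
  have hα0 : 0 < α := hκ.trans hκα
  have hακ : 0 < α - κ := sub_pos.2 hκα
  set c := ‖L.AB‖ + ‖L.B‖ + 1 with hc
  have hc0 : 0 ≤ c := by positivity
  refine ⟨Cs + Cs * (c / (α - κ)) + Cs * (c / α), by positivity, fun X₀ v d hX₀ hv hv0 hd => ?_⟩
  let Br : EuclideanSpace 𝕜 (Fin m) →L[ℝ] H := L.B.restrictScalars ℝ
  let ABr : EuclideanSpace 𝕜 (Fin m) →L[ℝ] H := L.AB.restrictScalars ℝ
  -- Forcing of the lifted state W = X - B v, which satisfies the homogeneous boundary condition;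
  -- v(0) = 0 gives W(0) = X₀.
  let f : ℝ → H := fun t => ABr (v t) - Br (deriv v t) + d t
  have hv' : ContDiff ℝ 1 (deriv v) := by
    have h2 : (2 : WithTop ℕ∞) = 1 + 1 := by norm_num
    rw [h2, contDiff_succ_iff_deriv] at hv
    exact hv.2.2
  have hf : ContDiff ℝ 1 f :=
    ((ABr.contDiff.comp (hv.of_le one_le_two)).sub (Br.contDiff.comp hv')).add hd
  obtain ⟨AW, hAW, hW⟩ := hS.exists_classical_solution hA hf hX₀
  set W : ℝ → H := fun t => S (max t 0) X₀ + IsC0Semigroup.conv S f t with hWdef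
  refine ⟨fun t => W t + L.B (v t), fun t => AW t + L.AB (v t), ?_, ?_, fun t ht => ?_, ?_⟩
  · simp [hWdef, hv0, IsC0Semigroup.conv, hS.zero]
  · have := hv.continuous
    fun_prop
  · obtain ⟨h1, h2⟩ := add_lift_mem_graph L (v t) (hW t ht).1
    refine ⟨h1, h2, ?_⟩
    have h3 := (Br.hasFDerivAt.comp_hasDerivAt t
      (hv.differentiable two_ne_zero t).hasDerivAt).hasDerivWithinAt (s := Ici 0)
    refine ((hW t ht).2.add h3).congr_deriv ?_
    simp only [f]
    change _ = AW t + ABr (v t) + d t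
    abel
  · intro t p δ ht hp hδ hb
    have hfb : ∀ s ∈ Icc 0 t, ‖f s‖ ≤ c * p * Real.exp (-κ * s) + c * δ := by
      intro s hs
      obtain ⟨h1, h2, h3⟩ := hb s hs
      have h4 : ‖ABr (v s)‖ ≤ ‖L.AB‖ * (p * Real.exp (-κ * s) + δ) := L.AB.le_opNorm_of_le h1
      have h5 : ‖Br (deriv v s)‖ ≤ ‖L.B‖ * (p * Real.exp (-κ * s) + δ) := L.B.le_opNorm_of_le h2
      have h6 : 0 ≤ p * Real.exp (-κ * s) := by positivity
      have h7 := norm_add_le (ABr (v s) - Br (deriv v s)) (d s)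
      have h8 := norm_sub_le (ABr (v s)) (Br (deriv v s))
      simp only [f]
      rw [hc]
      linarith
    -- The projection commutes with the semigroup, so it enters Duhamel's formula and every term
    -- decays at rate α.
    have hQ : tailProj 𝕜 φ ψ N₀ (W t) = S t (tailProj 𝕜 φ ψ N₀ X₀) +
        ∫ s in (0 : ℝ)..t, S (max s 0) (tailProj 𝕜 φ ψ N₀ (f (t - s))) := by
      simp only [hWdef, map_add, max_eq_left ht, tailProj_semigroup hS hA hR hψ N₀ ht]
      congr 1
      rw [IsC0Semigroup.conv, ← map_intervalIntegral]
      · refine intervalIntegral.integral_congr fun s _ => ?_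
        exact tailProj_semigroup hS hA hR hψ N₀ (le_max_right _ _) _
      · exact (hS.continuous_conv_integrand hf.continuous).comp
          (continuous_id.prodMk continuous_const)
    have hint : ‖∫ s in (0 : ℝ)..t, S (max s 0) (tailProj 𝕜 φ ψ N₀ (f (t - s)))‖ ≤
        Cs * (c * p * Real.exp (-κ * t) / (α - κ) + c * δ / α) := by
      have h1 : ‖∫ s in (0 : ℝ)..t, S (max s 0) (tailProj 𝕜 φ ψ N₀ (f (t - s)))‖ ≤
          ∫ s in (0 : ℝ)..t, Cs * (Real.exp (-α * s) *
            (c * p * Real.exp (-κ * (t - s)) + c * δ)) := by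
        refine intervalIntegral.norm_integral_le_of_norm_le ht
          (Eventually.of_forall fun s hs => ?_) (Continuous.intervalIntegrable (by fun_prop) _ _)
        rw [max_eq_left hs.1.le, ← mul_assoc]
        refine (hCs s hs.1.le _).trans ?_
        gcongr
        exact hfb _ ⟨by linarith [hs.2], by linarith [hs.1]⟩
      refine h1.trans ?_
      rw [intervalIntegral.integral_const_mul]
      gcongr
      exact integral_exp_mul_le hκ hκα (by positivity) (by positivity) t
    have h0 : ‖S t (tailProj 𝕜 φ ψ N₀ X₀)‖ ≤ Cs * (Real.exp (-κ * t) * ‖X₀‖) := by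
      refine (hCs t ht X₀).trans ?_
      rw [mul_assoc]
      gcongr
    have hx := mul_nonneg (Real.exp_pos (-κ * t)).le (norm_nonneg X₀)
    have hy := mul_nonneg (Real.exp_pos (-κ * t)).le hp
    simp only [add_sub_cancel_right]
    rw [hQ]
    refine (norm_add_le _ _).trans ((add_le_add h0 hint).trans ?_)
    set e := Real.exp (-κ * t)
    calc _ = Cs * (e * ‖X₀‖) + Cs * (c / (α - κ)) * (e * p) + Cs * (c / α) * δ := by ring
      _ ≤ Cs * (e * (‖X₀‖ + p) + δ) + Cs * (c / (α - κ)) * (e * (‖X₀‖ + p) + δ) +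
          Cs * (c / α) * (e * (‖X₀‖ + p) + δ) := by
          gcongr
          · linarith
          · linarith
          · linarith
      _ = _ := by ring

end ClosedLoop

/-! ### Existence and the input-to-state estimates -/

section Main

open MeasureTheory

variable {𝕜 : Type*} [RCLike 𝕜] {H : Type*} [NormedAddCommGroup H] [InnerProductSpace 𝕜 H]
  [NormedSpace ℝ H] [IsScalarTower ℝ 𝕜 H] [CompleteSpace H] {m : ℕ} {A : H →ₗ.[𝕜] H}
  {𝓑 : H →ₗ.[𝕜] EuclideanSpace 𝕜 (Fin m)} {S : ℝ → H →L[𝕜] H} {lam : ℕ → 𝕜} {φ ψ : ℕ → H}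

set_option maxHeartbeats 1000000 in
/-- Existence of closed-loop solutions, with exponential input-to-state estimates. -/
theorem exists_isClosedLoopSolution (hS : IsC0Semigroup S)
    (hA : IsGenerator (disturbanceFree A 𝓑) S)
    (hR : IsRieszSpectral (disturbanceFree A 𝓑) lam φ) (hψ : IsBiorthogonal 𝕜 φ ψ)
    (L : LiftingOperator A 𝓑) {N₀ : ℕ} {α κ C : ℝ} (hκ : 0 < κ) (hκα : κ < α)
    (hα : ∀ n, N₀ ≤ n → RCLike.re (lam n) ≤ -α) {D : ℝ} (hD : 0 < D)
    (K : Matrix (Fin m) (Fin N₀) 𝕜) (hC0 : 0 ≤ C)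
    (hC : ∀ t : ℝ, 0 ≤ t → ‖NormedSpace.exp
      (t • matCLM (closedLoopMatrix (truncA lam N₀) (truncB L lam ψ N₀) D K))‖ ≤
        C * Real.exp (-κ * t))
    {t₀ : ℝ} (ht₀ : 0 < t₀) {χ : ℝ → ℝ} (hχ : IsTransition D t₀ χ) :
    ∃ C' : ℝ, 0 ≤ C' ∧ ∀ (X₀ : H) (d : ℝ → H), X₀ ∈ (disturbanceFree A 𝓑).domain →
      ContDiffOn ℝ 1 d (Ici 0) → ∃ (X : ℝ → H) (u : ℝ → EuclideanSpace 𝕜 (Fin m)),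
        IsClosedLoopSolution L lam ψ N₀ D K χ X₀ d X u ∧
        ∀ t δ : ℝ, 0 ≤ t → (∀ s ∈ Icc 0 t, ‖d s‖ ≤ δ) →
          ‖X t‖ ≤ C' * (Real.exp (-κ * t) * ‖X₀‖ + δ) ∧
          ‖u t‖ ≤ C' * (Real.exp (-κ * t) * ‖X₀‖ + δ) := by
  set a := matCLM (truncA lam N₀) with ha
  set b := matCLM (truncB L lam ψ N₀) with hb
  set Kc := matCLM K with hKc
  set P := coeffsCLM 𝕜 ψ N₀ with hP
  set J := synthCLM 𝕜 φ N₀ with hJ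
  set β := NormedSpace.exp (-D • a) ∘L b with hβ
  rw [matCLM_closedLoopMatrix] at hC
  obtain ⟨η, hη, hηχ, hη0, hηI, hη1⟩ := hχ.exists_extension hD
  obtain ⟨Cu, hCu0, hCu⟩ := exists_predictor a β Kc hκ hC0 hC ht₀ hη hηI
    (fun t ht => hη1 t (ht₀.trans_le ht) ht)
  obtain ⟨Cx, hCx0, hCx⟩ := exists_boundary_solution hS hA hR hψ L hκ hκα hα
  obtain ⟨Ci, hCi0, hCi⟩ := exists_norm_delayIntegral_le a b hD.le
  -- The loss of decay when a bound at a time in [t - D, t] is expressed at time t.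
  set E := Real.exp (κ * D) with hE
  have hE1 : 1 ≤ E := Real.one_le_exp (by positivity)
  set c := Cu * ‖P‖ with hc
  have hc0 : 0 ≤ c := by positivity
  refine ⟨‖L.B‖ * (c * E) + Cx * (1 + c * E) +
    ‖J‖ * (c + Ci * (c * E) + ‖P‖ * (‖L.B‖ * (c * E))) + c, by positivity, ?_⟩
  intro X₀ d hX₀ hd
  obtain ⟨d', hd', hdd⟩ := exists_contDiff_one_extension hd
  obtain ⟨Z, hZ0, hZ, hu2, hest⟩ := hCu (fun t => P (d' t)) (P X₀) (P.contDiff.comp hd')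
  set u : ℝ → EuclideanSpace 𝕜 (Fin m) := fun t => η t • Kc (Z t) with hu
  have hu0 : ∀ t, t ≤ 0 → u t = 0 := fun t ht => by simp [hu, hη0 t ht]
  have hderu0 : ∀ t, t < 0 → deriv u t = 0 := by
    intro t ht
    have h1 : u =ᶠ[𝓝 t] fun _ => 0 := by
      filter_upwards [gt_mem_nhds ht] with s hs using hu0 s (le_of_lt hs)
    rw [h1.deriv_eq, deriv_const]
  set v : ℝ → EuclideanSpace 𝕜 (Fin m) := fun t => u (t - D) with hv
  have hv2 : ContDiff ℝ 2 v := hu2.comp (contDiff_id.sub contDiff_const)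
  have hderv : ∀ t, deriv v t = deriv u (t - D) := fun t => deriv_comp_sub_const u D t
  obtain ⟨X, AX, hX0, hAX, hX, hXest⟩ := hCx X₀ v d' hX₀ hv2 (hu0 _ (by linarith)) hd'
  have huc : Continuous u := hu2.continuous
  -- With u now fixed, both sides solve z' = a z + β u + P d' from P X₀. This closes the loop: the
  -- prescribed input is the feedback of the state it produces.
  have hZart : EqOn (fun t => P (X t) + delayIntegral a b D u t) Z (Ici 0) := by
    refine eqOn_of_hasDerivWithinAt_affine (M := fun _ => a) (C := ‖a‖)
      (g := fun t => β (u t) + P (d' t)) (fun _ _ => le_rfl) (fun t ht => ?_) (fun t ht => ?_) ?_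
    · obtain ⟨h1, h2, h3⟩ := hX t ht
      have h4 : P (AX t) = a (P (X t)) + b (u (t - D)) :=
        coeffsCLM_of_mem_graph hS hA hR hψ L N₀ h1 h2
      have hY : HasDerivWithinAt (fun t => P (X t)) (a (P (X t)) + b (u (t - D)) + P (d' t))
          (Ici 0) t := by
        refine (P.hasFDerivAt.comp_hasDerivWithinAt t h3).congr_deriv ?_
        rw [map_add, h4]
      refine (hasDerivWithinAt_add_delayIntegral a b D huc (Y := fun t => P (X t))
        (g := fun t => P (d' t)) hY).congr_deriv ?_
      rw [add_assoc]
      rfl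
    · refine (hZ t).hasDerivWithinAt.congr_deriv ?_
      simp only [hu, map_smul, add_apply, smul_apply, ContinuousLinearMap.comp_apply, add_assoc]
    · rw [hX0, hZ0, delayIntegral_zero a b hD.le fun t ht => hu0 t ht.2, add_zero]
  refine ⟨X, u, ⟨⟨AX, hAX, fun t ht => ?_⟩, fun t ht => (hX t ht).2.1,
    huc.locallyIntegrable.locallyIntegrableOn _, fun t ht => hu0 t ht.2, fun t ht => ?_, hX0⟩, ?_⟩
  · rw [← hdd ht]
    exact ⟨(hX t ht).1, (hX t ht).2.2⟩
  · rw [artstein_eq, ← hηχ t ht, ← RCLike.real_smul_eq_coe_smul]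
    change η t • Kc (Z t) = η t • Kc (P (X t) + delayIntegral a b D u t)
    exact congrArg (fun z => η t • Kc z) (hZart ht).symm
  intro t δ ht hδ
  have hδ0 : 0 ≤ δ := (norm_nonneg _).trans (hδ 0 ⟨le_rfl, ht⟩)
  have hd's : ∀ s ∈ Icc 0 t, ‖d' s‖ ≤ δ := fun s hs => by
    rw [hdd (mem_Ici.2 hs.1)]
    exact hδ s hs
  have hbase : ∀ s ∈ Icc 0 t, ‖Z s‖ ≤ c * (Real.exp (-κ * s) * ‖X₀‖ + δ) ∧
      ‖u s‖ ≤ c * (Real.exp (-κ * s) * ‖X₀‖ + δ) ∧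
      ‖deriv u s‖ ≤ c * (Real.exp (-κ * s) * ‖X₀‖ + δ) := by
    intro s hs
    have h1 := hest s (‖P‖ * δ) hs.1 fun r hr => P.le_opNorm_of_le (hd's r ⟨hr.1, hr.2.trans hs.2⟩)
    have h2 : Cu * (Real.exp (-κ * s) * ‖P X₀‖ + ‖P‖ * δ) ≤
        c * (Real.exp (-κ * s) * ‖X₀‖ + δ) := by
      calc _ ≤ Cu * (Real.exp (-κ * s) * (‖P‖ * ‖X₀‖) + ‖P‖ * δ) := by
            gcongr
            exact P.le_opNorm X₀
        _ = _ := by ring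
    exact ⟨h1.1.trans h2, h1.2.1.trans h2, h1.2.2.trans h2⟩
  have hshift : ∀ s r, r - D ≤ s → Real.exp (-κ * s) ≤ E * Real.exp (-κ * r) := by
    intro s r hsr
    rw [hE, ← Real.exp_add, Real.exp_le_exp]
    nlinarith
  have hdelay : ∀ s r, r - D ≤ s → s ≤ r → r ≤ t →
      ‖u s‖ ≤ c * (E * Real.exp (-κ * r) * ‖X₀‖ + δ) ∧
      ‖deriv u s‖ ≤ c * (E * Real.exp (-κ * r) * ‖X₀‖ + δ) := by
    intro s r h1 h2 h3
    have h0 : 0 ≤ c * (E * Real.exp (-κ * r) * ‖X₀‖ + δ) := by positivity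
    rcases lt_or_ge s 0 with hs | hs
    · rw [hu0 s hs.le, hderu0 s hs, norm_zero]
      exact ⟨h0, h0⟩
    · obtain ⟨-, h4, h5⟩ := hbase s ⟨hs, h2.trans h3⟩
      have h6 : c * (Real.exp (-κ * s) * ‖X₀‖ + δ) ≤ c * (E * Real.exp (-κ * r) * ‖X₀‖ + δ) := by
        gcongr
        exact hshift s r h1
      exact ⟨h4.trans h6, h5.trans h6⟩
  -- One pair of constants must serve v, v' and d: the coefficient c + 1 covers both c δ from the
  -- input and δ from the disturbance.
  have hXb := hXest t (c * E * ‖X₀‖) ((c + 1) * δ) ht (by positivity) (by positivity)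
    fun s hs => by
      obtain ⟨h1, h2⟩ := hdelay (s - D) s le_rfl (by linarith) hs.2
      have h3 : c * (E * Real.exp (-κ * s) * ‖X₀‖ + δ) ≤
          c * E * ‖X₀‖ * Real.exp (-κ * s) + (c + 1) * δ := by linarith
      have h4 : δ ≤ (c + 1) * δ := by nlinarith
      exact ⟨h1.trans h3, by rw [hderv]; exact h2.trans h3, (hd's s hs).trans h4⟩
  set e := Real.exp (-κ * t) with he
  have hx : 0 ≤ e * ‖X₀‖ := by positivity
  set T := e * ‖X₀‖ + δ with hT
  have hT0 : 0 ≤ T := by positivity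
  have hcE : c * (E * e * ‖X₀‖ + δ) ≤ c * E * T := by
    calc _ ≤ c * (E * e * ‖X₀‖ + E * δ) := by
          gcongr
          exact le_mul_of_one_le_left hδ0 hE1
      _ = _ := by rw [hT]; ring
  have huE : ∀ s ∈ Icc (t - D) t, ‖u s‖ ≤ c * E * T := fun s hs =>
    (hdelay s t hs.1 hs.2 le_rfl).1.trans hcE
  obtain ⟨hZt, hut, -⟩ := hbase t ⟨ht, le_rfl⟩
  have hvt : ‖L.B (v t)‖ ≤ ‖L.B‖ * (c * E * T) :=
    L.B.le_opNorm_of_le (huE _ ⟨le_rfl, by linarith⟩)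
  have hI := hCi u t _ huE
  have hYt : P (X t) = Z t - delayIntegral a b D u t := eq_sub_of_add_eq (hZart ht)
  -- Lift, stable modes and first modes of X - B v; the last are expressed by Z through Artstein's
  -- transform.
  have hsplit : X t = L.B (v t) + tailProj 𝕜 φ ψ N₀ (X t - L.B (v t)) +
      J (Z t - delayIntegral a b D u t - P (L.B (v t))) := by
    rw [← hYt, ← map_sub, add_assoc, tailProj_add_synthCLM]
    abel
  have hJt : ‖J (Z t - delayIntegral a b D u t - P (L.B (v t)))‖ ≤
      ‖J‖ * (c * T + Ci * (c * E * T) + ‖P‖ * (‖L.B‖ * (c * E * T))) := by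
    refine J.le_opNorm_of_le ?_
    refine (norm_sub_le _ _).trans (add_le_add ((norm_sub_le _ _).trans (add_le_add hZt hI)) ?_)
    exact P.le_opNorm_of_le hvt
  have hQ : ‖tailProj 𝕜 φ ψ N₀ (X t - L.B (v t))‖ ≤ Cx * (1 + c * E) * T := by
    refine hXb.trans ?_
    rw [mul_assoc Cx]
    refine mul_le_mul_of_nonneg_left ?_ hCx0
    have h1 : (c + 1) * δ ≤ (1 + c * E) * δ := by
      refine mul_le_mul_of_nonneg_right ?_ hδ0
      have := le_mul_of_one_le_right hc0 hE1
      linarith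
    calc e * (‖X₀‖ + c * E * ‖X₀‖) + (c + 1) * δ = (1 + c * E) * (e * ‖X₀‖) + (c + 1) * δ := by ring
      _ ≤ (1 + c * E) * (e * ‖X₀‖) + (1 + c * E) * δ := by gcongr
      _ = _ := by rw [hT]; ring
  constructor
  · have h1 : ‖X t‖ ≤ ‖L.B‖ * (c * E * T) + Cx * (1 + c * E) * T +
        ‖J‖ * (c * T + Ci * (c * E * T) + ‖P‖ * (‖L.B‖ * (c * E * T))) := by
      conv_lhs => rw [hsplit]
      exact (norm_add_le _ _).trans (add_le_add ((norm_add_le _ _).trans (add_le_add hvt hQ)) hJt)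
    have h2 : 0 ≤ c * T := by positivity
    linarith
  · have h1 : 0 ≤ (‖L.B‖ * (c * E) + Cx * (1 + c * E) +
        ‖J‖ * (c + Ci * (c * E) + ‖P‖ * (‖L.B‖ * (c * E)))) * T := by positivity
    linarith

end Main

end DelayBoundaryControl
end

open DelayBoundaryControl in
theorem theorem1 {𝕜 : Type*} [RCLike 𝕜] {H : Type*} [NormedAddCommGroup H]
    [InnerProductSpace 𝕜 H] [NormedSpace ℝ H] [IsScalarTower ℝ 𝕜 H] [CompleteSpace H]
    [TopologicalSpace.SeparableSpace H] {m : ℕ}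
    -- a boundary control system with a lifting operator
    (A : H →ₗ.[𝕜] H) (𝓑 : H →ₗ.[𝕜] EuclideanSpace 𝕜 (Fin m))
    (hsys : IsBoundaryControlSystem A 𝓑) (L : LiftingOperator A 𝓑)
    -- (A1), with the biorthogonal sequence
    (lam : ℕ → 𝕜) (φ ψ : ℕ → H) (hA1 : IsRieszSpectral (disturbanceFree A 𝓑) lam φ)
    (hψ : IsBiorthogonal 𝕜 φ ψ)
    -- (A2); the indices start at 0
    (N₀ : ℕ) (hN₀ : 1 ≤ N₀) (α : ℝ) (hα : 0 < α)
    (hA2 : ∀ n, N₀ ≤ n → RCLike.re (lam n) ≤ -α)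
    -- (A3)
    (hA3 : KalmanCondition (truncA lam N₀) (truncB L lam ψ N₀))
    (D : ℝ) (hD : 0 < D) :
    (∃ K : Matrix (Fin m) (Fin N₀) 𝕜,
      IsHurwitz (closedLoopMatrix (truncA lam N₀) (truncB L lam ψ N₀) D K)) ∧
    ∀ K : Matrix (Fin m) (Fin N₀) 𝕜,
      IsHurwitz (closedLoopMatrix (truncA lam N₀) (truncB L lam ψ N₀) D K) →
      ∃ κ₀ : ℝ, 0 < κ₀ ∧ ∀ (t₀ : ℝ) (χ : ℝ → ℝ), 0 < t₀ → IsTransition D t₀ χ →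
        ∃ C₁ C₂ C₃ C₄ : ℝ, 0 ≤ C₁ ∧ 0 ≤ C₂ ∧ 0 ≤ C₃ ∧ 0 ≤ C₄ ∧
          ∀ (X₀ : H) (d : ℝ → H), X₀ ∈ (disturbanceFree A 𝓑).domain →
            ContDiffOn ℝ 1 d (Ici 0) →
            ∃ (X : ℝ → H) (u : ℝ → EuclideanSpace 𝕜 (Fin m)),
              IsClosedLoopSolution L lam ψ N₀ D K χ X₀ d X u ∧
              (∀ X' u', IsClosedLoopSolution L lam ψ N₀ D K χ X₀ d X' u' →
                EqOn X' X (Ici 0) ∧ EqOn u' u (Ici (-D))) ∧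
              ∀ t : ℝ, 0 ≤ t →
                ‖X t‖ ≤ C₁ * Real.exp (-κ₀ * t) * ‖X₀‖
                  + C₂ * sSup ((fun τ => ‖d τ‖) '' Icc 0 t) ∧
                ‖u t‖ ≤ C₃ * Real.exp (-κ₀ * t) * ‖X₀‖
                  + C₄ * sSup ((fun τ => ‖d τ‖) '' Icc 0 t) := by
  have _ : NeZero N₀ := ⟨by omega⟩
  obtain ⟨S, hS, hA⟩ := hsys.generates
  refine ⟨exists_isHurwitz_closedLoopMatrix _ _ hA3 D, fun K hK => ?_⟩
  obtain ⟨κ, C, hκ, hC0, hC⟩ := hK.exists_norm_exp_le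
  -- Halving α keeps the rate strictly below α, as the convolution estimate on the stable modes
  -- requires.
  have hκ₀ : 0 < min κ (α / 2) := lt_min hκ (by positivity)
  refine ⟨min κ (α / 2), hκ₀, fun t₀ χ ht₀ hχ => ?_⟩
  have hC' : ∀ t : ℝ, 0 ≤ t → ‖NormedSpace.exp
      (t • matCLM (closedLoopMatrix (truncA lam N₀) (truncB L lam ψ N₀) D K))‖ ≤
        C * Real.exp (-(min κ (α / 2)) * t) := by
    intro t ht
    refine (hC t ht).trans ?_
    gcongr
    exact min_le_left _ _
  obtain ⟨C', hC'0, h⟩ := exists_isClosedLoopSolution hS hA hA1 hψ L hκ₀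
    ((min_le_right _ _).trans_lt (half_lt_self hα)) hA2 hD K hC0 hC' ht₀ hχ
  refine ⟨C', C', C', C', hC'0, hC'0, hC'0, hC'0, fun X₀ d hX₀ hd => ?_⟩
  obtain ⟨X, u, hXu, hest⟩ := h X₀ d hX₀ hd
  have hsub : Ici (0 : ℝ) ⊆ Ici (-D) := Ici_subset_Ici.2 (by linarith)
  refine ⟨X, u, hXu, fun X' u' h' => h'.unique hS hA hA1 hψ hD
    (hχ.contDiffOn.continuousOn.mono hsub) (fun t ht => hχ.mem_Icc t (hsub ht)) hXu,
    fun t ht => ?_⟩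
  have hbdd : BddAbove ((fun τ => ‖d τ‖) '' Icc 0 t) :=
    isCompact_Icc.bddAbove_image (hd.continuousOn.mono Icc_subset_Ici_self).norm
  have h1 := hest t (sSup ((fun τ => ‖d τ‖) '' Icc 0 t)) ht
    fun s hs => le_csSup hbdd ⟨s, hs, rfl⟩
  rwa [mul_add, ← mul_assoc] at h1
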